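/- Let $\mathcal{A}=(\alpha,\mu,\beta)$ be a $\mathbb{Q}$-weighted automaton of dimension $n$ over a finite alphabet $\Sigma$, i.e. $\alpha\in\mathbb{Q}^{1\times n}$, $\mu(\sigma)\in\mathbb{Q}^{n\times n}$ for $\sigma\in\Sigma$, and $\beta\in\mathbb{Q}^{n\times 1}$; extend $\mu$ to $\Sigma^*$ by $\mu(\varepsilon)=I_n$ and $\mu(w\sigma)=\mu(w)\mu(\sigma)$. Consider the following procedure $\mathtt{Z\_generators}(\mathcal{A})$. 1. Put $W:=\{\varepsilon\}$. 2. While there is $(w,\sigma)\in W\times\Sigma$ with $\alpha\mu(w\sigma)\notin\langle \alpha\mu(u):u\in W\rangle_{\mathbb{Q}}$, choose such a pair and put $W:=W\cup\{w\sigma\}$; if $\alpha\mu(w\sigma)\notin\mathbb{Z}^n$, stop and return the word $w\sigma$. 3. While there is $(w,\sigma)\in W\times\Sigma$ with $\alpha\mu(w\sigma)\notin\langle \alpha\mu(u):u\in W\rangle_{\mathbb{Z}}$, choose such a pair and put $W:=W\cup\{w\sigma\}$; if $\alpha\mu(w\sigma)\notin\mathbb{Z}^n$, stop and return the word $w\sigma$.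 4. Return $W$. This procedure is a polynomial-time algorithm: whatever choices are made, it stops with an output after a number of steps (loop iterations and loop exits) that is bounded by a fixed polynomial in the length of the encoding of $\mathcal{A}$ (rationals written in binary), and it can be carried out by a single program whose bit cost is bounded by a polynomial in that length; that is, on the encoding of each $\mathcal{A}$ this program outputs, within that cost, the encoding of an output that the procedure can return on $\mathcal{A}$. Every output of the procedure is either a finite set of words $W\subseteq\Sigma^*$ that generates the forward module of $\mathcal{A}$, namely \[\langle \alpha\mu(w):w\in W\rangle_{\mathbb{Z}}=\langle \alpha\mu(w):w\in\Sigma^*\rangle_{\mathbb{Z}},\] or else a word $w\in\Sigma^*$ such that $\alpha\mu(w)\notin\mathbb{Z}^n$. -/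

import Mathlib

/-! ## Rational weighted automata -/

/-- A `ℚ`-weighted automaton `(α, μ, β)` of dimension `n` over the alphabet `S`. -/
structure QAutomaton (S : Type*) (n : ℕ) where
  /-- the initial row vector `α` -/
  init : Fin n → ℚ
  /-- the transition matrices `μ` -/
  trans : S → Matrix (Fin n) (Fin n) ℚ
  /-- the final column vector `β` -/
  final : Fin n → ℚ

namespace QAutomaton

variable {S : Type*} {n : ℕ}

/-- The extension of `μ` to words: `μ(ε) = 1` and `μ(wσ) = μ(w) μ(σ)`. -/
def wordTrans (A : QAutomaton S n) (w : List S) : Matrix (Fin n) (Fin n) ℚ :=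
  (w.map A.trans).prod

/-- The forward vector `α μ(w)`. -/
def forward (A : QAutomaton S n) (w : List S) : Fin n → ℚ :=
  Matrix.vecMul A.init (A.wordTrans w)

/-- The forward module: the `ℤ`-span of all forward vectors. -/
def forwardModule (A : QAutomaton S n) : Submodule ℤ (Fin n → ℚ) :=
  Submodule.span ℤ (Set.range A.forward)

/-- The `R`-span of the forward vectors of the words that occur in the list `W`
(used with `R = ℚ` and `R = ℤ`). -/
def spanOf (R : Type*) [Semiring R] [Module R (Fin n → ℚ)]
    (A : QAutomaton S n) (W : List (List S)) : Submodule R (Fin n → ℚ) :=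
  Submodule.span R (A.forward '' {w | w ∈ W})

end QAutomaton

/-- All entries of the rational vector are integers. -/
def IsIntegerVector {n : ℕ} (v : Fin n → ℚ) : Prop :=
  ∀ i, ∃ z : ℤ, v i = z

/-! ## The procedure `Z_generators`

The finite set `W` of words is kept as a list, the most recently added word first. A word is
only added if its forward vector lies outside the current span, so the list has no repetitions. -/

/-- What the procedure can return: a finite set of words, or a single word. -/
inductive ZGenOutput (S : Type*) where
  | generators (W : List (List S))
  | counterexample (w : List S)

/-- The configurations of the procedure: inside the first loop, inside the second loop, or
stopped with an output. -/
inductive ZGenState (S : Type*) where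
  | rankLoop (W : List (List S))
  | moduleLoop (W : List (List S))
  | done (out : ZGenOutput S)

/-- One step of the procedure: one iteration of a while-loop, or leaving a while-loop because its
guard fails. The choice of the pair `(w, σ)` in the guard is nondeterministic. -/
inductive ZGenStep {S : Type*} {n : ℕ} (A : QAutomaton S n) : ZGenState S → ZGenState S → Prop where
  | rank_add {W : List (List S)} {w : List S} {σ : S} (hw : w ∈ W)
      (hnew : A.forward (w ++ [σ]) ∉ A.spanOf ℚ W)
      (hint : IsIntegerVector (A.forward (w ++ [σ]))) :
      ZGenStep A (.rankLoop W) (.rankLoop ((w ++ [σ]) :: W))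
  | rank_return {W : List (List S)} {w : List S} {σ : S} (hw : w ∈ W)
      (hnew : A.forward (w ++ [σ]) ∉ A.spanOf ℚ W)
      (hint : ¬ IsIntegerVector (A.forward (w ++ [σ]))) :
      ZGenStep A (.rankLoop W) (.done (.counterexample (w ++ [σ])))
  | rank_exit {W : List (List S)}
      (hclosed : ∀ w ∈ W, ∀ σ : S, A.forward (w ++ [σ]) ∈ A.spanOf ℚ W) :
      ZGenStep A (.rankLoop W) (.moduleLoop W)
  | module_add {W : List (List S)} {w : List S} {σ : S} (hw : w ∈ W)
      (hnew : A.forward (w ++ [σ]) ∉ A.spanOf ℤ W)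
      (hint : IsIntegerVector (A.forward (w ++ [σ]))) :
      ZGenStep A (.moduleLoop W) (.moduleLoop ((w ++ [σ]) :: W))
  | module_return {W : List (List S)} {w : List S} {σ : S} (hw : w ∈ W)
      (hnew : A.forward (w ++ [σ]) ∉ A.spanOf ℤ W)
      (hint : ¬ IsIntegerVector (A.forward (w ++ [σ]))) :
      ZGenStep A (.moduleLoop W) (.done (.counterexample (w ++ [σ])))
  | module_exit {W : List (List S)}
      (hclosed : ∀ w ∈ W, ∀ σ : S, A.forward (w ++ [σ]) ∈ A.spanOf ℤ W) :
      ZGenStep A (.moduleLoop W) (.done (.generators W))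

/-- `ZGenRun A m s`: some run of the procedure on `A` is in the configuration `s` after exactly
`m` steps. The procedure starts in the first loop with `W = {ε}`. -/
inductive ZGenRun {S : Type*} {n : ℕ} (A : QAutomaton S n) : ℕ → ZGenState S → Prop where
  | start : ZGenRun A 0 (.rankLoop [[]])
  | step {m : ℕ} {s s' : ZGenState S} : ZGenRun A m s → ZGenStep A s s' → ZGenRun A (m + 1) s'

/-- Some run of the procedure on `A` stops with the output `out`. -/
def ZGenReturns {S : Type*} {n : ℕ} (A : QAutomaton S n) (out : ZGenOutput S) : Prop :=
  ∃ m, ZGenRun A m (.done out)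

/-! ## A model of computation with bit cost

Deterministic while-programs over data built from integers by pairing. Only elementary operations
are available: integer arithmetic, comparison, forming and splitting pairs. An elementary operation
applied to data of bit size `s` costs `s ^ 2` (this covers schoolbook multiplication and division),
and wherever a program uses its input a second time the copy is charged as well. Hence the size of
everything that is computed is linearly bounded by the cost for a fixed program, and the cost is
polynomially related to the running time on a Turing machine. -/

/-- The data on which programs work. -/
inductive Datum where
  | int (z : ℤ)
  | pair (a b : Datum)

namespace Datum

/-- The bit size: the binary length of every integer, plus one for its sign, plus one for every
pairing. -/
def size : Datum → ℕ
  | int z => z.natAbs.size + 1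
  | pair a b => a.size + b.size + 1

/-- A list as iterated pairs, closed by the integer `0`. -/
def list : List Datum → Datum
  | [] => int 0
  | a :: l => pair a (list l)

/-- A rational number, as its numerator and denominator in lowest terms. -/
def rat (q : ℚ) : Datum :=
  pair (int q.num) (int q.den)

/-- A rational vector. -/
def vec {n : ℕ} (v : Fin n → ℚ) : Datum :=
  list (List.ofFn fun i => rat (v i))

/-- A rational matrix, as the list of its rows. -/
def mat {m n : ℕ} (M : Matrix (Fin m) (Fin n) ℚ) : Datum :=
  list (List.ofFn fun i => vec (M i))

/-- The truth value `1` or `0`. -/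
def ofBool (b : Bool) : Datum :=
  int (if b then 1 else 0)

end Datum

/-- The elementary operations. -/
inductive ElemOp where
  | id
  | const (z : ℤ)
  | fst
  | snd
  | isPair
  | add
  | sub
  | mul
  | div
  | mod
  | le

/-- The effect of an elementary operation; on data of the wrong shape the result is `0`. -/
def ElemOp.apply : ElemOp → Datum → Datum
  | id, x => x
  | const z, _ => .int z
  | fst, .pair a _ => a
  | snd, .pair _ b => b
  | isPair, .pair _ _ => .int 1
  | add, .pair (.int a) (.int b) => .int (a + b)
  | sub, .pair (.int a) (.int b) => .int (a - b)
  | mul, .pair (.int a) (.int b) => .int (a * b)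
  | div, .pair (.int a) (.int b) => .int (a / b)
  | mod, .pair (.int a) (.int b) => .int (a % b)
  | le, .pair (.int a) (.int b) => .ofBool (decide (a ≤ b))
  | _, _ => .int 0

/-- While-programs; each maps one input to at most one result. -/
inductive WhileProgram where
  /-- an elementary operation -/
  | op (f : ElemOp)
  /-- first `p`, then `q` on the result -/
  | seq (p q : WhileProgram)
  /-- the pair of the results of `p` and `q` on the same input -/
  | pair (p q : WhileProgram)
  /-- `p` if the test `c` gives a value other than `0`, and `q` otherwise -/
  | ite (c p q : WhileProgram)
  /-- replace the current value by its image under `p` as long as the test `c`, applied to the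
  current value, gives a value other than `0` -/
  | loop (c p : WhileProgram)

/-- `p.Halts x y t`: on the input `x` the program `p` halts with the result `y`, and the run
costs `t` bit operations. -/
inductive WhileProgram.Halts : WhileProgram → Datum → Datum → ℕ → Prop where
  | op (f : ElemOp) (x : Datum) : Halts (.op f) x (f.apply x) (x.size ^ 2)
  | seq {p q : WhileProgram} {x y z : Datum} {t u : ℕ} :
      Halts p x y t → Halts q y z u → Halts (.seq p q) x z (t + u)
  | pair {p q : WhileProgram} {x y z : Datum} {t u : ℕ} :
      Halts p x y t → Halts q x z u → Halts (.pair p q) x (.pair y z) (t + u + x.size)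
  | ite_true {c p q : WhileProgram} {x v y : Datum} {t u : ℕ} :
      Halts c x v t → v ≠ .int 0 → Halts p x y u → Halts (.ite c p q) x y (t + u + x.size)
  | ite_false {c p q : WhileProgram} {x y : Datum} {t u : ℕ} :
      Halts c x (.int 0) t → Halts q x y u → Halts (.ite c p q) x y (t + u + x.size)
  | loop_exit {c p : WhileProgram} {x : Datum} {t : ℕ} :
      Halts c x (.int 0) t → Halts (.loop c p) x x (t + x.size)
  | loop_next {c p : WhileProgram} {x v y z : Datum} {t u s : ℕ} :
      Halts c x v t → v ≠ .int 0 → Halts p x y u → Halts (.loop c p) y z s →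
      Halts (.loop c p) x z (t + u + s + x.size)

/-! ## Encodings -/

/-- The encoding of an automaton over an alphabet whose letters are numbered by `e`: the dimension,
the number of letters, `α`, the matrices `μ(σ)` in the order of the numbering, and `β`. -/
def QAutomaton.encode {S : Type*} {k n : ℕ} (e : Fin k ≃ S) (A : QAutomaton S n) : Datum :=
  .list [.int n, .int k, .vec A.init, .list (List.ofFn fun i => .mat (A.trans (e i))),
    .vec A.final]

/-- A word, as the list of the numbers of its letters. -/
def Datum.word {S : Type*} {k : ℕ} (e : Fin k ≃ S) (w : List S) : Datum :=
  .list (w.map fun σ => .int ((e.symm σ : ℕ) : ℤ))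

/-- An output of the procedure: the kind of output (`0` or `1`), then the words or the word. -/
def ZGenOutput.encode {S : Type*} {k : ℕ} (e : Fin k ≃ S) : ZGenOutput S → Datum
  | generators W => .pair (.int 0) (.list (W.map (Datum.word e)))
  | counterexample w => .pair (.int 1) (Datum.word e w)

/-! ## Polynomially bounded quantities -/

/-! Correctness. A word is returned only when its forward vector is not integral. When the second
loop is left, the ℤ-span of the vectors of `W` contains `α` and is mapped into itself by every
`μ(σ)`, so it contains every forward vector (`forward_mem_of_closed`).

Number of steps. Each word added in the first loop raises the rational dimension, so at most `n` are
added. Let `d` be a common denominator of `α` and `μ`. Every word of `W` except `ε` has an integral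
forward vector, so all vectors `d·αμ(w)` with `w ∈ W` lie in `ℤⁿ`; `α` itself may be fractional. At
the end of the first loop choose a maximal independent family `U` among them, let `D = det(UUᵀ)`,
and let `P = D·1 - Uᵀ adj(UUᵀ) U`, which is `D` times the orthogonal projection onto the complement
of the rows. The lattice `L(W) = ⟨d·αμ(w) : w ∈ W⟩ + Pℤⁿ` contains `Dℤⁿ`, since `Dx = Uᵀ adj(UUᵀ) U
x + Px`, so its index in `ℤⁿ` is at most `Dⁿ`. Because `P² = DP` and `P` kills the rational span,
adding `Pℤⁿ` puts no further vectors of that span into the lattice (`mem_projLattice_iff`). Hence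
every word added in the second loop strictly enlarges `L(W)` and at least halves its index, and
there are at most `n log₂ D` such words. The words behind `U` have length at most `n`, so `log₂ D`
is polynomial in the input (`RankInv.bounds`).

Bit cost. The program computes with integers only. The rational test is whether `P` kills the
candidate; `D` and `P` are updated by a rank-one formula with an exact division by the old
determinant (`gramProj_addRow`), so they remain subdeterminant expressions of bounded size. The
integral test uses a triangular basis of `L(W)`. A vector is inserted by the Euclidean algorithm on
leading entries, and since `Dℤⁿ ⊆ L(W)` everything may be reduced modulo `D`, which keeps the
entries short (`insert_spec`, `RowBdd`). The program follows one admissible sequence of choices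
(`Sim.step`), so the bound on arbitrary runs also bounds its iterations, and with it the sizes of
its states (`Data.size_le`).

Polynomial cost is obtained from a calculus of functions computed by while-programs: `PolyTime` is
closed under composition, because a result is at most linearly longer than the cost of producing it,
and under folds and loops whose intermediate values have polynomial size. -/

theorem Polynomial.eval_nat_mono (p : Polynomial ℕ) : Monotone fun x : ℕ => p.eval x := by
  intro a b h
  simp only [Polynomial.eval_eq_sum_range]
  gcongr

/-- `g` is bounded by a polynomial in `s`. -/
def PolyBdd {ι : Type*} (s g : ι → ℕ) : Prop :=
  ∃ p : Polynomial ℕ, ∀ i, g i ≤ p.eval (s i)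

namespace PolyBdd

variable {ι : Type*} {s g h : ι → ℕ}

theorem self : PolyBdd s s := ⟨Polynomial.X, fun i => by simp⟩

theorem const (c : ℕ) : PolyBdd s fun _ => c := ⟨Polynomial.C c, fun i => by simp⟩

theorem mono (hg : PolyBdd s g) (hh : ∀ i, h i ≤ g i) : PolyBdd s h :=
  let ⟨p, hp⟩ := hg
  ⟨p, fun i => (hh i).trans (hp i)⟩

theorem add (hg : PolyBdd s g) (hh : PolyBdd s h) : PolyBdd s fun i => g i + h i := by
  obtain ⟨p, hp⟩ := hg
  obtain ⟨q, hq⟩ := hh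
  exact ⟨p + q, fun i => by simpa using add_le_add (hp i) (hq i)⟩

theorem mul (hg : PolyBdd s g) (hh : PolyBdd s h) : PolyBdd s fun i => g i * h i := by
  obtain ⟨p, hp⟩ := hg
  obtain ⟨q, hq⟩ := hh
  exact ⟨p * q, fun i => by simpa using Nat.mul_le_mul (hp i) (hq i)⟩

theorem pow (hg : PolyBdd s g) (k : ℕ) : PolyBdd s fun i => g i ^ k := by
  obtain ⟨p, hp⟩ := hg
  exact ⟨p ^ k, fun i => by simpa using Nat.pow_le_pow_left (hp i) k⟩

theorem eval (hg : PolyBdd s g) (p : Polynomial ℕ) : PolyBdd s fun i => p.eval (g i) := by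
  obtain ⟨q, hq⟩ := hg
  exact ⟨p.comp q, fun i => by simpa using p.eval_nat_mono (hq i)⟩

end PolyBdd

/-! ## Encodings of types as data -/

/-- A type whose elements are represented by data. -/
class DatumEnc (α : Type*) where
  /-- the datum that represents an element -/
  enc : α → Datum

namespace DatumEnc

instance : DatumEnc Datum := ⟨fun x => x⟩
instance : DatumEnc ℤ := ⟨Datum.int⟩
instance : DatumEnc ℕ := ⟨fun n => Datum.int n⟩
instance : DatumEnc Bool := ⟨Datum.ofBool⟩
instance : DatumEnc ℚ := ⟨Datum.rat⟩
instance {α β : Type*} [DatumEnc α] [DatumEnc β] : DatumEnc (α × β) :=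
  ⟨fun x => .pair (enc x.1) (enc x.2)⟩
instance {α : Type*} [DatumEnc α] : DatumEnc (List α) := ⟨fun l => .list (l.map enc)⟩

/-- The bit size of the encoding. -/
def size {α : Type*} [DatumEnc α] (a : α) : ℕ := (enc a).size

variable {α β : Type*} [DatumEnc α] [DatumEnc β]

@[simp] theorem enc_mk (a : α) (b : β) : enc (a, b) = .pair (enc a) (enc b) := rfl
@[simp] theorem enc_nil : enc ([] : List α) = .int 0 := rfl
@[simp] theorem enc_cons (a : α) (l : List α) : enc (a :: l) = .pair (enc a) (enc l) := rfl
@[simp] theorem enc_int (z : ℤ) : enc z = .int z := rfl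
@[simp] theorem enc_true : enc true = .int 1 := rfl
@[simp] theorem enc_false : enc false = .int 0 := rfl

@[simp] theorem size_mk (a : α) (b : β) : size (a, b) = size a + size b + 1 := rfl
@[simp] theorem size_nil : size ([] : List α) = 1 := rfl
@[simp] theorem size_cons (a : α) (l : List α) : size (a :: l) = size a + size l + 1 := rfl
theorem size_int (z : ℤ) : size z = z.natAbs.size + 1 := rfl

theorem _root_.Datum.size_pos (x : Datum) : 0 < x.size := by
  cases x <;> simp [Datum.size]

theorem size_pos (a : α) : 0 < size a := Datum.size_pos _

theorem size_append (l l' : List α) : size (l ++ l') + 1 = size l + size l' := by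
  induction l with
  | nil => simp [add_comm]
  | cons a l ih => simp only [List.cons_append, size_cons]; omega

theorem length_lt_size (l : List α) : l.length < size l := by
  induction l with
  | nil => simp
  | cons a l ih => simp only [List.length_cons, size_cons]; omega

theorem size_le_of_mem {a : α} {l : List α} (h : a ∈ l) : size a < size l := by
  induction l with
  | nil => simp at h
  | cons b l ih =>
    rcases List.mem_cons.1 h with rfl | h
    · simp only [size_cons]; omega
    · have := ih h; simp only [size_cons]; omega

theorem size_list_le {l : List α} {B : ℕ} (h : ∀ a ∈ l, size a ≤ B) :
    size l ≤ l.length * (B + 1) + 1 := by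
  induction l with
  | nil => simp
  | cons a l ih =>
    have h1 := h a (by simp)
    have h2 := ih fun b hb => h b (by simp [hb])
    simp only [size_cons, List.length_cons]; nlinarith

theorem size_reverse (l : List α) : size l.reverse = size l := by
  induction l with
  | nil => rfl
  | cons a l ih =>
    have := size_append l.reverse [a]
    simp only [List.reverse_cons, size_cons, size_nil] at *; omega

theorem size_int_le {z : ℤ} {b : ℕ} (h : z.natAbs < 2 ^ b) : size z ≤ b + 1 := by
  rw [size_int]; have := Nat.size_le.2 h; omega

theorem natAbs_lt_two_pow_size (z : ℤ) : z.natAbs + 1 ≤ 2 ^ (size z - 1) := by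
  rw [size_int]; exact Nat.lt_size_self _

theorem size_add_le (a b : ℤ) : size (a + b) ≤ size a + size b := by
  have h1 := natAbs_lt_two_pow_size a
  have h2 := natAbs_lt_two_pow_size b
  have := size_pos a
  have := size_pos b
  have h3 : (a + b).natAbs < 2 ^ ((size a - 1) + (size b - 1) + 1) := by
    have h4 := Int.natAbs_add_le a b
    have h5 : 2 ^ (size a - 1) ≤ 2 ^ ((size a - 1) + (size b - 1)) :=
      Nat.pow_le_pow_right (by norm_num) (by omega)
    have h6 : 2 ^ (size b - 1) ≤ 2 ^ ((size a - 1) + (size b - 1)) :=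
      Nat.pow_le_pow_right (by norm_num) (by omega)
    rw [pow_succ]; omega
  have := size_int_le h3
  omega

theorem size_neg (a : ℤ) : size (-a) = size a := by simp [size_int]

theorem size_sub_le (a b : ℤ) : size (a - b) ≤ size a + size b := by
  rw [sub_eq_add_neg, ← size_neg b]; exact size_add_le _ _

theorem size_mul_le (a b : ℤ) : size (a * b) ≤ size a + size b := by
  have h1 := natAbs_lt_two_pow_size a
  have h2 := natAbs_lt_two_pow_size b
  have := size_pos a
  have := size_pos b
  have h3 : (a * b).natAbs < 2 ^ ((size a - 1) + (size b - 1)) := by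
    rw [Int.natAbs_mul, pow_add]
    exact Nat.mul_lt_mul'' (by omega) (by omega)
  have := size_int_le h3
  omega

theorem size_mono {a b : ℤ} (h : a.natAbs ≤ b.natAbs) : size a ≤ size b := by
  rw [size_int, size_int]; have := Nat.size_le_size h; omega

theorem size_div_le (a b : ℤ) : size (a / b) ≤ size a + size b := by
  have := size_mono (Int.natAbs_ediv_le_natAbs a b)
  omega

theorem size_mod_le (a b : ℤ) : size (a % b) ≤ size a + size b := by
  rcases eq_or_ne b 0 with rfl | hb
  · simp
  · have h1 := Int.emod_nonneg a hb
    have h2 := Int.emod_lt_abs a hb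
    rw [Int.abs_eq_natAbs] at h2
    have := size_mono (a := a % b) (b := b) (by omega)
    omega

end DatumEnc

/-! ### Sizes of results in terms of cost. -/

open DatumEnc

/-- Results of integer arithmetic are no longer than the two operands together; the additive
constant absorbs the literal of `const` and the truth values. -/
theorem ElemOp.size_apply_le (f : ElemOp) : ∃ c, ∀ x, (f.apply x).size ≤ x.size + c := by
  have h0 : ∀ (x : Datum) (c : ℕ), (Datum.int 0).size ≤ x.size + c := fun x c => by
    have := x.size_pos; simp [Datum.size]; omega
  have hint : ∀ (g : ElemOp) (op : ℤ → ℤ → ℤ),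
      (∀ a b, g.apply (.pair (.int a) (.int b)) = .int (op a b)) →
      (∀ x, (∀ a b, x ≠ .pair (.int a) (.int b)) → g.apply x = .int 0) →
      (∀ a b, DatumEnc.size (op a b) ≤ DatumEnc.size a + DatumEnc.size b) →
      ∃ c, ∀ x, (g.apply x).size ≤ x.size + c := by
    intro g op h1 h2 h3
    refine ⟨0, fun x => ?_⟩
    by_cases hx : ∃ a b, x = .pair (.int a) (.int b)
    · obtain ⟨a, b, rfl⟩ := hx
      rw [h1]
      exact (h3 a b).trans (by simp [Datum.size, DatumEnc.size])
    · push Not at hx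
      rw [h2 x hx]; exact h0 x 0
  have hbad : ∀ (g : ElemOp), (g = .add ∨ g = .sub ∨ g = .mul ∨ g = .div ∨ g = .mod) →
      ∀ x, (∀ a b, x ≠ .pair (.int a) (.int b)) → g.apply x = .int 0 := by
    intro g hg x hx
    rcases hg with rfl | rfl | rfl | rfl | rfl <;> rcases x with z | ⟨_ | ⟨_, _⟩, _ | ⟨_, _⟩⟩ <;>
      first | rfl | exact absurd rfl (hx _ _)
  cases f with
  | id => exact ⟨0, fun x => by simp [ElemOp.apply]⟩
  | const z =>
    refine ⟨(Datum.int z).size, fun x => ?_⟩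
    simp [ElemOp.apply]
  | fst =>
    refine ⟨0, fun x => ?_⟩
    cases x
    · exact h0 _ _
    · simp [ElemOp.apply, Datum.size]; omega
  | snd =>
    refine ⟨0, fun x => ?_⟩
    cases x
    · exact h0 _ _
    · simp [ElemOp.apply, Datum.size]; omega
  | isPair =>
    refine ⟨1, fun x => ?_⟩
    cases x
    · exact h0 _ _
    · simp [ElemOp.apply, Datum.size]
  | add => exact hint .add (· + ·) (fun _ _ => rfl) (hbad _ (by simp)) size_add_le
  | sub => exact hint .sub (· - ·) (fun _ _ => rfl) (hbad _ (by simp)) size_sub_le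
  | mul => exact hint .mul (· * ·) (fun _ _ => rfl) (hbad _ (by simp)) size_mul_le
  | div => exact hint .div (· / ·) (fun _ _ => rfl) (hbad _ (by simp)) size_div_le
  | mod => exact hint .mod (· % ·) (fun _ _ => rfl) (hbad _ (by simp)) size_mod_le
  | le =>
    refine ⟨1, fun x => ?_⟩
    have h1 : ∀ b, (Datum.ofBool b).size ≤ 2 := by decide
    have := x.size_pos
    rcases x with z | ⟨a | _, b | _⟩
    · exact h0 _ _
    · exact (h1 _).trans (by omega)
    all_goals exact h0 _ _

/-- The result of a program is at most linearly larger than the cost of the run. -/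
theorem WhileProgram.size_le_cost (P : WhileProgram) :
    ∃ c, ∀ x y t, P.Halts x y t → y.size ≤ c * t := by
  have key : ∀ {P : WhileProgram} {c : ℕ}, 1 ≤ c → (∀ x y t, P.Halts x y t → y.size ≤ c * t) →
    ∀ c' ≥ c, ∀ x y t, P.Halts x y t → y.size ≤ c' * t := fun _ h c' hc x y t hP =>
      (h x y t hP).trans (Nat.mul_le_mul_right _ hc)
  suffices h : ∃ c, 1 ≤ c ∧ ∀ x y t, P.Halts x y t → y.size ≤ c * t from
    let ⟨c, _, h⟩ := h; ⟨c, h⟩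
  induction P with
  | op f =>
    obtain ⟨c, hc⟩ := f.size_apply_le
    refine ⟨c + 1, by omega, ?_⟩
    rintro x y t ⟨⟩
    have := x.size_pos
    refine (hc x).trans ?_
    -- Sizes are positive, so the charged square dominates both the size and the constant.
    nlinarith [Nat.zero_le c, Nat.mul_le_mul_left c (Nat.one_le_pow 2 x.size this)]
  | seq p q _ hq =>
    obtain ⟨c, hc, hq⟩ := hq
    refine ⟨c, hc, ?_⟩
    rintro x y t ⟨⟩
    rename_i h1 h2
    exact (hq _ _ _ h2).trans (Nat.mul_le_mul_left _ (by omega))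
  | pair p q hp hq =>
    obtain ⟨c, hc, hp⟩ := hp
    obtain ⟨c', hc', hq⟩ := hq
    refine ⟨c + c', by omega, ?_⟩
    rintro x y t ⟨⟩
    rename_i h1 h2
    have := key hc hp (c + c') (by omega) _ _ _ h1
    have := key hc' hq (c + c') (by omega) _ _ _ h2
    have := x.size_pos
    simp only [Datum.size]
    nlinarith
  | ite b p q _ hp hq =>
    obtain ⟨c, hc, hp⟩ := hp
    obtain ⟨c', hc', hq⟩ := hq
    refine ⟨c + c', by omega, ?_⟩
    rintro x y t ⟨⟩
    · rename_i h1
      exact (key hc hp (c + c') (by omega) _ _ _ h1).trans (Nat.mul_le_mul_left _ (by omega))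
    · rename_i h1
      exact (key hc' hq (c + c') (by omega) _ _ _ h1).trans (Nat.mul_le_mul_left _ (by omega))
  | loop b p _ _ =>
    -- The final value of a loop is the argument of the last, failing test, where its size is
    -- charged as a copy.
    refine ⟨1, le_rfl, ?_⟩
    intro x y t h
    generalize hP : WhileProgram.loop b p = P at h
    induction h with
    | loop_exit => omega
    | loop_next _ _ _ _ _ _ ih => have := ih hP; omega
    | _ => cases hP

/-- `f` is computed by a while-program whose cost is polynomial in the size of the argument. -/
@[fun_prop]
def PolyTime {α β : Type} [DatumEnc α] [DatumEnc β] (f : α → β) : Prop :=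
  ∃ (P : WhileProgram) (p : Polynomial ℕ), ∀ a, ∃ t, P.Halts (enc a) (enc (f a)) t ∧ t ≤ p.eval (size a)

/-! ### Closure properties of polynomial-time functions. -/

namespace PolyTime

variable {α β γ δ : Type} [DatumEnc α] [DatumEnc β] [DatumEnc γ] [DatumEnc δ]

theorem of_bdd {f : α → β} (P : WhileProgram) {g : α → ℕ} (hg : PolyBdd size g)
    (h : ∀ a, ∃ t, P.Halts (enc a) (enc (f a)) t ∧ t ≤ g a) : PolyTime f := by
  obtain ⟨p, hp⟩ := hg
  exact ⟨P, p, fun a => let ⟨t, h1, h2⟩ := h a; ⟨t, h1, h2.trans (hp a)⟩⟩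

theorem congr {f g : α → β} (hf : PolyTime f) (h : ∀ a, f a = g a) : PolyTime g :=
  funext h ▸ hf

/-- This is what makes composition work: the second program runs on an argument whose size is
bounded by the cost of the first. -/
theorem size_bdd {f : α → β} (hf : PolyTime f) : PolyBdd size fun a => size (f a) := by
  obtain ⟨P, p, h⟩ := hf
  obtain ⟨c, hc⟩ := P.size_le_cost
  refine ⟨Polynomial.C c * p, fun a => ?_⟩
  obtain ⟨t, h1, h2⟩ := h a
  rw [Polynomial.eval_mul, Polynomial.eval_C]
  exact (hc _ _ _ h1).trans (Nat.mul_le_mul_left c h2)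

theorem of_op (o : ElemOp) {f : α → β} (h : ∀ a, o.apply (enc a) = enc (f a)) : PolyTime f :=
  of_bdd (.op o) (PolyBdd.self.pow 2) fun a => ⟨_, h a ▸ .op o _, le_rfl⟩

@[fun_prop]
theorem id : PolyTime fun a : α => a := of_op .id fun _ => rfl

@[fun_prop]
theorem comp {g : β → γ} {f : α → β} (hg : PolyTime g) (hf : PolyTime f) :
    PolyTime fun a => g (f a) := by
  have hs := hf.size_bdd
  obtain ⟨P, p, hP⟩ := hf
  obtain ⟨Q, q, hQ⟩ := hg
  refine of_bdd (.seq P Q) ((PolyBdd.self.eval p).add (hs.eval q)) fun a => ?_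
  obtain ⟨t, h1, h2⟩ := hP a
  obtain ⟨u, h3, h4⟩ := hQ (f a)
  exact ⟨_, .seq h1 h3, by omega⟩

@[fun_prop]
theorem pair {f : α → β} {g : α → γ} (hf : PolyTime f) (hg : PolyTime g) :
    PolyTime fun a => (f a, g a) := by
  obtain ⟨P, p, hP⟩ := hf
  obtain ⟨Q, q, hQ⟩ := hg
  refine of_bdd (.pair P Q)
    (((PolyBdd.self.eval p).add (PolyBdd.self.eval q)).add PolyBdd.self) fun a => ?_
  obtain ⟨t, h1, h2⟩ := hP a
  obtain ⟨u, h3, h4⟩ := hQ a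
  exact ⟨_, .pair h1 h3, by simp only [size] at *; omega⟩

@[fun_prop]
theorem fst : PolyTime fun a : α × β => a.1 := of_op .fst fun _ => rfl

@[fun_prop]
theorem snd : PolyTime fun a : α × β => a.2 := of_op .snd fun _ => rfl

@[fun_prop]
theorem const (b : β) : PolyTime fun _ : α => b := by
  suffices ∀ d : Datum, ∃ P : WhileProgram, ∃ g : α → ℕ, PolyBdd size g ∧
      ∀ a, ∃ t, P.Halts (enc a) d t ∧ t ≤ g a from
    let ⟨P, _, hg, h⟩ := this (enc b)
    of_bdd P hg h
  intro d
  induction d with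
  | int z => exact ⟨.op (.const z), _, PolyBdd.self.pow 2, fun a => ⟨_, .op _ _, le_rfl⟩⟩
  | pair x y hx hy =>
    obtain ⟨P, f, hf, hP⟩ := hx
    obtain ⟨Q, g, hg, hQ⟩ := hy
    refine ⟨.pair P Q, _, (hf.add hg).add PolyBdd.self, fun a => ?_⟩
    obtain ⟨t, h1, h2⟩ := hP a
    obtain ⟨u, h3, h4⟩ := hQ a
    exact ⟨_, .pair h1 h3, by simp only [size] at *; omega⟩

@[fun_prop]
theorem cond {c : α → Bool} {f g : α → β} (hc : PolyTime c) (hf : PolyTime f) (hg : PolyTime g) :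
    PolyTime fun a => bif c a then f a else g a := by
  obtain ⟨C, r, hC⟩ := hc
  obtain ⟨P, p, hP⟩ := hf
  obtain ⟨Q, q, hQ⟩ := hg
  refine of_bdd (.ite C P Q) ((((PolyBdd.self.eval p).add (PolyBdd.self.eval q)).add
    (PolyBdd.self.eval r)).add PolyBdd.self) fun a => ?_
  obtain ⟨s, h5, h6⟩ := hC a
  obtain ⟨t, h1, h2⟩ := hP a
  obtain ⟨u, h3, h4⟩ := hQ a
  cases hca : c a <;> rw [hca] at h5
  · exact ⟨_, .ite_false h5 h3, by simp only [size] at *; omega⟩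
  · exact ⟨_, .ite_true h5 (by simp) h1, by simp only [size] at *; omega⟩

@[fun_prop]
theorem ite {c : α → Prop} [DecidablePred c] {f g : α → β} (hc : PolyTime fun a => decide (c a))
    (hf : PolyTime f) (hg : PolyTime g) : PolyTime fun a => if c a then f a else g a := by
  simpa only [Bool.cond_decide] using cond hc hf hg

/-- A while loop with a polynomial-time test and body: its cost is the number of iterations times
a polynomial in a bound of the sizes of the values that occur. -/
theorem exists_loop {c : α → Bool} {f : α → α} (hc : PolyTime c) (hf : PolyTime f) :
    ∃ (P : WhileProgram) (p : Polynomial ℕ), ∀ (N B : ℕ) (a : α), (∀ i < N, c (f^[i] a) = true) →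
      c (f^[N] a) = false → (∀ i ≤ N, size (f^[i] a) ≤ B) →
      ∃ t, P.Halts (enc a) (enc (f^[N] a)) t ∧ t ≤ (N + 1) * p.eval B := by
  obtain ⟨C, q, hC⟩ := hc
  obtain ⟨P, p, hP⟩ := hf
  -- A round pays for the body, the test and the copy of the current value, whence the summand `X`.
  -- The failing test at the end accounts for the factor `N + 1`.
  refine ⟨.loop C P, p + q + Polynomial.X, fun N B => ?_⟩
  induction N with
  | zero =>
    intro a _ hN hB
    have hB := hB 0 le_rfl
    obtain ⟨s, h1, h2⟩ := hC a
    rw [show c a = false from hN] at h1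
    have := q.eval_nat_mono hB
    refine ⟨_, .loop_exit h1, ?_⟩
    simp only [size, Function.iterate_zero, id_eq, Polynomial.eval_add, Polynomial.eval_X] at *
    omega
  | succ N ih =>
    intro a hi hN hB
    have hB' := hB 0 (Nat.zero_le _)
    obtain ⟨s, h1, h2⟩ := hC a
    rw [show c a = true from hi 0 (by omega)] at h1
    obtain ⟨t, h3, h4⟩ := hP a
    obtain ⟨u, h5, h6⟩ := ih (f a) (fun i h => hi (i + 1) (by omega)) hN
      fun i h => hB (i + 1) (by omega)
    have := q.eval_nat_mono hB'
    have := p.eval_nat_mono hB'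
    refine ⟨_, .loop_next h1 (by simp) h3 h5, ?_⟩
    simp only [size, Function.iterate_zero, id_eq, Polynomial.eval_add, Polynomial.eval_X] at *
    rw [Nat.succ_mul]
    omega

theorem loop {c : α → Bool} {f : α → α} (hc : PolyTime c) (hf : PolyTime f) {N : α → ℕ}
    (hN : PolyBdd size N) {B : α → ℕ} (hB : PolyBdd size B)
    (hi : ∀ a, ∀ i < N a, c (f^[i] a) = true) (he : ∀ a, c (f^[N a] a) = false)
    (hs : ∀ a, ∀ i ≤ N a, size (f^[i] a) ≤ B a) : PolyTime fun a => f^[N a] a := by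
  obtain ⟨P, p, hP⟩ := exists_loop hc hf
  exact of_bdd P ((hN.add (.const 1)).mul (hB.eval p)) fun a =>
    hP (N a) (B a) a (hi a) (he a) (hs a)

/-! ### Integers and Booleans -/

theorem add_int : PolyTime fun a : ℤ × ℤ => a.1 + a.2 := of_op .add fun _ => rfl
theorem sub_int : PolyTime fun a : ℤ × ℤ => a.1 - a.2 := of_op .sub fun _ => rfl
theorem mul_int : PolyTime fun a : ℤ × ℤ => a.1 * a.2 := of_op .mul fun _ => rfl
theorem div_int : PolyTime fun a : ℤ × ℤ => a.1 / a.2 := of_op .div fun _ => rfl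
theorem mod_int : PolyTime fun a : ℤ × ℤ => a.1 % a.2 := of_op .mod fun _ => rfl
theorem le_int : PolyTime fun a : ℤ × ℤ => decide (a.1 ≤ a.2) := of_op .le fun _ => rfl

@[fun_prop]
theorem add {f g : α → ℤ} (hf : PolyTime f) (hg : PolyTime g) : PolyTime fun a => f a + g a :=
  add_int.comp (hf.pair hg)

@[fun_prop]
theorem sub {f g : α → ℤ} (hf : PolyTime f) (hg : PolyTime g) : PolyTime fun a => f a - g a :=
  sub_int.comp (hf.pair hg)

@[fun_prop]
theorem mul {f g : α → ℤ} (hf : PolyTime f) (hg : PolyTime g) : PolyTime fun a => f a * g a :=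
  mul_int.comp (hf.pair hg)

@[fun_prop]
theorem div {f g : α → ℤ} (hf : PolyTime f) (hg : PolyTime g) : PolyTime fun a => f a / g a :=
  div_int.comp (hf.pair hg)

@[fun_prop]
theorem mod {f g : α → ℤ} (hf : PolyTime f) (hg : PolyTime g) : PolyTime fun a => f a % g a :=
  mod_int.comp (hf.pair hg)

@[fun_prop]
theorem le {f g : α → ℤ} (hf : PolyTime f) (hg : PolyTime g) :
    PolyTime fun a => decide (f a ≤ g a) :=
  le_int.comp (hf.pair hg)

@[fun_prop]
theorem rat_num {f : α → ℚ} (hf : PolyTime f) : PolyTime fun a => (f a).num :=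
  (of_op .fst fun _ => rfl : PolyTime fun q : ℚ => q.num).comp hf

@[fun_prop]
theorem rat_den {f : α → ℚ} (hf : PolyTime f) : PolyTime fun a => ((f a).den : ℤ) :=
  (of_op .snd fun _ => rfl : PolyTime fun q : ℚ => (q.den : ℤ)).comp hf

@[fun_prop]
theorem not {c : α → Bool} (hc : PolyTime c) : PolyTime fun a => !c a := by
  have h : (fun a => !c a) = fun a => bif c a then false else true := by
    funext a; cases c a <;> rfl
  exact h ▸ cond hc (const false) (const true)

@[fun_prop]
theorem and {c d : α → Bool} (hc : PolyTime c) (hd : PolyTime d) : PolyTime fun a => c a && d a := by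
  simpa only [Bool.cond_false_right] using cond hc hd (const false)

@[fun_prop]
theorem or {c d : α → Bool} (hc : PolyTime c) (hd : PolyTime d) : PolyTime fun a => c a || d a := by
  simpa only [Bool.cond_true_left] using cond hc (const true) hd

@[fun_prop]
theorem lt {f g : α → ℤ} (hf : PolyTime f) (hg : PolyTime g) :
    PolyTime fun a => decide (f a < g a) := by
  simpa only [← not_le, decide_not] using (hg.le hf).not

@[fun_prop]
theorem eq_zero {f : α → ℤ} (hf : PolyTime f) : PolyTime fun a => decide (f a = 0) := by
  have h : ∀ z : ℤ, decide (z = 0) = (decide (z ≤ 0) && decide (0 ≤ z)) := fun z => by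
    rw [← Bool.decide_and, decide_eq_decide]; omega
  simp only [h]
  fun_prop

@[fun_prop]
theorem decide_eq_true {c : α → Bool} (hc : PolyTime c) : PolyTime fun a => decide (c a = true) := by
  simpa only [Bool.decide_eq_true] using hc

/-! ### Lists -/

@[fun_prop]
-- A nonempty list has the same encoding as the pair of its head and tail, so the identity operation
-- suffices.
theorem cons {f : α → β} {l : α → List β} (hf : PolyTime f) (hl : PolyTime l) :
    PolyTime fun a => f a :: l a :=
  (of_op .id fun _ => rfl : PolyTime fun x : β × List β => x.1 :: x.2).comp (hf.pair hl)

@[fun_prop]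
theorem isEmpty {l : α → List β} (hl : PolyTime l) : PolyTime fun a => (l a).isEmpty := by
  have h : PolyTime fun l : List β => !l.isEmpty := of_op .isPair fun l => by cases l <;> rfl
  simpa using (h.comp hl).not

@[fun_prop]
theorem tail {l : α → List β} (hl : PolyTime l) : PolyTime fun a => (l a).tail :=
  (of_op .snd fun l => by cases l <;> rfl : PolyTime fun l : List β => l.tail).comp hl

@[fun_prop]
theorem headD {l : α → List β} (hl : PolyTime l) {d : α → β} (hd : PolyTime d) :
    PolyTime fun a => (l a).headD (d a) := by
  suffices h : PolyTime fun x : List β × β => x.1.headD x.2 from h.comp (hl.pair hd)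
  refine of_bdd (.ite (.seq (.op .fst) (.op .isPair)) (.seq (.op .fst) (.op .fst)) (.op .snd))
    ((((PolyBdd.self.pow 2).mul (.const 4))).add PolyBdd.self) ?_
  rintro ⟨_ | ⟨b, l⟩, d⟩
  · refine ⟨_, .ite_false (.seq (.op _ _) (.op _ _)) (.op _ _), ?_⟩
    have : (enc ([] : List β)).size ≤ size (([] : List β), d) := by simp [size, Datum.size]
    have := Nat.pow_le_pow_left this 2
    simp only [size, ElemOp.apply, enc_mk] at *
    omega
  · refine ⟨_, .ite_true (.seq (.op _ _) (.op _ _)) (by simp [ElemOp.apply])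
      (.seq (.op _ _) (.op _ _)), ?_⟩
    have : (enc (b :: l)).size ≤ size (b :: l, d) := by simp [size, Datum.size]; omega
    have := Nat.pow_le_pow_left this 2
    simp only [size, ElemOp.apply, enc_mk] at *
    omega

/-- A polynomial-time step could double the accumulator each time, so all partial results need a
common polynomial bound. The fold is run as a loop on the parameter, the unread part of the list and
the accumulator. -/
theorem foldl [Inhabited γ] {F : α → β → γ → β} (hF : PolyTime fun s : α × β × γ => F s.1 s.2.1 s.2.2)
    {l : α → List γ} (hl : PolyTime l) {b : α → β} (hb : PolyTime b) {B : α → ℕ}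
    (hB : PolyBdd size B) (h : ∀ a, ∀ i, size (((l a).take i).foldl (F a) (b a)) ≤ B a) :
    PolyTime fun a => (l a).foldl (F a) (b a) := by
  let f : α × List γ × β → α × List γ × β := fun s =>
    (s.1, s.2.1.tail, F s.1 s.2.2 (s.2.1.headD default))
  have hf : PolyTime f :=
    fst.pair ((tail (fst.comp snd)).pair
      (hF.comp (fst.pair ((snd.comp snd).pair (headD (fst.comp snd) (const default))))))
  have hit : ∀ a (i : ℕ) (l : List γ) b, i ≤ l.length →
      f^[i] (a, l, b) = (a, l.drop i, (l.take i).foldl (F a) b) := by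
    intro a i
    induction i with
    | zero => intro l b _; simp
    | succ i ih =>
      intro l b hi
      cases l with
      | nil => simp at hi
      | cons c l => simpa [f] using ih l (F a b c) (by simpa using hi)
  have hstart : PolyTime fun a => (a, l a, b a) := id.pair (hl.pair hb)
  obtain ⟨P, p, hP⟩ := exists_loop
    (by fun_prop : PolyTime fun s : α × List γ × β => !s.2.1.isEmpty) hf
  have hs := hstart.size_bdd
  obtain ⟨Q, q, hQ⟩ := hstart
  have key : PolyTime fun a => f^[(l a).length] (a, l a, b a) := by
    refine of_bdd (.seq Q P) ((PolyBdd.self.eval q).add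
      (((hl.size_bdd.mono fun a => (length_lt_size _).le).add (.const 1)).mul
        ((hs.add hB).eval p))) fun a => ?_
    obtain ⟨t, h1, h2⟩ := hQ a
    obtain ⟨u, h3, h4⟩ := hP (l a).length (size (a, l a, b a) + B a) (a, l a, b a)
      (fun i hi => by
        rw [hit _ _ _ _ hi.le]
        cases hd : (l a).drop i with
        | nil => simp only [List.drop_eq_nil_iff] at hd; omega
        | cons => rfl)
      (by rw [hit _ _ _ _ le_rfl]; simp)
      (fun i hi => by
        rw [hit _ _ _ _ hi]
        have h5 := h a i
        have h6 : size ((l a).drop i) ≤ size (l a) := by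
          have := size_append ((l a).take i) ((l a).drop i)
          rw [List.take_append_drop] at this
          have := size_pos ((l a).take i)
          omega
        simp only [size_mk]; omega)
    exact ⟨_, .seq h1 h3, by omega⟩
  refine ((snd.comp snd).comp key).congr fun a => ?_
  rw [hit _ _ _ _ le_rfl]
  simp

/-- If an element lengthens the accumulator by an amount that does not depend on the accumulator,
the increments add up to at most the length times a polynomial, which is the a priori bound required
by `foldl`. -/
theorem foldl_of_growth [Inhabited γ] {F : α → β → γ → β}
    (hF : PolyTime fun s : α × β × γ => F s.1 s.2.1 s.2.2)
    {l : α → List γ} (hl : PolyTime l) {b : α → β} (hb : PolyTime b) {G : α × γ → ℕ}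
    (hG : PolyBdd size G) (h : ∀ a b c, size (F a b c) ≤ size b + G (a, c)) :
    PolyTime fun a => (l a).foldl (F a) (b a) := by
  obtain ⟨p, hp⟩ := hG
  have hlen : PolyBdd size fun a => (l a).length := hl.size_bdd.mono fun a => (length_lt_size _).le
  refine foldl hF hl hb (B := fun a => size (b a) + (l a).length *
    p.eval (size (a, l a))) (hb.size_bdd.add (hlen.mul ((id.pair hl).size_bdd.eval p))) ?_
  intro a i
  have key : ∀ l' : List γ, (∀ c ∈ l', c ∈ l a) → ∀ b,
      size (l'.foldl (F a) b) ≤ size b + l'.length * p.eval (size (a, l a)) := by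
    intro l'
    induction l' with
    | nil => intro _ b; simp
    | cons c l' ih =>
      intro hm b
      have h1 := ih (fun c hc => hm c (by simp [hc])) (F a b c)
      have h2 := h a b c
      have h3 := hp (a, c)
      have h4 : p.eval (size (a, c)) ≤ p.eval (size (a, l a)) := p.eval_nat_mono (by
        have := size_le_of_mem (hm c (by simp))
        simp only [size_mk]; omega)
      simp only [List.foldl_cons, List.length_cons, Nat.succ_mul]
      omega
  refine (key _ (fun c hc => List.mem_of_mem_take hc) _).trans ?_
  have : ((l a).take i).length ≤ (l a).length := by simp
  gcongr

@[fun_prop]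
theorem reverse [Inhabited β] {l : α → List β} (hl : PolyTime l) :
    PolyTime fun a => (l a).reverse := by
  suffices h : PolyTime fun l : List β => l.foldl (fun r a => a :: r) [] by
    refine (h.comp hl).congr fun a => ?_
    simp
  refine foldl_of_growth (F := fun _ r a => a :: r) (by fun_prop) id (const _)
    (G := fun x => size x.2 + 1) (snd.size_bdd.add (.const 1)) fun _ b c => ?_
  simp only [size_cons]; omega

@[fun_prop]
theorem append [Inhabited β] {l l' : α → List β} (hl : PolyTime l) (hl' : PolyTime l') :
    PolyTime fun a => l a ++ l' a := by
  suffices h : PolyTime fun x : List β × List β => x.1.foldl (fun r a => a :: r) x.2 by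
    refine (h.comp ((reverse hl).pair hl')).congr fun a => ?_
    simp
  refine foldl_of_growth (F := fun _ r a => a :: r) (by fun_prop) fst snd
    (G := fun x => size x.2 + 1) (snd.size_bdd.add (.const 1)) fun _ b c => ?_
  simp only [size_cons]; omega

@[fun_prop]
theorem map [Inhabited β] [Inhabited γ] {l : α → List β} (hl : PolyTime l) {f : α → β → γ}
    (hf : PolyTime fun x : α × β => f x.1 x.2) : PolyTime fun a => (l a).map (f a) := by
  suffices h : PolyTime fun a => (l a).foldl (fun r b => f a b :: r) [] by
    refine (reverse h).congr fun a => ?_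
    simp
  refine foldl_of_growth (F := fun a r b => f a b :: r) ?_ hl (const _)
    (G := fun x => size (f x.1 x.2) + 1) (hf.size_bdd.add (.const 1)) fun _ b c => ?_
  · exact cons (hf.comp (fst.pair (snd.comp snd))) (fst.comp snd)
  · simp only [size_cons]; omega

@[fun_prop]
theorem filter [Inhabited β] {l : α → List β} (hl : PolyTime l) {f : α → β → Bool}
    (hf : PolyTime fun x : α × β => f x.1 x.2) : PolyTime fun a => (l a).filter (f a) := by
  suffices h : PolyTime fun a => (l a).foldl (fun r b => bif f a b then b :: r else r) [] by
    refine (reverse h).congr fun a => ?_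
    have : ∀ (l r : List β), l.foldl (fun r b => bif f a b then b :: r else r) r =
        (l.filter (f a)).reverse ++ r := by
      intro l
      induction l with
      | nil => simp
      | cons b l ih => intro r; cases h : f a b <;> simp [ih, h]
    simp [this]
  refine foldl_of_growth (F := fun a r b => bif f a b then b :: r else r) ?_ hl (const _)
    (G := fun x => size x.2 + 1) (snd.size_bdd.add (.const 1)) fun a b c => ?_
  · exact cond (hf.comp (fst.pair (snd.comp snd))) (by fun_prop) (by fun_prop)
  · cases f a c <;> simp only [cond_true, cond_false, size_cons] <;> omega

@[fun_prop]
theorem flatMap [Inhabited β] [Inhabited γ] {l : α → List β} (hl : PolyTime l) {f : α → β → List γ}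
    (hf : PolyTime fun x : α × β => f x.1 x.2) : PolyTime fun a => (l a).flatMap (f a) := by
  suffices h : PolyTime fun a => (l a).foldl (fun r b => r ++ f a b) [] by
    refine h.congr fun a => ?_
    have : ∀ (l : List β) (r : List γ), l.foldl (fun r b => r ++ f a b) r = r ++ l.flatMap (f a) := by
      intro l
      induction l with
      | nil => simp
      | cons b l ih => intro r; simp [ih]
    simp [this]
  refine foldl_of_growth (F := fun a r b => r ++ f a b) ?_ hl (const _)
    (G := fun x => size (f x.1 x.2)) hf.size_bdd fun a b c => ?_
  · exact append (by fun_prop) (hf.comp (fst.pair (snd.comp snd)))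
  · have := size_append b (f a c); dsimp only; omega

@[fun_prop]
theorem all [Inhabited β] {l : α → List β} (hl : PolyTime l) {f : α → β → Bool}
    (hf : PolyTime fun x : α × β => f x.1 x.2) : PolyTime fun a => (l a).all (f a) := by
  have h := isEmpty (filter hl (f := fun a b => !f a b) (not hf))
  refine h.congr fun a => ?_
  rw [Bool.eq_iff_iff]
  simp [List.filter_eq_nil_iff]

@[fun_prop]
theorem zipWith [Inhabited β] [Inhabited γ] [Inhabited δ] {l : α → List β} (hl : PolyTime l)
    {l' : α → List γ} (hl' : PolyTime l') {f : α → β → γ → δ}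
    (hf : PolyTime fun x : α × β × γ => f x.1 x.2.1 x.2.2) :
    PolyTime fun a => List.zipWith (f a) (l a) (l' a) := by
  -- The fold consumes the second list while running through the first and collects the pairs in
  -- reverse order; `f` is applied afterwards by `map`.
  suffices h : PolyTime fun a => (l a).foldl (fun (s : List γ × List (β × γ)) b =>
      bif s.1.isEmpty then s else (s.1.tail, (b, s.1.headD default) :: s.2)) (l' a, []) by
    refine (map (reverse (snd.comp h)) (f := fun a x => f a x.1 x.2) hf).congr fun a => ?_
    have : ∀ (l : List β) (l' : List γ) r, (l.foldl (fun (s : List γ × List (β × γ)) b =>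
        bif s.1.isEmpty then s else (s.1.tail, (b, s.1.headD default) :: s.2)) (l', r)).2 =
        (l.zip l').reverse ++ r := by
      intro l
      induction l with
      | nil => simp
      | cons b l ih => intro l' r; cases l' <;> simp [ih, -List.headD_eq_head?_getD]
    simp only [this, List.append_nil, List.reverse_reverse, List.zip, List.map_zipWith]
  refine foldl_of_growth (F := fun _ (s : List γ × List (β × γ)) b =>
      bif s.1.isEmpty then s else (s.1.tail, (b, s.1.headD default) :: s.2)) (by fun_prop) hl
      (hl'.pair (const _))
    (G := fun x => size x.2 + 2) (snd.size_bdd.add (.const 2)) ?_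
  rintro a ⟨_ | ⟨c, s⟩, r⟩ b <;>
    simp only [List.isEmpty_nil, List.isEmpty_cons, cond_true, cond_false, size_mk, size_cons,
      List.tail_cons, List.headD_cons] <;> omega

@[fun_prop]
theorem sum {l : α → List ℤ} (hl : PolyTime l) : PolyTime fun a => (l a).sum := by
  simp only [List.sum_eq_foldl]
  refine foldl_of_growth (F := fun _ r b => r + b) (by fun_prop) hl (const _)
    (G := fun x => size x.2) snd.size_bdd fun _ b c => size_add_le b c

@[fun_prop]
theorem prod {l : α → List ℤ} (hl : PolyTime l) : PolyTime fun a => (l a).prod := by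
  simp only [List.prod_eq_foldl]
  refine foldl_of_growth (F := fun _ r b => r * b) (by fun_prop) hl (const _)
    (G := fun x => size x.2) snd.size_bdd fun _ b c => size_mul_le b c

end PolyTime

/-! ## Integer vectors and matrices as lists -/

namespace IntList

/-- The inner product. -/
def dot (u v : List ℤ) : ℤ := (List.zipWith (fun a b => a * b) u v).sum

/-- The product of a matrix, given by its rows, with a column vector. -/
def mulVec (M : List (List ℤ)) (v : List ℤ) : List ℤ := M.map fun r => dot r v

/-- The transpose of a matrix with as many columns as rows. -/
def transpose (M : List (List ℤ)) : List (List ℤ) :=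
  M.reverse.foldl (fun c r => List.zipWith (fun a l => a :: l) r c) (M.map fun _ => [])

/-- The identity matrix with as many rows as `l` has elements. -/
def identity {α : Type} (l : List α) : List (List ℤ) :=
  l.foldl (fun M _ => (1 :: M.map fun _ => 0) :: M.map fun r => 0 :: r) []

/-- The upper triangular part of `D` times the identity matrix. -/
def diagonal (D : ℤ) {α : Type} (l : List α) : List (List ℤ) :=
  l.foldl (fun M _ => (D :: M.map fun _ => 0) :: M) []

/-- The numbers `0, 1, …` of the elements of `l`. -/
def indices {α : Type} (l : List α) : List ℤ :=
  (l.foldl (fun M _ => (M.map fun _ => (1 : ℤ)).sum :: M) []).reverse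

/-- The vector `v - q t`, reduced modulo `D`. -/
def subMod (D q : ℤ) (v t : List ℤ) : List ℤ := List.zipWith (fun a b => (a - q * b) % D) v t

end IntList

/-! ### Cost of linear algebra on lists. -/

namespace PolyTime
open IntList

variable {α β γ : Type} [DatumEnc α] [DatumEnc β] [DatumEnc γ]

@[fun_prop]
theorem intDot {u v : α → List ℤ} (hu : PolyTime u) (hv : PolyTime v) :
    PolyTime fun a => dot (u a) (v a) := by
  unfold dot; fun_prop

@[fun_prop]
theorem intMulVec {M : α → List (List ℤ)} {v : α → List ℤ} (hM : PolyTime M) (hv : PolyTime v) :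
    PolyTime fun a => mulVec (M a) (v a) := by
  unfold mulVec; fun_prop

@[fun_prop]
theorem intSubMod {D q : α → ℤ} {v t : α → List ℤ} (hD : PolyTime D) (hq : PolyTime q)
    (hv : PolyTime v) (ht : PolyTime t) : PolyTime fun a => subMod (D a) (q a) (v a) (t a) := by
  unfold subMod; fun_prop

theorem length_bdd {l : α → List β} (hl : PolyTime l) : PolyBdd size fun a => (l a).length :=
  hl.size_bdd.mono fun _ => (length_lt_size _).le

@[fun_prop]
-- Prepending the entries of a row to the columns lengthens the columns by at most the size of that
-- row.
theorem intTranspose {M : α → List (List ℤ)} (hM : PolyTime M) :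
    PolyTime fun a => transpose (M a) := by
  unfold transpose
  refine foldl_of_growth (F := fun _ c r => List.zipWith (fun a l => a :: l) r c)
    (by fun_prop) hM.reverse (by fun_prop) (G := fun x => size x.2) snd.size_bdd fun _ c r => ?_
  dsimp only
  induction r generalizing c with
  | nil => simp
  | cons a r ih =>
    cases c with
    | nil => simp
    | cons b c => have := ih c; simp only [List.zipWith_cons_cons, size_cons]; omega

theorem _root_.IntList.size_nested_le {m b : ℕ} {M : List (List ℤ)} (hM : M.length ≤ m)
    (h : ∀ r ∈ M, r.length ≤ m ∧ ∀ x ∈ r, size x ≤ b) :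
    size M ≤ m * (m * (b + 1) + 2) + 1 := by
  refine (size_list_le fun r hr => ?_ : size M ≤ M.length * ((m * (b + 1) + 1) + 1) + 1).trans
    (by gcongr)
  exact (size_list_le (h r hr).2).trans (by have := (h r hr).1; gcongr)

@[fun_prop]
theorem intIdentity {l : α → List β} [Inhabited β] (hl : PolyTime l) :
    PolyTime fun a => identity (l a) := by
  have hb := hl.length_bdd
  refine foldl (F := fun _ M _ => (1 :: M.map fun _ => 0) :: M.map fun r => 0 :: r)
    -- The entries `0` and `1` have size at most `2`, so this is the bound of `size_nested_le` with
    -- `b = 2`.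
    (by fun_prop) hl (const _) (((hb.mul ((hb.mul (.const (2 + 1))).add (.const 2)))).add (.const 1))
    fun a i => ?_
  refine size_nested_le (m := (l a).length) ?_ ?_
  all_goals
    have hlen : ∀ l : List β, (identity l).length = l.length := by
      intro l
      induction l using List.reverseRecOn with
      | nil => rfl
      | append_singleton l a ih => simp_all [identity]
  · change (identity _).length ≤ _
    rw [hlen]; simp
  · have key : ∀ l : List β, ∀ r ∈ identity l, r.length ≤ l.length ∧ ∀ x ∈ r, size x ≤ 2 := by
      intro l
      induction l using List.reverseRecOn with
      | nil => simp [identity]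
      | append_singleton l a ih =>
        have h := hlen l
        simp only [identity, List.foldl_append, List.foldl_cons, List.foldl_nil] at ih h ⊢
        intro r hr
        have h1 : size (1 : ℤ) = 2 := by decide
        have h0 : size (0 : ℤ) = 1 := by decide
        rcases List.mem_cons.1 hr with rfl | hr
        · simp only [List.length_cons, List.length_map, List.length_append, h, List.length_nil]
          refine ⟨by omega, ?_⟩
          simp only [List.mem_cons, List.mem_map]
          rintro x (rfl | ⟨_, _, rfl⟩) <;> omega
        · obtain ⟨r', hr', rfl⟩ := List.mem_map.1 hr
          obtain ⟨h2, h3⟩ := ih r' hr'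
          refine ⟨by simpa using h2, ?_⟩
          simp only [List.mem_cons]
          rintro x (rfl | hx)
          · omega
          · exact h3 x hx
    intro r hr
    obtain ⟨h1, h2⟩ := key _ r hr
    exact ⟨h1.trans (by simp), h2⟩

theorem _root_.IntList.length_diagonal (D : ℤ) {ι : Type} (l : List ι) :
    (diagonal D l).length = l.length := by
  induction l using List.reverseRecOn with
  | nil => rfl
  | append_singleton l a ih => simp_all [diagonal]

theorem _root_.IntList.mem_diagonal (D : ℤ) {ι : Type} (l : List ι) :
    ∀ r ∈ diagonal D l, r.length ≤ l.length ∧ ∀ x ∈ r, size x ≤ size D := by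
  induction l using List.reverseRecOn with
  | nil => simp [diagonal]
  | append_singleton l a ih =>
    have h := length_diagonal D l
    simp only [diagonal, List.foldl_append, List.foldl_cons, List.foldl_nil] at ih h ⊢
    intro r hr
    rcases List.mem_cons.1 hr with rfl | hr
    · simp only [List.length_cons, List.length_map, List.length_append, h, List.length_nil]
      refine ⟨by omega, ?_⟩
      simp only [List.mem_cons, List.mem_map]
      rintro x (rfl | ⟨_, _, rfl⟩)
      · exact le_rfl
      · exact size_mono (by simp)
    · obtain ⟨h2, h3⟩ := ih r hr
      exact ⟨h2.trans (by simp), h3⟩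

@[fun_prop]
theorem intDiagonal {D : α → ℤ} (hD : PolyTime D) {l : α → List β} [Inhabited β]
    (hl : PolyTime l) : PolyTime fun a => diagonal (D a) (l a) := by
  have hb := hl.length_bdd
  have hd := hD.size_bdd
  refine foldl (F := fun a M _ => (D a :: M.map fun _ => 0) :: M)
    (by fun_prop) hl (const _)
    (((hb.mul ((hb.mul (hd.add (.const 1))).add (.const 2)))).add (.const 1)) fun a i => ?_
  refine size_nested_le (m := (l a).length) ?_ ?_
  · exact (length_diagonal _ _).le.trans (by simp)
  · intro r hr
    obtain ⟨h1, h2⟩ := mem_diagonal (D a) ((l a).take i) r hr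
    exact ⟨h1.trans (by simp), h2⟩

theorem _root_.IntList.indices_eq {ι : Type} (l : List ι) :
    indices l = (List.range l.length).map Int.ofNat := by
  rw [indices, List.reverse_eq_iff]
  induction l using List.reverseRecOn with
  | nil => rfl
  | append_singleton l a ih =>
    simp only [List.foldl_append, List.foldl_cons, List.foldl_nil, ih, List.length_append,
      List.length_cons, List.length_nil, zero_add, List.range_succ]
    simp [Function.comp_def]

@[fun_prop]
theorem intIndices {l : α → List β} [Inhabited β] (hl : PolyTime l) :
    PolyTime fun a => indices (l a) := by
  have hb := hl.length_bdd
  refine reverse (foldl (F := fun a M _ => (M.map fun _ => (1 : ℤ)).sum :: M)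
    (by fun_prop) hl (const _)
    ((hb.mul ((hb.add (.const 1)).add (.const 1))).add (.const 1)) fun a i => ?_)
  have h := indices_eq ((l a).take i)
  rw [indices] at h
  rw [← size_reverse, h]
  refine (size_list_le (B := (l a).length + 1) ?_).trans ?_
  · simp only [List.mem_map, List.mem_range, List.length_take]
    rintro _ ⟨j, hj, rfl⟩
    refine size_int_le ?_
    have : j < 2 ^ j := Nat.lt_two_pow_self
    have : 2 ^ j ≤ 2 ^ (l a).length := Nat.pow_le_pow_right (by norm_num) (by omega)
    simp; omega
  · have : ((List.range ((l a).take i).length).map Int.ofNat).length ≤ (l a).length := by simp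
    gcongr

end PolyTime

/-! ## Triangular bases -/

namespace IntList

/-- The test of the loop in the Euclidean algorithm on the first entries of two vectors `t`, `v`,
which are given together with a modulus. -/
def euclidCond (s : ℤ × List ℤ × List ℤ) : Bool :=
  decide (0 < s.1) && decide (0 < s.2.1.headD 0) && !decide (s.2.2.headD 0 % s.2.1.headD 0 = 0)

/-- One division with remainder in the Euclidean algorithm. -/
def euclidStep (s : ℤ × List ℤ × List ℤ) : ℤ × List ℤ × List ℤ :=
  (s.1, subMod s.1 (s.2.2.headD 0 / s.2.1.headD 0) s.2.2 s.2.1, s.2.1)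

theorem headD_subMod {D q : ℤ} (a b : ℤ) (v t : List ℤ) :
    (subMod D q (a :: v) (b :: t)).headD 0 = (a - q * b) % D := rfl

/-- The first entry of the vector is not assumed to be below the modulus. Reducing the nonnegative
remainder modulo `D` can only make it smaller, which is all that termination needs. -/
theorem headD_euclidStep {s : ℤ × List ℤ × List ℤ} (h : euclidCond s = true) :
    0 ≤ (euclidStep s).2.1.headD 0 ∧
      (euclidStep s).2.1.headD 0 ≤ s.2.2.headD 0 % s.2.1.headD 0 := by
  obtain ⟨D, t, v⟩ := s
  simp only [euclidCond, Bool.and_eq_true, decide_eq_true_eq, Bool.not_eq_true',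
    decide_eq_false_iff_not] at h
  obtain ⟨⟨hD, ht⟩, hv⟩ := h
  cases t with
  | nil => simp at ht
  | cons b t =>
    cases v with
    | nil => simp at hv
    | cons a v =>
      simp only [euclidStep, headD_subMod, List.headD_cons] at *
      have h1 : a - a / b * b = a % b := by rw [Int.emod_def, mul_comm]
      rw [h1]
      have := Int.emod_nonneg a ht.ne'
      exact ⟨Int.emod_nonneg _ hD.ne', by
        rw [Int.emod_def (a % b) D]
        have := mul_nonneg hD.le (Int.ediv_nonneg this hD.le)
        omega⟩

end IntList

namespace IntList

/-- The product of the two first entries is a measure: if `0 < t < v`, then `v % t` is below `t` and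
at most `v - t`, so replacing `(t, v)` by `(v % t, t)` at least halves it. The order `t < v`
persists. -/
theorem exists_euclidCond_eq_false_aux (m : ℕ) : ∀ s : ℤ × List ℤ × List ℤ,
    s.2.1.headD 0 < s.2.2.headD 0 → s.2.1.headD 0 * s.2.2.headD 0 < 2 ^ m →
    ∃ N ≤ m, euclidCond (euclidStep^[N] s) = false := by
  induction m with
  | zero =>
    intro s h1 h2
    refine ⟨0, le_rfl, ?_⟩
    by_contra h
    simp only [Function.iterate_zero, id_eq, Bool.not_eq_false] at h
    have h3 : 0 < s.2.1.headD 0 := by simp_all [euclidCond]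
    nlinarith
  | succ m ih =>
    intro s h1 h2
    cases h : euclidCond s with
    | false => exact ⟨0, by omega, h⟩
    | true =>
      have h3 : 0 < s.2.1.headD 0 := by simp_all [euclidCond]
      obtain ⟨h4, h5⟩ := headD_euclidStep h
      have h6 : (euclidStep s).2.2 = s.2.1 := rfl
      have h7 := Int.emod_lt_of_pos (s.2.2.headD 0) h3
      have h8 : s.2.2.headD 0 % s.2.1.headD 0 ≤ s.2.2.headD 0 - s.2.1.headD 0 := by
        have h9 := Int.mul_ediv_add_emod (s.2.2.headD 0) (s.2.1.headD 0)
        have h10 : 1 ≤ s.2.2.headD 0 / s.2.1.headD 0 := by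
          rw [Int.le_ediv_iff_mul_le h3]; omega
        nlinarith
      obtain ⟨N, hN, hc⟩ := ih (euclidStep s) (by rw [h6]; omega) (by
        rw [h6]
        rw [pow_succ] at h2
        nlinarith)
      exact ⟨N + 1, by omega, hc⟩

theorem exists_euclidCond_eq_false (s : ℤ × List ℤ × List ℤ) :
    ∃ N ≤ 2 * size s + 1, euclidCond (euclidStep^[N] s) = false := by
  cases h : euclidCond s with
  | false => exact ⟨0, by omega, h⟩
  | true =>
    have h3 : 0 < s.2.1.headD 0 := by simp_all [euclidCond]
    obtain ⟨h4, h5⟩ := headD_euclidStep h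
    have h6 : (euclidStep s).2.2 = s.2.1 := rfl
    have h7 := Int.emod_lt_of_pos (s.2.2.headD 0) h3
    have h8 : s.2.1.headD 0 < 2 ^ size s := by
      have h9 : size (s.2.1.headD 0) ≤ size s := by
        have : size (s.2.1.headD 0) ≤ size s.2.1 := by
          cases s.2.1 with
          | nil => simp [size_int]
          | cons a l => simp only [List.headD_cons, size_cons]; omega
        have : size s = size s.1 + (size s.2.1 + size s.2.2 + 1) + 1 := rfl
        omega
      have h10 := natAbs_lt_two_pow_size (s.2.1.headD 0)
      have h11 : 2 ^ (size (s.2.1.headD 0) - 1) ≤ 2 ^ size s :=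
        Nat.pow_le_pow_right (by norm_num) (by omega)
      zify at h10 h11
      rw [abs_of_pos h3] at h10
      omega
    -- One step establishes the order required by the measure argument, whatever the size of `v`;
    -- afterwards both entries are below `2 ^ size s`.
    obtain ⟨N, hN, hc⟩ := exists_euclidCond_eq_false_aux (2 * size s) (euclidStep s)
      (by rw [h6]; omega) (by
        rw [h6, two_mul, pow_add]
        nlinarith)
    exact ⟨N + 1, by omega, hc⟩

theorem exists_euclidCond_eq_false' (s : ℤ × List ℤ × List ℤ) :
    ∃ N, euclidCond (euclidStep^[N] s) = false :=
  let ⟨N, _, h⟩ := exists_euclidCond_eq_false s; ⟨N, h⟩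

/-- The vectors `t`, `v` at the end of the Euclidean algorithm on their first entries. -/
def euclid (s : ℤ × List ℤ × List ℤ) : ℤ × List ℤ × List ℤ :=
  euclidStep^[Nat.find (exists_euclidCond_eq_false' s)] s

theorem euclidCond_euclid (s : ℤ × List ℤ × List ℤ) : euclidCond (euclid s) = false :=
  Nat.find_spec (exists_euclidCond_eq_false' s)

theorem euclid_induction {p : ℤ × List ℤ × List ℤ → Prop} (s : ℤ × List ℤ × List ℤ) (h0 : p s)
    (hs : ∀ s, p s → euclidCond s = true → p (euclidStep s)) :
    ∀ i ≤ Nat.find (exists_euclidCond_eq_false' s), p (euclidStep^[i] s) := by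
  intro i
  induction i with
  | zero => exact fun _ => h0
  | succ i ih =>
    intro hi
    rw [Function.iterate_succ_apply']
    refine hs _ (ih (by omega)) ?_
    have := Nat.find_min (exists_euclidCond_eq_false' s) (show i < _ by omega)
    simpa using this

/-- The vector `t'` arises from `t` in the Euclidean algorithm modulo `D`. -/
def RowBdd (D : ℤ) (t t' : List ℤ) : Prop :=
  t'.length ≤ t.length ∧ ∀ x ∈ t', x ∈ t ∨ size x ≤ size D

theorem RowBdd.refl (D : ℤ) (t : List ℤ) : RowBdd D t t := ⟨le_rfl, fun _ => .inl⟩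

theorem RowBdd.size_le {D : ℤ} {t t' : List ℤ} (h : RowBdd D t t') :
    size t' ≤ size t * (size t + size D + 1) + 1 := by
  refine (size_list_le (B := size t + size D) fun x hx => ?_).trans ?_
  · rcases h.2 x hx with h | h
    · have := size_le_of_mem h; omega
    · omega
  · have := h.1.trans (length_lt_size t).le
    gcongr

theorem rowBdd_subMod {D : ℤ} (hD : 0 < D) {q : ℤ} {v t t' : List ℤ} (h : t'.length ≤ t.length) :
    RowBdd D t (subMod D q v t') := by
  refine ⟨by simp only [subMod, List.length_zipWith]; omega, fun x hx => .inr ?_⟩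
  simp only [subMod, List.mem_iff_getElem, List.length_zipWith, List.getElem_zipWith] at hx
  obtain ⟨i, _, rfl⟩ := hx
  refine size_mono ?_
  have h1 := Int.emod_nonneg (v[i] - q * t'[i]) hD.ne'
  have h2 := Int.emod_lt_of_pos (v[i] - q * t'[i]) hD
  omega

/-- Every vector met on the way is an original one or has just been reduced modulo `D`. Sizes
therefore do not accumulate over the iterations. -/
theorem euclid_iterate (s : ℤ × List ℤ × List ℤ) :
    ∀ i ≤ Nat.find (exists_euclidCond_eq_false' s), (euclidStep^[i] s).1 = s.1 ∧
      RowBdd s.1 s.2.1 (euclidStep^[i] s).2.1 ∧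
        ((euclidStep^[i] s).2.2 = s.2.2 ∨ RowBdd s.1 s.2.1 (euclidStep^[i] s).2.2) := by
  refine euclid_induction (p := fun s' => s'.1 = s.1 ∧ RowBdd s.1 s.2.1 s'.2.1 ∧
    (s'.2.2 = s.2.2 ∨ RowBdd s.1 s.2.1 s'.2.2)) s ⟨rfl, .refl _ _, .inl rfl⟩ ?_
  rintro s' ⟨h1, h2, _⟩ hc
  have hD : 0 < s'.1 := by simp_all [euclidCond]
  exact ⟨h1, h1 ▸ rowBdd_subMod hD h2.1, .inr h2⟩

/-- The effect on a row `t` of a triangular basis, and on the vector `v` to be inserted, of making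
the first entry of `v` zero; that entry is removed from `v`. -/
def insertRow (D : ℤ) (t v : List ℤ) : List ℤ × List ℤ :=
  if 0 < D then
    ((euclid (D, t, v)).2.1, (subMod D ((euclid (D, t, v)).2.2.headD 0 /
      (euclid (D, t, v)).2.1.headD 0) (euclid (D, t, v)).2.2 (euclid (D, t, v)).2.1).tail)
  else (t, [])

/-- One step of `IntList.insert`. -/
def insertStep (D : ℤ) (r : List ℤ × List (List ℤ) × Bool) (t : List ℤ) :
    List ℤ × List (List ℤ) × Bool :=
  ((insertRow D t r.1).2, (insertRow D t r.1).1 :: r.2.1,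
    r.2.2 || !decide (r.1.headD 0 % t.headD 0 = 0))

/-- Insert the vector `v` into the lattice with triangular basis `T`; the Boolean tells whether the
lattice grows. -/
def insert (D : ℤ) (T : List (List ℤ)) (v : List ℤ) : List (List ℤ) × Bool :=
  ((T.foldl (insertStep D) (v, [], false)).2.1.reverse,
    (T.foldl (insertStep D) (v, [], false)).2.2)

theorem insert_nil (D : ℤ) (v : List ℤ) : IntList.insert D [] v = ([], false) := rfl

/-- The fold with accumulators is suited to the cost analysis; this recursion on the rows is suited
to induction. -/
theorem insert_cons (D : ℤ) (T : List (List ℤ)) (t v : List ℤ) :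
    IntList.insert D (t :: T) v =
      ((insertRow D t v).1 :: (IntList.insert D T (insertRow D t v).2).1,
        !decide (v.headD 0 % t.headD 0 = 0) || (IntList.insert D T (insertRow D t v).2).2) := by
  have hi : ∀ t T v, IntList.insert D (t :: T) v =
    ((T.foldl (insertStep D) (insertStep D (v, [], false) t)).2.1.reverse,
      (T.foldl (insertStep D) (insertStep D (v, [], false) t)).2.2) := fun _ _ _ => rfl
  have key : ∀ (T : List (List ℤ)) r, (T.foldl (insertStep D) r).2 =
      ((IntList.insert D T r.1).1.reverse ++ r.2.1, r.2.2 || (IntList.insert D T r.1).2) := by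
    intro T
    induction T with
    | nil => simp [insert_nil]
    | cons t T ih =>
      intro r
      rw [List.foldl_cons, ih, hi, ih]
      simp [Bool.or_assoc, insertStep]
  rw [hi, key]
  simp [insertStep]

theorem insertRow_fst (D : ℤ) (t v : List ℤ) : RowBdd D t (insertRow D t v).1 := by
  rw [insertRow]
  split
  · exact (euclid_iterate (D, t, v) _ le_rfl).2.1
  · exact .refl _ _

/-- The bound does not mention `v`: what is passed on to the next row is reduced modulo `D` and no
longer than the row. Hence nothing grows while `v` travels through the basis. -/
theorem size_insertRow_snd (D : ℤ) (t v : List ℤ) :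
    size (insertRow D t v).2 ≤ size t * (size t + size D + 1) + 1 := by
  rw [insertRow]
  split
  · rename_i hD
    have h := (rowBdd_subMod hD (q := (euclid (D, t, v)).2.2.headD 0 / (euclid (D, t, v)).2.1.headD 0)
      (v := (euclid (D, t, v)).2.2) (euclid_iterate (D, t, v) _ le_rfl).2.1.1).size_le
    refine le_trans ?_ h
    simp only [euclid]
    cases subMod _ _ _ _ with
    | nil => simp
    | cons a l => simp only [List.tail_cons, size_cons]; omega
  · simp

theorem forall₂_insert (D : ℤ) (T : List (List ℤ)) (v : List ℤ) :
    List.Forall₂ (RowBdd D) T (IntList.insert D T v).1 := by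
  induction T generalizing v with
  | nil => exact .nil
  | cons t T ih => rw [insert_cons]; exact .cons (insertRow_fst _ _ _) (ih _)

end IntList

/-! ### Cost of inserting a vector into a triangular basis. -/

namespace PolyTime
open IntList

variable {α β γ : Type} [DatumEnc α] [DatumEnc β] [DatumEnc γ]

theorem intEuclid : PolyTime euclid := by
  have h1 : PolyTime fun s : ℤ × List ℤ × List ℤ => s.2.1 := by fun_prop
  have h2 : PolyTime fun s : ℤ × List ℤ × List ℤ => s.1 := by fun_prop
  refine loop (c := euclidCond) (f := euclidStep) (by unfold euclidCond; fun_prop)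
    (by unfold euclidStep; fun_prop) (N := fun s => Nat.find (exists_euclidCond_eq_false' s))
    (((PolyBdd.const 2).mul .self |>.add (.const 1)).mono ?_)
    (((h1.size_bdd.mul ((h1.size_bdd.add h2.size_bdd).add (.const 1))).mul (.const 2)).add
      ((PolyBdd.self).add (.const 10))) ?_ euclidCond_euclid ?_
  · intro s
    obtain ⟨N, hN, h⟩ := exists_euclidCond_eq_false s
    exact (Nat.find_min' _ h).trans hN
  · intro s i hi
    simpa using Nat.find_min (exists_euclidCond_eq_false' s) hi
  · intro s i hi
    obtain ⟨h3, h4, h5⟩ := euclid_iterate s i hi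
    have h6 := h4.size_le
    have h7 : size (euclidStep^[i] s) = size (euclidStep^[i] s).1 +
      (size (euclidStep^[i] s).2.1 + size (euclidStep^[i] s).2.2 + 1) + 1 := rfl
    have h8 : size s = size s.1 + (size s.2.1 + size s.2.2 + 1) + 1 := rfl
    rw [h3] at h7
    rcases h5 with h5 | h5
    · rw [h5] at h7; omega
    · have := h5.size_le; omega

@[fun_prop]
theorem intInsert {D : α → ℤ} {T : α → List (List ℤ)} {v : α → List ℤ} (hD : PolyTime D)
    (hT : PolyTime T) (hv : PolyTime v) : PolyTime fun a => IntList.insert (D a) (T a) (v a) := by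
  have hrow : ∀ {β : Type} [DatumEnc β] {D : β → ℤ} {t v : β → List ℤ}, PolyTime D → PolyTime t →
      PolyTime v → PolyTime fun b => insertRow (D b) (t b) (v b) := fun hD ht hv => by
    have h := intEuclid.comp (hD.pair (ht.pair hv))
    unfold insertRow
    refine ite (lt (const 0) hD) ?_ ?_ <;> fun_prop
  have h1 : PolyTime fun s : (ℤ × List (List ℤ) × List ℤ) × List ℤ => s.1.1 := by fun_prop
  have h2 : PolyTime fun s : (ℤ × List (List ℤ) × List ℤ) × List ℤ => s.2 := by fun_prop
  suffices h : PolyTime fun a : ℤ × List (List ℤ) × List ℤ =>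
      a.2.1.foldl (insertStep a.1) (a.2.2, [], false) by
    have := h.comp (hD.pair (hT.pair hv))
    unfold IntList.insert; fun_prop
  have hF : PolyTime fun s : (ℤ × List (List ℤ) × List ℤ) × (List ℤ × List (List ℤ) × Bool) ×
      List ℤ => insertStep s.1.1 s.2.1 s.2.2 := by
    have : PolyTime fun s : (ℤ × List (List ℤ) × List ℤ) × (List ℤ × List (List ℤ) × Bool) ×
      List ℤ => insertRow s.1.1 s.2.2 s.2.1.1 := hrow (by fun_prop) (by fun_prop) (by fun_prop)
    unfold insertStep; fun_prop
  -- Each row contributes its new version to the output and replaces the travelling vector. Both are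
  -- bounded in terms of the row and `D`, hence the factor `2`.
  refine foldl_of_growth (F := fun a => insertStep a.1)
    hF
    (l := fun a => a.2.1) (by fun_prop) (b := fun a => (a.2.2, [], false)) (by fun_prop)
    (((h2.size_bdd.mul ((h2.size_bdd.add h1.size_bdd).add (.const 1))).mul (.const 2)).add
      (.const 10)) ?_
  rintro ⟨D, T, w⟩ ⟨v, out, b⟩ t
  have h3 := size_insertRow_snd D t v
  have h4 := (insertRow_fst D t v).size_le
  have h5 : ∀ b : Bool, 2 * size b ≤ 4 ∧ 1 ≤ size b := by decide
  have h6 := h5 b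
  have h7 := h5 (b || !decide (v.headD 0 % t.headD 0 = 0))
  simp only [insertStep, size_mk, size_cons]
  omega

end PolyTime

attribute [irreducible] IntList.insert

/-! ## The algorithm -/

namespace ZGen
open IntList

/-- The state of the algorithm. -/
structure State where
  /-- a common denominator of the entries of `α` and `μ` -/
  den : ℤ
  /-- the numbers of the letters with the matrices `(den • μ(σ))ᵀ` -/
  letters : List (ℤ × List (List ℤ))
  /-- `0` and `1` in the loops, `2` and `3` after a return -/
  phase : ℤ
  /-- the words `w` that were found, with the vectors `den • α μ(w)` -/
  words : List (List ℤ × List ℤ)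
  /-- the Gram determinant of the independent vectors -/
  det : ℤ
  /-- `det` times the orthogonal projection onto their complement -/
  proj : List (List ℤ)
  /-- a triangular basis of the lattice spanned by the vectors of the words and `proj` -/
  lat : List (List ℤ)
  /-- the word that is returned -/
  out : List ℤ

namespace State

/-- The fields as a tuple. -/
def toTuple (s : State) : ℤ × List (ℤ × List (List ℤ)) × ℤ × List (List ℤ × List ℤ) × ℤ ×
    List (List ℤ) × List (List ℤ) × List ℤ :=
  (s.den, s.letters, s.phase, s.words, s.det, s.proj, s.lat, s.out)

instance : DatumEnc State := ⟨fun s => enc s.toTuple⟩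

end State

/-- Insert a vector into the family of independent vectors. -/
def updateProj (D : ℤ) (P : List (List ℤ)) (v : List ℤ) : ℤ × List (List ℤ) :=
  if (mulVec P v).all (fun x => decide (x = 0)) then (D, P)
  else (dot v (mulVec P v), List.zipWith (fun r a =>
    List.zipWith (fun x b => (dot v (mulVec P v) * x - a * b) / D) r (mulVec P v)) P (mulVec P v))

/-- The vectors whose span with the multiples of `D` is the lattice are inserted. -/
def initLat (D : ℤ) (V : List (List ℤ)) (l : List ℤ) : List (List ℤ) :=
  V.foldl (fun T v => (IntList.insert D T v).1) (diagonal D l)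

/-- The words `wσ` with the vectors `den ^ 2 • α μ(wσ)`. -/
def candidates (s : State) : List (List ℤ × List ℤ) :=
  s.words.flatMap fun w => s.letters.map fun a => (w.1 ++ [a.1], mulVec a.2 w.2)

/-- Whether a candidate enlarges the rational span. -/
def rankNew (s : State) (c : List ℤ × List ℤ) : Bool :=
  !(mulVec s.proj c.2).all fun x => decide (x = 0)

/-- Divide a vector by an integer. -/
def divVec (d : ℤ) (v : List ℤ) : List ℤ := v.map fun x => x / d

/-- Whether an integer divides a vector. -/
def dvdVec (d : ℤ) (v : List ℤ) : Bool := v.all fun x => decide (x % d = 0)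

/-- Whether a candidate enlarges the integral span. -/
def moduleNew (s : State) (c : List ℤ × List ℤ) : Bool :=
  !dvdVec s.den c.2 || (IntList.insert s.det s.lat (divVec s.den c.2)).2

/-- Add a word in the first loop. -/
def rankAdd (s : State) (c : List ℤ × List ℤ) : State :=
  { s with
    words := (c.1, divVec s.den c.2) :: s.words
    det := (updateProj s.det s.proj (divVec s.den c.2)).1
    proj := (updateProj s.det s.proj (divVec s.den c.2)).2 }

/-- Add a word in the second loop. -/
def moduleAdd (s : State) (c : List ℤ × List ℤ) : State :=
  { s with
    words := (c.1, divVec s.den c.2) :: s.words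
    lat := (IntList.insert s.det s.lat (divVec s.den c.2)).1 }

/-- Leave the first loop. -/
def rankExit (s : State) : State :=
  { s with
    phase := 1
    lat := initLat s.det (s.proj ++ s.words.map fun w => w.2) (s.proj.map fun _ => 0) }

/-- Leave the second loop. -/
def moduleExit (s : State) : State := { s with phase := 2 }

/-- Return a word. -/
def return_ (s : State) (c : List ℤ × List ℤ) : State := { s with phase := 3, out := c.1 }

/-- The candidates that enlarge the span. -/
def newCandidates (s : State) : List (List ℤ × List ℤ) :=
  if s.phase = 0 then (candidates s).filter (rankNew s) else (candidates s).filter (moduleNew s)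

/-- The candidate that is chosen. -/
def choice (s : State) : List ℤ × List ℤ := (newCandidates s).headD ([], [])

/-- One iteration of a loop, or leaving a loop. -/
def step (s : State) : State :=
  if (newCandidates s).isEmpty then (if s.phase = 0 then rankExit s else moduleExit s)
  else if dvdVec (s.den * s.den) (choice s).2 then
    (if s.phase = 0 then rankAdd s (choice s) else moduleAdd s (choice s))
  else return_ s (choice s)

/-- Whether the algorithm has not yet stopped. -/
def running (s : State) : Bool := decide (s.phase ≤ 1)

/-- The automaton as read from its encoding. -/
abbrev Input := ℕ × ℕ × List ℚ × List (List (List ℚ)) × List ℚ × ℤ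

/-- The product of all denominators in `α` and `μ`. -/
def inputDen (x : Input) : ℤ :=
  (x.2.2.1.map fun q => (q.den : ℤ)).prod *
    (x.2.2.2.1.flatMap fun M => M.flatMap fun r => r.map fun q => (q.den : ℤ)).prod

/-- A rational number times a multiple of its denominator. -/
def scale (d : ℤ) (q : ℚ) : ℤ := q.num * (d / q.den)

/-- The vector `α`, multiplied by the common denominator. -/
def inputInit (x : Input) : List ℤ := x.2.2.1.map (scale (inputDen x))

/-- The initial state. -/
def start (x : Input) : State where
  den := inputDen x
  letters := List.zipWith (fun i M => (i, transpose (M.map fun r => r.map (scale (inputDen x)))))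
    (indices x.2.2.2.1) x.2.2.2.1
  phase := 0
  words := [([], inputInit x)]
  det := (updateProj 1 (identity x.2.2.1) (inputInit x)).1
  proj := (updateProj 1 (identity x.2.2.1) (inputInit x)).2
  lat := []
  out := []

/-- The encoding of the output in a final state. -/
def output (s : State) : Datum :=
  if s.phase = 2 then enc ((0 : ℤ), s.words.map fun w => w.1) else enc ((1 : ℤ), s.out)

end ZGen

/-! ### Cost of the parts of the algorithm. -/

namespace PolyTime
open IntList ZGen

variable {α : Type} [DatumEnc α]

theorem toTuple : PolyTime State.toTuple := of_op .id fun _ => rfl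

@[fun_prop]
theorem mkState {den phase det : α → ℤ} {letters : α → List (ℤ × List (List ℤ))}
    {words : α → List (List ℤ × List ℤ)} {proj lat : α → List (List ℤ)} {out : α → List ℤ}
    (h1 : PolyTime den) (h2 : PolyTime letters) (h3 : PolyTime phase) (h4 : PolyTime words)
    (h5 : PolyTime det) (h6 : PolyTime proj) (h7 : PolyTime lat) (h8 : PolyTime out) :
    PolyTime fun a => State.mk (den a) (letters a) (phase a) (words a) (det a) (proj a) (lat a)
      (out a) :=
  (of_op .id fun _ => rfl : PolyTime fun x : ℤ × List (ℤ × List (List ℤ)) × ℤ ×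
    List (List ℤ × List ℤ) × ℤ × List (List ℤ) × List (List ℤ) × List ℤ =>
      State.mk x.1 x.2.1 x.2.2.1 x.2.2.2.1 x.2.2.2.2.1 x.2.2.2.2.2.1 x.2.2.2.2.2.2.1
        x.2.2.2.2.2.2.2).comp
    (h1.pair (h2.pair (h3.pair (h4.pair (h5.pair (h6.pair (h7.pair h8)))))))

@[fun_prop]
theorem state_den : PolyTime fun s : State => s.den := fst.comp toTuple
@[fun_prop]
theorem state_letters : PolyTime fun s : State => s.letters := (fst.comp snd).comp toTuple
@[fun_prop]
theorem state_phase : PolyTime fun s : State => s.phase :=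
  (fst.comp (snd.comp snd)).comp toTuple
@[fun_prop]
theorem state_words : PolyTime fun s : State => s.words :=
  (fst.comp (snd.comp (snd.comp snd))).comp toTuple
@[fun_prop]
theorem state_det : PolyTime fun s : State => s.det :=
  (fst.comp (snd.comp (snd.comp (snd.comp snd)))).comp toTuple
@[fun_prop]
theorem state_proj : PolyTime fun s : State => s.proj :=
  (fst.comp (snd.comp (snd.comp (snd.comp (snd.comp snd))))).comp toTuple
@[fun_prop]
theorem state_lat : PolyTime fun s : State => s.lat :=
  (fst.comp (snd.comp (snd.comp (snd.comp (snd.comp (snd.comp snd)))))).comp toTuple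
@[fun_prop]
theorem state_out : PolyTime fun s : State => s.out :=
  (snd.comp (snd.comp (snd.comp (snd.comp (snd.comp (snd.comp snd)))))).comp toTuple

@[fun_prop]
theorem zgen_updateProj {D : α → ℤ} {P : α → List (List ℤ)} {v : α → List ℤ} (hD : PolyTime D)
    (hP : PolyTime P) (hv : PolyTime v) : PolyTime fun a => updateProj (D a) (P a) (v a) := by
  unfold updateProj; fun_prop

@[fun_prop]
theorem zgen_divVec {d : α → ℤ} {v : α → List ℤ} (hd : PolyTime d) (hv : PolyTime v) :
    PolyTime fun a => divVec (d a) (v a) := by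
  unfold divVec; fun_prop

@[fun_prop]
theorem zgen_dvdVec {d : α → ℤ} {v : α → List ℤ} (hd : PolyTime d) (hv : PolyTime v) :
    PolyTime fun a => dvdVec (d a) (v a) := by
  unfold dvdVec; fun_prop

/-- Each entry of a row is either kept or reduced modulo `D` at an insertion, so the size of the
basis does not depend on how many vectors are inserted. -/
theorem _root_.ZGen.initLat_rows (D : ℤ) (V : List (List ℤ)) (l : List ℤ) :
    (initLat D V l).length = l.length ∧
      ∀ r ∈ initLat D V l, r.length ≤ l.length ∧ ∀ x ∈ r, size x ≤ size D := by
  induction V using List.reverseRecOn with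
  | nil => exact ⟨length_diagonal _ _, mem_diagonal _ _⟩
  | append_singleton V v ih =>
    rw [show initLat D (V ++ [v]) l = (IntList.insert D (initLat D V l) v).1 by simp [initLat]]
    have h := forall₂_insert D (initLat D V l) v
    refine ⟨h.length_eq ▸ ih.1, fun r hr => ?_⟩
    obtain ⟨i, hi, rfl⟩ := List.mem_iff_getElem.1 hr
    have hb := h.get (by rw [h.length_eq]; exact hi) hi
    obtain ⟨h1, h2⟩ := ih.2 _ (List.getElem_mem (by rw [h.length_eq]; exact hi))
    exact ⟨hb.1.trans h1, fun x hx => (hb.2 x hx).elim (h2 x) _root_.id⟩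

@[fun_prop]
theorem zgen_initLat {D : α → ℤ} {V : α → List (List ℤ)} {l : α → List ℤ} (hD : PolyTime D)
    (hV : PolyTime V) (hl : PolyTime l) : PolyTime fun a => initLat (D a) (V a) (l a) := by
  have hb := hl.length_bdd
  have hd := hD.size_bdd
  refine foldl (F := fun a T v => (IntList.insert (D a) T v).1) (by fun_prop) hV (by fun_prop)
    ((hb.mul ((hb.mul (hd.add (.const 1))).add (.const 2))).add (.const 1)) fun a i => ?_
  obtain ⟨h1, h2⟩ := initLat_rows (D a) ((V a).take i) (l a)
  exact size_nested_le h1.le h2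

@[fun_prop]
theorem zgen_newCandidates : PolyTime newCandidates := by
  unfold newCandidates rankNew moduleNew candidates; fun_prop

@[fun_prop]
theorem zgen_choice : PolyTime choice := by
  unfold choice; fun_prop

theorem zgen_step : PolyTime step := by
  unfold step rankExit moduleExit return_ rankAdd moduleAdd
  fun_prop

theorem zgen_running : PolyTime running := by
  unfold running; fun_prop

@[fun_prop]
theorem zgen_scale {d : α → ℤ} {q : α → ℚ} (hd : PolyTime d) (hq : PolyTime q) :
    PolyTime fun a => scale (d a) (q a) := by
  unfold scale; fun_prop

@[fun_prop]
theorem zgen_inputDen : PolyTime inputDen := by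
  unfold inputDen; fun_prop

theorem zgen_start : PolyTime start := by
  unfold start inputInit
  fun_prop

theorem zgen_output : PolyTime output := by
  have h : ∀ {β : Type} [DatumEnc β], PolyTime fun b : β => enc b := of_op .id fun _ => rfl
  unfold output
  have h2 : PolyTime fun s : State => decide (s.phase = 2) := by
    refine (eq_zero (sub state_phase (const 2))).congr fun s => ?_
    rw [decide_eq_decide]; omega
  refine ite h2 (h.comp ?_) (h.comp ?_) <;> fun_prop

end PolyTime

/-! ## Orthogonal projections and Gram determinants -/

namespace Matrix

variable {ι κ R K : Type*} [Fintype ι] [DecidableEq ι] [Fintype κ] [DecidableEq κ]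

/-- The Gram determinant of the rows of `U` times the orthogonal projection onto the orthogonal
complement of the rows. -/
def gramProj [CommRing R] (U : Matrix ι κ R) : Matrix κ κ R :=
  (U * Uᵀ).det • 1 - Uᵀ * (U * Uᵀ).adjugate * U

section CommRing
variable [CommRing R] (U : Matrix ι κ R)

theorem mul_gramProj : U * gramProj U = 0 := by
  rw [gramProj, Matrix.mul_sub, ← Matrix.mul_assoc, ← Matrix.mul_assoc, mul_adjugate]
  simp

theorem transpose_gramProj : (gramProj U)ᵀ = gramProj U := by
  simp [gramProj, transpose_mul, adjugate_transpose, Matrix.mul_assoc]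

theorem gramProj_mul_transpose : gramProj U * Uᵀ = 0 := by
  rw [← transpose_gramProj, ← transpose_mul, mul_gramProj, transpose_zero]

/-- As `U` annihilates `gramProj U`, only the scalar summand of the left factor survives. -/
theorem gramProj_mul_self : gramProj U * gramProj U = (U * Uᵀ).det • gramProj U := by
  conv_lhs => rw [gramProj.eq_1 U]
  rw [Matrix.sub_mul, Matrix.mul_assoc _ U (_ - _), ← gramProj, mul_gramProj]
  simp

theorem map_gramProj {S : Type*} [CommRing S] (f : R →+* S) :
    (gramProj U).map f = gramProj (U.map f) := by
  have h1 : (U * Uᵀ).map f = U.map f * (U.map f)ᵀ := by rw [Matrix.map_mul, transpose_map]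
  rw [gramProj, gramProj, ← h1]
  have h2 : ((U * Uᵀ).map f).det = f (U * Uᵀ).det := (f.map_det _).symm
  have h3 : ((U * Uᵀ).map f).adjugate = (U * Uᵀ).adjugate.map f := (f.map_adjugate _).symm
  rw [h2, h3, ← transpose_map, ← Matrix.map_mul, ← Matrix.map_mul]
  ext i j
  simp only [map_apply, sub_apply, smul_apply, one_apply, smul_eq_mul, map_sub, map_mul,
    apply_ite f, map_one, map_zero]

theorem gramProj_mulVec (v : κ → R) :
    gramProj U *ᵥ v = (U * Uᵀ).det • v - Uᵀ *ᵥ ((U * Uᵀ).adjugate *ᵥ (U *ᵥ v)) := by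
  simp [gramProj, sub_mulVec, smul_mulVec, mulVec_mulVec, Matrix.mul_assoc]

theorem dotProduct_gramProj_mulVec (v w : κ → R) :
    v ⬝ᵥ (gramProj U *ᵥ w) = (gramProj U *ᵥ v) ⬝ᵥ w := by
  rw [dotProduct_mulVec, ← mulVec_transpose, transpose_gramProj]

end CommRing

section Field
variable [Field K] (U : Matrix ι κ K) (V : Matrix Unit κ K)

theorem fromRows_mul_transpose {ι κ : Type*} [Fintype κ] (U : Matrix ι κ K) (V : Matrix Unit κ K) :
    fromRows U V * (fromRows U V)ᵀ = fromBlocks (U * Uᵀ) (U * Vᵀ) (V * Uᵀ) (V * Vᵀ) := by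
  rw [transpose_fromRows, fromRows_mul_fromCols]

/-- The determinant of the enlarged Gram matrix is `D` times the Schur complement of the old one,
and that product is the quadratic form of the projection at the new row. -/
theorem det_gram_fromRows (h : (U * Uᵀ).det ≠ 0) :
    (fromRows U V * (fromRows U V)ᵀ).det = (V * gramProj U * Vᵀ) () () := by
  have : Invertible (U * Uᵀ) := invertibleOfIsUnitDet _ h.isUnit
  rw [fromRows_mul_transpose, det_fromBlocks₁₁, det_unique (n := Unit), invOf_eq_nonsing_inv,
    inv_def, Ring.inverse_eq_inv', gramProj]
  simp only [PUnit.default_eq_unit, sub_apply, Matrix.mul_sub, Matrix.sub_mul, Matrix.mul_smul,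
    Matrix.smul_mul, smul_apply, smul_eq_mul, Matrix.mul_one, Matrix.mul_assoc]
  field_simp

/-- Uniqueness of the projection: multiplying the first equation by `U` gives `UUᵀY = DU`, which
determines `Y` because the Gram matrix is invertible. -/
theorem eq_gramProj {X : Matrix κ κ K} {Y : Matrix ι κ K} (h : (U * Uᵀ).det ≠ 0)
    (hX : X = (U * Uᵀ).det • 1 - Uᵀ * Y) (hU : U * X = 0) : X = gramProj U := by
  have h1 : (U * Uᵀ) * Y = (U * Uᵀ).det • U := by
    rw [hX, Matrix.mul_sub, sub_eq_zero] at hU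
    rw [Matrix.mul_assoc, ← hU]; simp
  have h2 : (U * Uᵀ).det • Y = (U * Uᵀ).det • ((U * Uᵀ).adjugate * U) := by
    rw [← Matrix.mul_smul, ← h1, ← Matrix.mul_assoc, adjugate_mul]; simp
  have h3 := smul_right_injective _ h h2
  rw [hX, gramProj, h3, Matrix.mul_assoc]

/-- One Gram–Schmidt step without fractions. After division by `D` the right side is annihilated by
`U` and by `V`, and it differs from a scalar matrix by combinations of their rows, so `eq_gramProj`
identifies it. -/
theorem gramProj_fromRows (h : (U * Uᵀ).det ≠ 0) (h' : (V * gramProj U * Vᵀ) () () ≠ 0) :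
    (U * Uᵀ).det • gramProj (fromRows U V) =
      (V * gramProj U * Vᵀ) () () • gramProj U - (V * gramProj U)ᵀ * (V * gramProj U) := by
  have hdet := det_gram_fromRows U V h
  set δ := (V * gramProj U * Vᵀ) () () with hδ
  set D := (U * Uᵀ).det with hD
  have h1 : V * gramProj U * Vᵀ = δ • 1 := by ext ⟨⟩ ⟨⟩; simp [hδ]
  have hVP : V * gramProj U = D • V - V * Uᵀ * (U * Uᵀ).adjugate * U := by
    rw [gramProj, Matrix.mul_sub]; simp [Matrix.mul_assoc, hD]
  have hPV : (V * gramProj U)ᵀ = D • Vᵀ - Uᵀ * ((U * Uᵀ).adjugate * U * Vᵀ) := by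
    rw [transpose_mul, transpose_gramProj, gramProj, Matrix.sub_mul]; simp [Matrix.mul_assoc, hD]
  have key : D⁻¹ • (δ • gramProj U - (V * gramProj U)ᵀ * (V * gramProj U)) =
      gramProj (fromRows U V) := by
    refine eq_gramProj (fromRows U V) (Y := fromRows (D⁻¹ • (δ • ((U * Uᵀ).adjugate * U) -
      (U * Uᵀ).adjugate * U * Vᵀ * (V * gramProj U))) (V * gramProj U)) (hdet ▸ h') ?_ ?_
    · rw [hdet, transpose_fromRows, fromCols_mul_fromRows]
      conv_lhs => rw [hPV, Matrix.sub_mul]; arg 2; arg 1; arg 2; rw [gramProj]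
      simp only [Matrix.mul_smul, Matrix.smul_mul, Matrix.mul_sub, smul_sub, Matrix.mul_assoc,
        ← hD, smul_smul, inv_mul_cancel₀ h, one_smul]
      rw [show D⁻¹ * (δ * D) = δ by field_simp]
      abel
    · rw [fromRows_mul]
      have h2 : U * (D⁻¹ • (δ • gramProj U - (V * gramProj U)ᵀ * (V * gramProj U))) = 0 := by
        rw [transpose_mul, transpose_gramProj, Matrix.mul_smul, Matrix.mul_sub, Matrix.mul_smul,
          ← Matrix.mul_assoc, ← Matrix.mul_assoc U, mul_gramProj]
        simp
      have h3 : V * (D⁻¹ • (δ • gramProj U - (V * gramProj U)ᵀ * (V * gramProj U))) = 0 := by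
        rw [transpose_mul, transpose_gramProj, Matrix.mul_smul, Matrix.mul_sub, Matrix.mul_smul,
          ← Matrix.mul_assoc, ← Matrix.mul_assoc V, h1]
        simp
      rw [h2, h3]
      ext (i | i) j <;> rfl
  rw [← key, smul_smul, mul_inv_cancel₀ h, one_smul]

end Field

section Int
variable (U : Matrix ι κ ℤ) (v : κ → ℤ)

/-- The matrix `U` with `v` as an additional row. -/
def addRow (U : Matrix ι κ R) (v : κ → R) : Matrix (ι ⊕ Unit) κ R := fromRows U (replicateRow Unit v)

theorem map_addRow {ι κ S : Type*} [CommRing R] [CommRing S] (f : R →+* S)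
    (U : Matrix ι κ R) (v : κ → R) :
    fromRows (U.map f) ((replicateRow Unit v).map f) = (addRow U v).map f := by
  ext (i | i) j <;> rfl

theorem det_gram_map {κ S : Type*} [Fintype κ] [CommRing R] [CommRing S] (f : R →+* S)
    (U : Matrix ι κ R) :
    (U.map f * (U.map f)ᵀ).det = f (U * Uᵀ).det := by
  rw [← transpose_map, ← Matrix.map_mul]
  exact (f.map_det _).symm

theorem map_replicateRow_gram (f : ℤ →+* ℚ) :
    ((replicateRow Unit v).map f * gramProj (U.map f) * ((replicateRow Unit v).map f)ᵀ) () () =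
      f (v ⬝ᵥ (gramProj U *ᵥ v)) := by
  rw [← map_gramProj, ← transpose_map, ← Matrix.map_mul, ← Matrix.map_mul, map_apply,
    Matrix.mul_assoc, Matrix.mul_apply]
  simp [dotProduct, mulVec, Matrix.mul_apply]

/-- The Schur complement requires an inverse of the Gram matrix, so the identity is proved over `ℚ`
and pulled back along the injection of `ℤ`. -/
theorem det_gram_addRow (h : (U * Uᵀ).det ≠ 0) :
    (addRow U v * (addRow U v)ᵀ).det = v ⬝ᵥ (gramProj U *ᵥ v) := by
  let f := Int.castRingHom ℚ
  have := det_gram_fromRows (U.map f) ((replicateRow Unit v).map f) (by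
    rw [det_gram_map]; exact (map_ne_zero_iff f f.injective_int).2 h)
  rw [map_addRow, det_gram_map, map_replicateRow_gram] at this
  exact f.injective_int this

theorem gramProj_addRow (h : (U * Uᵀ).det ≠ 0) (h' : v ⬝ᵥ (gramProj U *ᵥ v) ≠ 0) :
    (U * Uᵀ).det • gramProj (addRow U v) = (v ⬝ᵥ (gramProj U *ᵥ v)) • gramProj U -
      vecMulVec (gramProj U *ᵥ v) (gramProj U *ᵥ v) := by
  let f := Int.castRingHom ℚ
  have := gramProj_fromRows (U.map f) ((replicateRow Unit v).map f) (by
    rw [det_gram_map]; exact (map_ne_zero_iff f f.injective_int).2 h) (by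
    rw [map_replicateRow_gram]; exact (map_ne_zero_iff f f.injective_int).2 h')
  rw [map_addRow, det_gram_map, map_replicateRow_gram, ← map_gramProj, ← map_gramProj,
    ← Matrix.map_mul, ← transpose_map, ← Matrix.map_mul] at this
  ext i j
  have hij := congrFun₂ this i j
  have hrow : ∀ k, (replicateRow Unit v * gramProj U) () k = (gramProj U *ᵥ v) k := fun k => by
    conv_rhs => rw [← transpose_gramProj, mulVec_transpose]
    rfl
  simp only [smul_apply, sub_apply, map_apply, smul_eq_mul, Matrix.mul_apply (M := _ᵀ),
    transpose_apply, Finset.univ_unique, Finset.sum_singleton, PUnit.default_eq_unit, hrow,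
    ← map_mul, ← map_sub] at hij
  have := f.injective_int hij
  simp only [smul_apply, sub_apply, vecMulVec_apply, smul_eq_mul]
  exact this

/-- A vector with nonzero projection. -/
theorem det_gram_addRow_pos (h : 0 < (U * Uᵀ).det) (hv : gramProj U *ᵥ v ≠ 0) :
    0 < v ⬝ᵥ (gramProj U *ᵥ v) := by
  -- Symmetry and `P² = DP` give `D (v · Pv) = Pv · Pv`, a sum of squares.
  have h1 : (U * Uᵀ).det * (v ⬝ᵥ (gramProj U *ᵥ v)) =
      (gramProj U *ᵥ v) ⬝ᵥ (gramProj U *ᵥ v) := by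
    rw [← dotProduct_gramProj_mulVec, mulVec_mulVec, gramProj_mul_self, smul_mulVec,
      dotProduct_smul, smul_eq_mul]
  have h2 : 0 < (gramProj U *ᵥ v) ⬝ᵥ (gramProj U *ᵥ v) := by
    have h0 : 0 ≤ (gramProj U *ᵥ v) ⬝ᵥ (gramProj U *ᵥ v) :=
      Finset.sum_nonneg fun i _ => mul_self_nonneg _
    refine lt_of_le_of_ne h0 fun h => hv ?_
    exact dotProduct_self_eq_zero.1 h.symm
  rw [← h1] at h2
  exact (pos_iff_pos_of_mul_pos h2).1 h

/-- If `Pv = 0`, the definition of `P` writes `Dv` as a combination of the rows; conversely `P`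
annihilates the rows. -/
theorem gramProj_mulVec_eq_zero_iff (h : (U * Uᵀ).det ≠ 0) :
    gramProj U *ᵥ v = 0 ↔ (fun j => (v j : ℚ)) ∈ Submodule.span ℚ
      (Set.range fun i => fun j => (U i j : ℚ)) := by
  let f := Int.castRingHom ℚ
  have hmap : ∀ w : κ → ℤ, (fun j => ((gramProj U *ᵥ w) j : ℚ)) =
      (gramProj (U.map f)) *ᵥ fun j => (w j : ℚ) := by
    intro w
    ext j
    rw [← map_gramProj]
    simp [mulVec, dotProduct, f]
  have hdet : ((U.map f) * (U.map f)ᵀ).det ≠ 0 := by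
    rw [det_gram_map]; exact (map_ne_zero_iff f f.injective_int).2 h
  have h1 : gramProj U *ᵥ v = 0 ↔ (gramProj (U.map f) *ᵥ fun j => (v j : ℚ)) = 0 := by
    rw [← hmap]
    refine ⟨fun h => by rw [h]; ext; simp, fun h => ?_⟩
    ext j
    simpa using congrFun h j
  rw [h1]
  constructor
  · intro h2
    rw [gramProj_mulVec, sub_eq_zero] at h2
    rw [← Submodule.smul_mem_iff _ hdet, h2, mulVec_transpose, vecMul_eq_sum]
    exact Submodule.sum_mem _ fun i _ => Submodule.smul_mem _ _
      (Submodule.subset_span ⟨i, rfl⟩)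
  · intro h2
    have : Submodule.span ℚ (Set.range fun i => fun j => (U i j : ℚ)) ≤
        LinearMap.ker (mulVecLin (gramProj (U.map f))) := by
      rw [Submodule.span_le]
      rintro _ ⟨i, rfl⟩
      have := congrArg (fun M : Matrix κ ι ℚ => fun j => M j i) (gramProj_mul_transpose (U.map f))
      simpa [Matrix.mul_apply, funext_iff, mulVec, dotProduct] using this
    exact this h2

end Int
end Matrix

/-! ### Sizes of determinants, and the lattice completed by the projection. -/

namespace Matrix
variable {ι κ : Type*} [Fintype ι] [DecidableEq ι] [Fintype κ] [DecidableEq κ]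

/-- Leibniz expansion: at most `r!` terms of absolute value at most `2 ^ (r * b)`, and `r! ≤ 2 ^ (r
* r)`. -/
theorem natAbs_det_le (M : Matrix ι ι ℤ) {r b : ℕ} (hr : Fintype.card ι ≤ r)
    (h : ∀ i j, (M i j).natAbs ≤ 2 ^ b) : M.det.natAbs ≤ 2 ^ (r * (r + b)) := by
  have h1 := det_le (A := M) (abv := AbsoluteValue.abs) (x := (2 ^ b : ℤ)) fun i j => by
    have := h i j
    rw [AbsoluteValue.abs_apply, Int.abs_eq_natAbs]; exact_mod_cast this
  rw [AbsoluteValue.abs_apply, Int.abs_eq_natAbs, nsmul_eq_mul] at h1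
  have h2 : M.det.natAbs ≤ (Fintype.card ι).factorial * (2 ^ b) ^ Fintype.card ι := by
    exact_mod_cast h1
  refine h2.trans ?_
  have h3 : (Fintype.card ι).factorial ≤ 2 ^ (r * r) := by
    refine (Nat.factorial_le hr).trans ((Nat.factorial_le_pow r).trans ?_)
    rw [pow_mul]
    exact Nat.pow_le_pow_left Nat.lt_two_pow_self.le r
  have h4 : (2 ^ b) ^ Fintype.card ι ≤ 2 ^ (r * b) := by
    rw [← pow_mul, mul_comm]
    exact Nat.pow_le_pow_right (by norm_num) (Nat.mul_le_mul_right _ hr)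
  rw [mul_add, pow_add]
  exact Nat.mul_le_mul h3 h4

theorem natAbs_sum_le {ι : Type*} {s : Finset ι} (f : ι → ℤ) {B : ℕ} (h : ∀ i ∈ s, (f i).natAbs ≤ B) :
    (∑ i ∈ s, f i).natAbs ≤ s.card * B := by
  refine (Int.natAbs_sum_le _ _).trans ?_
  rw [← smul_eq_mul]
  exact Finset.sum_le_card_nsmul _ _ _ h

theorem natAbs_mul_apply_le {ι κ μ : Type*} [Fintype ι] (M : Matrix μ ι ℤ) (N : Matrix ι κ ℤ) {r a b : ℕ}
    (hr : Fintype.card ι ≤ r) (hM : ∀ i j, (M i j).natAbs ≤ 2 ^ a)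
    (hN : ∀ i j, (N i j).natAbs ≤ 2 ^ b) (i : μ) (j : κ) :
    ((M * N) i j).natAbs ≤ 2 ^ (r + a + b) := by
  rw [mul_apply]
  refine (natAbs_sum_le _ (B := 2 ^ a * 2 ^ b) fun k _ => ?_).trans ?_
  · rw [Int.natAbs_mul]
    exact Nat.mul_le_mul (hM _ _) (hN _ _)
  · rw [pow_add, pow_add, mul_assoc]
    exact Nat.mul_le_mul_right _ (hr.trans Nat.lt_two_pow_self.le)

variable (U : Matrix ι κ ℤ) {r n y : ℕ}

theorem natAbs_det_gram_le {κ : Type*} [Fintype κ] (U : Matrix ι κ ℤ) (hr : Fintype.card ι ≤ r) (hn : Fintype.card κ ≤ n)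
    (hU : ∀ i j, (U i j).natAbs ≤ 2 ^ y) :
    (U * Uᵀ).det.natAbs ≤ 2 ^ (r * (r + (n + y + y))) :=
  natAbs_det_le _ hr fun i j => natAbs_mul_apply_le _ _ hn hU (fun _ _ => hU _ _) i j

/-- An entry of the adjugate is the determinant of the Gram matrix with a row replaced by a unit
vector, hence as small as the Gram determinant. The two further products add `2r + 2y` to the
exponent, and the difference adds `1`. -/
theorem natAbs_gramProj_le (hr : Fintype.card ι ≤ r) (hn : Fintype.card κ ≤ n)
    (hU : ∀ i j, (U i j).natAbs ≤ 2 ^ y) (i j : κ) :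
    (gramProj U i j).natAbs ≤ 2 ^ (r * (r + (n + y + y)) + 2 * r + 2 * y + 1) := by
  have hG := natAbs_det_gram_le U hr hn hU
  have hadj : ∀ i j, ((U * Uᵀ).adjugate i j).natAbs ≤ 2 ^ (r * (r + (n + y + y))) := by
    intro i j
    rw [adjugate_apply]
    refine natAbs_det_le _ hr fun k l => ?_
    by_cases h : k = j
    · subst h
      rw [updateRow_self, Pi.single_apply]
      split
      · simpa using Nat.one_le_two_pow
      · simp
    · rw [updateRow_ne h]
      exact natAbs_mul_apply_le _ _ hn hU (fun _ _ => hU _ _) k l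
  have h2 := natAbs_mul_apply_le _ _ hr (natAbs_mul_apply_le (Uᵀ) _ hr (fun _ _ => hU _ _) hadj)
    hU i j
  have h1 : (((U * Uᵀ).det • (1 : Matrix κ κ ℤ)) i j).natAbs ≤ 2 ^ (r * (r + (n + y + y))) := by
    rw [smul_apply, one_apply]
    split
    · simpa using hG
    · simp
  rw [gramProj, sub_apply]
  refine (Int.natAbs_sub_le _ _).trans ((add_le_add h1 h2).trans ?_)
  generalize r * (r + (n + y + y)) = c
  have h3 : 2 ^ c ≤ 2 ^ (c + 2 * r + 2 * y) := Nat.pow_le_pow_right (by norm_num) (by omega)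
  rw [pow_succ, show r + (r + y + c) + y = c + 2 * r + 2 * y by ring]
  omega

/-- The lattice spanned by `V` and by a multiple of the orthogonal projections of the unit
vectors. -/
def projLattice {κ : Type*} [Fintype κ] (P : Matrix κ κ ℤ) (V : Set (κ → ℤ)) : Submodule ℤ (κ → ℤ) :=
  Submodule.span ℤ V ⊔ LinearMap.range (mulVecLin P)

theorem det_smul_mem_projLattice {V : Set (κ → ℤ)} (hV : ∀ i, U i ∈ V) (x : κ → ℤ) :
    (U * Uᵀ).det • x ∈ projLattice (gramProj U) V := by
  have h := gramProj_mulVec U x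
  rw [eq_sub_iff_add_eq', mulVec_transpose, vecMul_eq_sum] at h
  rw [← h]
  exact Submodule.add_mem_sup (Submodule.sum_mem _ fun i _ => Submodule.smul_mem _ _
    (Submodule.subset_span (hV i))) ⟨x, rfl⟩

/-- Let `v = m + Px` with `m` in the span. Applying `P`, which kills `v` and `m`, gives `D Px = 0`,
so `Px = 0`: the complement contributes nothing to vectors of the rational span. -/
theorem mem_projLattice_iff {V : Set (κ → ℤ)} (hG : (U * Uᵀ).det ≠ 0)
    (hV : ∀ v ∈ V, gramProj U *ᵥ v = 0) {v : κ → ℤ} (hv : gramProj U *ᵥ v = 0) :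
    v ∈ projLattice (gramProj U) V ↔ v ∈ Submodule.span ℤ V := by
  refine ⟨fun h => ?_, fun h => Submodule.mem_sup_left h⟩
  obtain ⟨m, hm, _, ⟨x, rfl⟩, rfl⟩ := Submodule.mem_sup.1 h
  have hm0 : gramProj U *ᵥ m = 0 := by
    have : Submodule.span ℤ V ≤ LinearMap.ker (mulVecLin (gramProj U)) := by
      rw [Submodule.span_le]; exact hV
    exact this hm
  rw [mulVec_add, hm0, zero_add, mulVecLin_apply, mulVec_mulVec, gramProj_mul_self,
    smul_mulVec] at hv
  rw [mulVecLin_apply, (smul_eq_zero_iff_right hG).1 hv, add_zero]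
  exact hm

theorem projLattice_insert {κ : Type*} [Fintype κ] (P : Matrix κ κ ℤ) (V : Set (κ → ℤ)) (v : κ → ℤ) :
    projLattice P (Insert.insert v V) = projLattice P V ⊔ Submodule.span ℤ {v} := by
  rw [projLattice, Submodule.span_insert, projLattice, sup_assoc, sup_comm]

end Matrix

/-- The submodule contains the kernel of reduction modulo `D`, whose index is the number of residue
vectors reached. -/
theorem Submodule.index_of_smul_mem {κ : Type*} [Fintype κ] {N : Submodule ℤ (κ → ℤ)} {D : ℕ}
    (hD : 0 < D) (h : ∀ x, (D : ℤ) • x ∈ N) :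
    0 < N.toAddSubgroup.index ∧ N.toAddSubgroup.index ≤ D ^ Fintype.card κ := by
  have : NeZero D := ⟨hD.ne'⟩
  let f : (κ → ℤ) →+ (κ → ZMod D) := (Int.castAddHom (ZMod D)).compLeft κ
  have hk : f.ker ≤ N.toAddSubgroup := by
    intro x hx
    have hx : ∀ i, ((x i : ℤ) : ZMod D) = 0 := fun i => congrFun hx i
    have : x = (D : ℤ) • fun i => x i / D := by
      ext i
      have := (ZMod.intCast_zmod_eq_zero_iff_dvd _ _).1 (hx i)
      simp [Int.mul_ediv_cancel' this]
    rw [this]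
    exact h _
  have h1 : f.ker.index ≤ D ^ Fintype.card κ := by
    rw [AddSubgroup.index_ker]
    have h0 : Nat.card f.range ≤ Nat.card (κ → ZMod D) :=
      Nat.card_le_card_of_injective Subtype.val Subtype.val_injective
    rwa [Nat.card_fun, Nat.card_zmod, Nat.card_eq_fintype_card (α := κ)] at h0
  have h2 : f.ker.index ≠ 0 := by
    rw [AddSubgroup.index_ker]
    exact Nat.card_pos.ne'
  have h3 := AddSubgroup.index_dvd_of_le hk
  exact ⟨Nat.pos_of_dvd_of_pos h3 (by omega), (Nat.le_of_dvd (by omega) h3).trans h1⟩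

/-- The index is multiplicative, and a proper inclusion of finite index has relative index at least
two. -/
theorem Submodule.two_mul_index_le {κ : Type*} {N N' : Submodule ℤ (κ → ℤ)} (h : N < N')
    (hN : 0 < N.toAddSubgroup.index) : 2 * N'.toAddSubgroup.index ≤ N.toAddSubgroup.index := by
  have hle : N.toAddSubgroup ≤ N'.toAddSubgroup := h.le
  have h1 := AddSubgroup.relIndex_mul_index hle
  rw [← h1] at hN ⊢
  have h2 : N.toAddSubgroup.relIndex N'.toAddSubgroup ≠ 1 := by
    rw [Ne, AddSubgroup.relIndex_eq_one]
    exact fun hh => h.not_ge hh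
  have h3 : N.toAddSubgroup.relIndex N'.toAddSubgroup ≠ 0 := fun h0 => by simp [h0] at hN
  exact Nat.mul_le_mul_right _ (by omega)

/-! ## The lattice of a triangular basis -/

namespace IntList

/-- A list of integers as a finitely supported sequence. -/
def seq (l : List ℤ) : ℕ → ℤ := fun i => l.getD i 0

/-- The shift of sequences. -/
def shift : (ℕ → ℤ) →ₗ[ℤ] (ℕ → ℤ) where
  toFun x := fun i => Nat.casesOn i 0 x
  map_add' x y := by ext i; cases i <;> simp
  map_smul' c x := by ext i; cases i <;> simp

@[simp] theorem shift_zero (x : ℕ → ℤ) : shift x 0 = 0 := rfl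
@[simp] theorem shift_succ (x : ℕ → ℤ) (i : ℕ) : shift x (i + 1) = x i := rfl

theorem eq_shift {x : ℕ → ℤ} (h : x 0 = 0) : x = shift fun i => x (i + 1) := by
  ext i; cases i <;> simp [h]

theorem shift_injective : Function.Injective shift := fun x y h => by
  ext i; exact congrFun h (i + 1)

theorem seq_zero (l : List ℤ) : seq l 0 = l.headD 0 := by cases l <;> rfl

theorem seq_tail (l : List ℤ) (i : ℕ) : seq l.tail i = seq l (i + 1) := by
  cases l <;> simp [seq]

theorem seq_of_le {l : List ℤ} {i : ℕ} (h : l.length ≤ i) : seq l i = 0 := by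
  simp [seq, h]

/-- The lattice spanned by the rows of a triangular matrix; the rows are given without the entries
to the left of the diagonal. -/
def lattice : List (List ℤ) → Submodule ℤ (ℕ → ℤ)
  | [] => ⊥
  | t :: T => Submodule.span ℤ {seq t} ⊔ (lattice T).map shift

/-- The sequences of multiples of `D` that vanish from the index `m` on. -/
def IsMultiple (D : ℤ) (m : ℕ) (x : ℕ → ℤ) : Prop := (∀ i, D ∣ x i) ∧ ∀ i, m ≤ i → x i = 0

/-- A triangular basis of a lattice that contains all multiples of `D`. -/
def IsBasis (D : ℤ) : List (List ℤ) → Prop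
  | [] => True
  | t :: T => t.length = T.length + 1 ∧ 0 < t.headD 0 ∧ t.headD 0 ≤ D ∧
      (∀ x, IsMultiple D (T.length + 1) x → x ∈ lattice (t :: T)) ∧ IsBasis D T

theorem IsBasis.mem_lattice {D : ℤ} {T : List (List ℤ)} (h : IsBasis D T) {x : ℕ → ℤ}
    (hx : IsMultiple D T.length x) : x ∈ lattice T := by
  cases T with
  | nil => exact (Submodule.mem_bot ℤ).2 (funext fun i => hx.2 i (Nat.zero_le _))
  | cons t T => exact h.2.2.2.1 x hx

theorem length_subMod (D q : ℤ) {v t : List ℤ} {m : ℕ} (hv : v.length = m) (ht : t.length = m) :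
    (subMod D q v t).length = m := by
  simp [subMod, hv, ht]

theorem seq_subMod {D q : ℤ} {v t : List ℤ} (h : v.length = t.length) (i : ℕ) :
    seq (subMod D q v t) i = (seq v i - q * seq t i) % D := by
  simp only [seq, subMod, List.getD_eq_getElem?_getD, List.getElem?_zipWith]
  by_cases hi : i < v.length
  · rw [List.getElem?_eq_getElem hi, List.getElem?_eq_getElem (h ▸ hi)]; rfl
  · rw [List.getElem?_eq_none (by omega), List.getElem?_eq_none (by omega)]; simp

/-- Subtracting a multiple of a vector does not change the span, even modulo `D`. -/
theorem exists_seq_subMod {D q : ℤ} {v t : List ℤ} {T : List (List ℤ)} (hT : IsBasis D T)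
    (hv : v.length = T.length + 1) (ht : t.length = T.length + 1)
    (h : seq (subMod D q v t) 0 = seq v 0 - q * seq t 0) :
    ∃ z ∈ (lattice T).map shift, seq (subMod D q v t) = seq v - q • seq t + z := by
  refine ⟨seq (subMod D q v t) - (seq v - q • seq t), ?_, by abel⟩
  -- The correction made by the reduction consists of multiples of `D` and, by `h`, vanishes at the
  -- first entry. It therefore lies in the shifted lattice of the remaining rows, which contains all
  -- such multiples.
  rw [eq_shift (x := seq (subMod D q v t) - (seq v - q • seq t)) (by simp [h])]
  refine ⟨_, hT.mem_lattice ⟨fun i => ?_, fun i hi => ?_⟩, rfl⟩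
  · simp only [Pi.sub_apply, Pi.smul_apply, smul_eq_mul, seq_subMod (hv.trans ht.symm)]
    rw [dvd_sub_comm]
    exact Int.dvd_self_sub_emod
  · simp only [Pi.sub_apply, Pi.smul_apply, smul_eq_mul, seq_subMod (hv.trans ht.symm)]
    rw [seq_of_le (l := v) (by omega), seq_of_le (l := t) (by omega)]
    simp

theorem span_pair_sup {M : Type*} [AddCommGroup M] {S : Submodule ℤ M} {t v w z : M} {q : ℤ}
    (hz : z ∈ S) (hw : w = v - q • t + z) :
    Submodule.span ℤ {t} ⊔ Submodule.span ℤ {w} ⊔ S =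
      Submodule.span ℤ {t} ⊔ Submodule.span ℤ {v} ⊔ S := by
  have key : ∀ {v w z : M} {q : ℤ}, z ∈ S → w = v - q • t + z →
      Submodule.span ℤ {t} ⊔ Submodule.span ℤ {w} ⊔ S ≤
      Submodule.span ℤ {t} ⊔ Submodule.span ℤ {v} ⊔ S := by
    intro v w z q hz hw
    refine sup_le (sup_le (le_sup_left.trans le_sup_left) ?_) le_sup_right
    rw [Submodule.span_singleton_le_iff_mem, hw]
    refine add_mem (sub_mem ?_ ?_) (Submodule.mem_sup_right hz)
    · exact Submodule.mem_sup_left (Submodule.mem_sup_right (Submodule.mem_span_singleton_self v))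
    · exact Submodule.smul_mem _ _ (Submodule.mem_sup_left
        (Submodule.mem_sup_left (Submodule.mem_span_singleton_self t)))
  refine le_antisymm (key hz hw) (key (z := -z) (q := -q) (neg_mem hz) ?_)
  rw [hw, neg_smul]; abel

/-- The invariant of the Euclidean algorithm. -/
def EuclidInv (D : ℤ) (T : List (List ℤ)) (S : Submodule ℤ (ℕ → ℤ)) (s : ℤ × List ℤ × List ℤ) :
    Prop :=
  s.1 = D ∧ s.2.1.length = T.length + 1 ∧ s.2.2.length = T.length + 1 ∧ 0 < s.2.1.headD 0 ∧
    s.2.1.headD 0 ≤ D ∧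
    Submodule.span ℤ {seq s.2.1} ⊔ Submodule.span ℤ {seq s.2.2} ⊔ (lattice T).map shift = S

theorem EuclidInv.step {D : ℤ} {T : List (List ℤ)} (hT : IsBasis D T) {S : Submodule ℤ (ℕ → ℤ)}
    {s : ℤ × List ℤ × List ℤ} (hs : EuclidInv D T S s) (hc : euclidCond s = true) :
    EuclidInv D T S (euclidStep s) := by
  obtain ⟨D', t, v⟩ := s
  obtain ⟨rfl, h1, h2, h3, h4, rfl⟩ := hs
  dsimp only at *
  have hmod : v.headD 0 - v.headD 0 / t.headD 0 * t.headD 0 = v.headD 0 % t.headD 0 := by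
    rw [Int.emod_def, mul_comm]
  have h5 := Int.emod_lt_of_pos (v.headD 0) h3
  have h6 := Int.emod_nonneg (v.headD 0) h3.ne'
  -- The remainder is below the pivot and the pivot is at most `D`, so reduction modulo `D` leaves
  -- this leading entry alone.
  have h7 : seq (subMod D' (v.headD 0 / t.headD 0) v t) 0 = v.headD 0 % t.headD 0 := by
    rw [seq_subMod (h2.trans h1.symm), seq_zero, seq_zero, hmod, Int.emod_eq_of_lt h6 (by omega)]
  obtain ⟨z, hz, hzz⟩ := exists_seq_subMod hT h2 h1 (q := v.headD 0 / t.headD 0)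
    (by rw [h7, seq_zero, seq_zero, hmod])
  refine ⟨rfl, length_subMod _ _ h2 h1, h1, ?_, ?_, ?_⟩
  · change 0 < (subMod D' (v.headD 0 / t.headD 0) v t).headD 0
    rw [← seq_zero, h7]
    have : ¬ v.headD 0 % t.headD 0 = 0 := by
      simp only [euclidCond, Bool.and_eq_true, decide_eq_true_eq, Bool.not_eq_true',
        decide_eq_false_iff_not] at hc
      exact hc.2
    omega
  · change (subMod D' (v.headD 0 / t.headD 0) v t).headD 0 ≤ D'
    rw [← seq_zero, h7]; omega
  · rw [← span_pair_sup hz hzz, sup_comm (Submodule.span ℤ {seq t})]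
    rfl

theorem euclidInv_euclid {D : ℤ} {T : List (List ℤ)} (hT : IsBasis D T) {S : Submodule ℤ (ℕ → ℤ)}
    {s : ℤ × List ℤ × List ℤ} (hs : EuclidInv D T S s) : EuclidInv D T S (euclid s) :=
  euclid_induction (p := EuclidInv D T S) s hs (fun _ h hc => h.step hT hc) _ le_rfl

theorem euclid_eq_self {s : ℤ × List ℤ × List ℤ} (h : euclidCond s = false) : euclid s = s := by
  rw [euclid, (Nat.find_eq_zero (exists_euclidCond_eq_false' s)).2 h]; rfl

/-- The Euclidean algorithm stops when the leading entry of one vector divides that of the other.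
One more subtraction makes the latter zero, so its tail can be handed to the shorter rows without
changing the total span. -/
theorem insertRow_spec {D : ℤ} (hD : 0 < D) {t v : List ℤ} {T : List (List ℤ)}
    (h : IsBasis D (t :: T)) (hv : v.length = T.length + 1) :
    (insertRow D t v).1.length = T.length + 1 ∧ (insertRow D t v).2.length = T.length ∧
      0 < (insertRow D t v).1.headD 0 ∧ (insertRow D t v).1.headD 0 ≤ D ∧
      Submodule.span ℤ {seq (insertRow D t v).1} ⊔ Submodule.span ℤ
        {shift (seq (insertRow D t v).2)} ⊔ (lattice T).map shift =
        Submodule.span ℤ {seq t} ⊔ Submodule.span ℤ {seq v} ⊔ (lattice T).map shift := by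
  obtain ⟨h1, h2, h3, -, hT⟩ := h
  have hs : EuclidInv D T (Submodule.span ℤ {seq t} ⊔ Submodule.span ℤ {seq v} ⊔
    (lattice T).map shift) (D, t, v) := ⟨rfl, h1, hv, h2, h3, rfl⟩
  have hc := euclidCond_euclid (D, t, v)
  have he := euclidInv_euclid hT hs
  rw [insertRow, if_pos hD]
  generalize euclid (D, t, v) = s at he hc
  obtain ⟨D', t', v'⟩ := s
  obtain ⟨rfl, h4, h5, h6, h7, h8⟩ := he
  dsimp only at *
  have h9 : v'.headD 0 % t'.headD 0 = 0 := by
    simpa [euclidCond, hD, h6, -List.headD_eq_head?_getD] using hc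
  have h10 : v'.headD 0 - v'.headD 0 / t'.headD 0 * t'.headD 0 = 0 := by
    rw [Int.emod_def] at h9
    linarith [mul_comm (t'.headD 0) (v'.headD 0 / t'.headD 0)]
  have h11 : seq (subMod D' (v'.headD 0 / t'.headD 0) v' t') 0 = 0 := by
    rw [seq_subMod (h5.trans h4.symm), seq_zero, seq_zero, h10]; simp
  obtain ⟨z, hz, hzz⟩ := exists_seq_subMod hT h5 h4 (q := v'.headD 0 / t'.headD 0)
    (by rw [h11, seq_zero, seq_zero, h10])
  refine ⟨h4, by simp [length_subMod _ _ h5 h4], h6, h7, ?_⟩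
  rw [← h8, ← span_pair_sup hz hzz]
  congr 3
  rw [eq_shift h11]
  congr 2
  ext i
  exact seq_tail _ _

theorem insert_spec {D : ℤ} (hD : 0 < D) {T : List (List ℤ)} (h : IsBasis D T) {v : List ℤ}
    (hv : v.length = T.length) :
    IsBasis D (IntList.insert D T v).1 ∧
      lattice (IntList.insert D T v).1 = lattice T ⊔ Submodule.span ℤ {seq v} ∧
      ((IntList.insert D T v).2 = false ↔ seq v ∈ lattice T) := by
  induction T generalizing v with
  | nil =>
    have : seq v = 0 := by
      ext i; exact seq_of_le (by simp at hv; simp [hv])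
    rw [insert_nil]
    simp [this, lattice, IsBasis]
  | cons t T ih =>
    obtain ⟨h1, h2, h3, h4, h5⟩ := insertRow_spec hD h hv
    obtain ⟨ht1, ht2, ht3, hfull, hT⟩ := id h
    obtain ⟨ih1, ih2, ih3⟩ := ih hT h2
    have hlen := (forall₂_insert D T (insertRow D t v).2).length_eq
    have hlat : lattice ((insertRow D t v).1 :: (IntList.insert D T (insertRow D t v).2).1) =
        lattice (t :: T) ⊔ Submodule.span ℤ {seq v} := by
      rw [lattice, lattice, ih2, Submodule.map_sup, Submodule.map_span, Set.image_singleton,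
        sup_right_comm, ← h5, sup_assoc, sup_comm (Submodule.map _ _)]
    rw [insert_cons]
    refine ⟨⟨?_, h3, h4, ?_, ih1⟩, hlat, ?_⟩
    · rw [h1, hlen]
    · intro x hx
      rw [hlat]
      exact Submodule.mem_sup_left (hfull x (hlen ▸ hx))
    -- Leading entries of lattice vectors are multiples of the pivot. If that of `v` is not, `v` is
    -- new; if it is, the row stays as it was and membership passes to the remainder.
    · by_cases hr : v.headD 0 % t.headD 0 = 0
      · have he : euclid (D, t, v) = (D, t, v) := by
          refine euclid_eq_self ?_
          simp [euclidCond, hr, -List.headD_eq_head?_getD]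
        have he1 : (insertRow D t v).1 = t := by rw [insertRow, if_pos hD, he]
        simp only [hr, decide_true, Bool.not_true, Bool.false_or]
        rw [ih3, lattice]
        have h6 : seq v ∈ Submodule.span ℤ {seq t} ⊔ (lattice T).map shift ↔
            shift (seq (insertRow D t v).2) ∈ Submodule.span ℤ {seq t} ⊔ (lattice T).map shift := by
          rw [he1] at h5
          have h7 : ∀ x, x ∈ Submodule.span ℤ {seq t} ⊔ (lattice T).map shift ↔
            Submodule.span ℤ {seq t} ⊔ Submodule.span ℤ {x} ⊔ (lattice T).map shift =
              Submodule.span ℤ {seq t} ⊔ (lattice T).map shift := by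
            intro x
            rw [sup_right_comm, sup_eq_left, Submodule.span_singleton_le_iff_mem]
          rw [h7, h7, h5]
        rw [h6]
        refine ⟨fun h => Submodule.mem_sup_right ⟨_, h, rfl⟩, fun h => ?_⟩
        obtain ⟨_, hc, _, ⟨y, hy, rfl⟩, hsum⟩ := Submodule.mem_sup.1 h
        obtain ⟨c, rfl⟩ := Submodule.mem_span_singleton.1 hc
        have h0 := congrFun hsum 0
        simp only [Pi.add_apply, Pi.smul_apply, shift_zero, add_zero, smul_eq_mul, seq_zero,
          mul_eq_zero, ht2.ne', or_false] at h0
        rw [h0, zero_smul, zero_add] at hsum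
        rwa [← shift_injective hsum]
      · simp only [hr, decide_false, Bool.not_false, Bool.true_or, Bool.true_eq_false, false_iff]
        intro h
        obtain ⟨_, hc, _, ⟨y, hy, rfl⟩, hsum⟩ := Submodule.mem_sup.1 h
        obtain ⟨c, rfl⟩ := Submodule.mem_span_singleton.1 hc
        have h0 := congrFun hsum 0
        simp only [Pi.add_apply, Pi.smul_apply, shift_zero, add_zero, smul_eq_mul, seq_zero] at h0
        exact hr (by rw [← h0]; simp)

theorem diagonal_spec {α : Type} {D : ℤ} (hD : 0 < D) (l : List α) :
    IsBasis D (diagonal D l) ∧ ∀ x ∈ lattice (diagonal D l), IsMultiple D l.length x := by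
  induction l using List.reverseRecOn with
  | nil =>
    refine ⟨trivial, fun x hx => ?_⟩
    rw [(Submodule.mem_bot ℤ).1 hx]
    exact ⟨fun i => by simp, fun i _ => rfl⟩
  | append_singleton l a ih =>
    have hl := length_diagonal D l
    rw [show diagonal D (l ++ [a]) = (D :: (diagonal D l).map fun _ => 0) :: diagonal D l by
      simp [diagonal]]
    have hs : ∀ i, seq (D :: (diagonal D l).map fun _ => 0) (i + 1) = 0 := by
      intro i
      rw [← seq_tail, List.tail_cons]
      simp only [seq, List.getD_eq_getElem?_getD, List.getElem?_map]
      cases (diagonal D l)[i]? <;> rfl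
    refine ⟨⟨by simp, hD, le_rfl, fun x hx => ?_, ih.1⟩, fun x hx => ?_⟩
    -- The first entry fixes the multiple of the new row; that row vanishes elsewhere, so the other
    -- entries are left to the old diagonal.
    · refine Submodule.mem_sup.2 ⟨_, Submodule.mem_span_singleton.2 ⟨x 0 / D, rfl⟩, _,
        ⟨fun i => x (i + 1), ih.1.mem_lattice ⟨fun i => hx.1 _, fun i hi => hx.2 _ (by omega)⟩,
          rfl⟩, ?_⟩
      ext i
      cases i with
      | zero => simpa [seq] using Int.ediv_mul_cancel (hx.1 0)
      | succ i => simp only [Pi.add_apply, Pi.smul_apply, hs, shift_succ, smul_zero, zero_add]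
    · obtain ⟨_, hc, _, ⟨y, hy, rfl⟩, rfl⟩ := Submodule.mem_sup.1 hx
      obtain ⟨c, rfl⟩ := Submodule.mem_span_singleton.1 hc
      obtain ⟨h1, h2⟩ := ih.2 y hy
      refine ⟨fun i => ?_, fun i hi => ?_⟩
      · cases i with
        | zero => simp [seq]
        | succ i =>
          simpa only [Pi.add_apply, Pi.smul_apply, hs, shift_succ, smul_zero, zero_add] using h1 i
      · cases i with
        | zero => simp at hi
        | succ i =>
          simpa only [Pi.add_apply, Pi.smul_apply, hs, shift_succ, smul_zero, zero_add] using
            h2 i (by simpa using hi)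

end IntList

/-! ## Integral forms of an automaton -/

namespace QAutomaton

variable {S : Type*} {n : ℕ}

theorem forward_nil (A : QAutomaton S n) : A.forward [] = A.init := by
  simp [forward, wordTrans]

theorem forward_concat (A : QAutomaton S n) (w : List S) (σ : S) :
    A.forward (w ++ [σ]) = Matrix.vecMul (A.forward w) (A.trans σ) := by
  simp [forward, wordTrans, Matrix.vecMul_vecMul]

/-- A common denominator of `α` and `μ`, and the integral multiples of `α` and `μ`. -/
structure IntForm (A : QAutomaton S n) where
  /-- the common denominator -/
  den : ℤ
  den_pos : 0 < den
  /-- the multiple of `α` -/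
  init : Fin n → ℤ
  /-- the multiples of the matrices -/
  trans : S → Matrix (Fin n) (Fin n) ℤ
  init_eq : ∀ i, (init i : ℚ) = den * A.init i
  trans_eq : ∀ σ i j, (trans σ i j : ℚ) = den * A.trans σ i j

namespace IntForm

variable {A : QAutomaton S n} (I : A.IntForm)

/-- The multiple of the forward vector, if it is integral. -/
def vec (w : List S) : Fin n → ℤ := fun i => ⌊(I.den : ℚ) * A.forward w i⌋

/-- The multiple of the forward vector is integral. -/
def IsInt (w : List S) : Prop := ∀ i, (I.vec w i : ℚ) = I.den * A.forward w i

/-- The vector of the word `wσ`, with the square of the denominator. -/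
def next (w : List S) (σ : S) : Fin n → ℤ := (I.trans σ).transpose.mulVec (I.vec w)

theorem den_ne_zero : (I.den : ℚ) ≠ 0 := by exact_mod_cast I.den_pos.ne'

theorem isInt_of {w : List S} (h : ∀ i, ∃ z : ℤ, (I.den : ℚ) * A.forward w i = z) : I.IsInt w := by
  intro i
  obtain ⟨z, hz⟩ := h i
  simp [vec, hz]

theorem isInt_of_isIntegerVector {w : List S} (h : IsIntegerVector (A.forward w)) : I.IsInt w :=
  I.isInt_of fun i => let ⟨z, hz⟩ := h i; ⟨I.den * z, by simp [hz]⟩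

theorem isInt_nil : I.IsInt [] := I.isInt_of fun i => ⟨I.init i, by rw [I.init_eq, forward_nil]⟩

theorem vec_nil : I.vec [] = I.init := by
  ext i
  have := I.isInt_nil i
  rw [forward_nil, ← I.init_eq] at this
  exact_mod_cast this

theorem next_eq {w : List S} (h : I.IsInt w) (σ : S) (i : Fin n) :
    (I.next w σ i : ℚ) = I.den * (I.den * A.forward (w ++ [σ]) i) := by
  rw [forward_concat]
  simp only [next, Matrix.mulVec, Matrix.vecMul, dotProduct, Matrix.transpose_apply, Int.cast_sum,
    Int.cast_mul, I.trans_eq, h _, Finset.mul_sum]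
  exact Finset.sum_congr rfl fun j _ => by ring

theorem isIntegerVector_iff {w : List S} (h : I.IsInt w) (σ : S) :
    IsIntegerVector (A.forward (w ++ [σ])) ↔ ∀ i, I.den * I.den ∣ I.next w σ i := by
  have h0 := I.den_ne_zero
  refine forall_congr' fun i => ?_
  have h1 := I.next_eq h σ i
  constructor
  · rintro ⟨z, hz⟩
    refine ⟨z, ?_⟩
    rw [hz] at h1
    have : (I.next w σ i : ℚ) = ((I.den * I.den * z : ℤ) : ℚ) := by rw [h1]; push_cast; ring
    exact_mod_cast this
  · rintro ⟨z, hz⟩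
    refine ⟨z, ?_⟩
    rw [hz] at h1
    push_cast at h1
    have h2 : (I.den : ℚ) * I.den ≠ 0 := mul_ne_zero h0 h0
    exact mul_left_cancel₀ h2 (by rw [h1]; ring)

theorem isInt_concat_iff {w : List S} (h : I.IsInt w) (σ : S) :
    I.IsInt (w ++ [σ]) ↔ ∀ i, I.den ∣ I.next w σ i := by
  have h0 := I.den_ne_zero
  constructor
  · intro hi i
    refine ⟨I.vec (w ++ [σ]) i, ?_⟩
    have := I.next_eq h σ i
    rw [← hi i] at this
    exact_mod_cast this
  · intro hi
    refine I.isInt_of fun i => ?_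
    obtain ⟨z, hz⟩ := hi i
    have h1 := I.next_eq h σ i
    rw [hz, Int.cast_mul] at h1
    exact ⟨z, (mul_left_cancel₀ h0 h1).symm⟩

theorem next_eq_mul {w : List S} {σ : S} (h : I.IsInt w) (h' : I.IsInt (w ++ [σ])) (i : Fin n) :
    I.next w σ i = I.den * I.vec (w ++ [σ]) i := by
  have := I.next_eq h σ i
  rw [← h' i] at this
  exact_mod_cast this

/-! ### Spans -/

/-- The family of vectors of the words in a list. -/
def vecs (W : List (List S)) : Set (Fin n → ℤ) := I.vec '' {w | w ∈ W}

theorem forward_mem_spanOf_int_iff {W : List (List S)} (hW : ∀ w ∈ W, I.IsInt w) {w : List S}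
    (hw : I.IsInt w) : A.forward w ∈ A.spanOf ℤ W ↔ I.vec w ∈ Submodule.span ℤ (I.vecs W) := by
  have h0 := I.den_ne_zero
  -- Division by the denominator is an injective `ℤ`-linear map that carries the integral vectors to
  -- the forward vectors.
  let φ : (Fin n → ℤ) →ₗ[ℤ] (Fin n → ℚ) :=
    { toFun := fun x i => (x i : ℚ) / I.den
      map_add' := fun x y => by ext i; simp [add_div]
      map_smul' := fun c x => by ext i; simp [mul_div_assoc] }
  have hφ : Function.Injective φ := by
    intro x y hxy
    ext i
    have : (x i : ℚ) / I.den = (y i : ℚ) / I.den := congrFun hxy i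
    have := (div_left_inj' h0).1 this
    exact_mod_cast this
  have hv : ∀ {w}, I.IsInt w → φ (I.vec w) = A.forward w := by
    intro w hw
    ext i
    change (I.vec w i : ℚ) / I.den = _
    rw [hw i]
    field_simp
  have hspan : A.spanOf ℤ W = (Submodule.span ℤ (I.vecs W)).map φ := by
    rw [spanOf, Submodule.map_span, vecs, Set.image_image]
    congr 1
    exact Set.image_congr fun w hw => (hv (hW w hw)).symm
  rw [hspan, ← hv hw, Submodule.mem_map]
  exact ⟨fun ⟨y, hy, hyx⟩ => hφ hyx ▸ hy, fun h => ⟨_, h, rfl⟩⟩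

/-- Integrality after multiplication by the denominator defines a `ℤ`-submodule. A candidate that
fails it is outside the span, so no lattice test is needed. -/
theorem isInt_of_mem_spanOf {W : List (List S)} (hW : ∀ w ∈ W, I.IsInt w) {w : List S}
    (hw : A.forward w ∈ A.spanOf ℤ W) : I.IsInt w := by
  let N : Submodule ℤ (Fin n → ℚ) :=
    { carrier := {x | ∀ i, ∃ z : ℤ, (I.den : ℚ) * x i = z}
      add_mem' := fun {x y} hx hy i => by
        obtain ⟨a, ha⟩ := hx i
        obtain ⟨b, hb⟩ := hy i
        exact ⟨a + b, by simp [mul_add, ha, hb]⟩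
      zero_mem' := fun i => ⟨0, by simp⟩
      smul_mem' := fun c x hx i => by
        obtain ⟨a, ha⟩ := hx i
        exact ⟨c * a, by simp [← ha]; ring⟩ }
  have : A.spanOf ℤ W ≤ N := by
    rw [spanOf, Submodule.span_le]
    rintro _ ⟨w, hw, rfl⟩ i
    exact ⟨_, (hW w hw i).symm⟩
  exact I.isInt_of (this hw)

/-! ### Independent vectors -/

/-- The rational span of the vectors of the words in `W` is spanned by independent vectors with Gram
determinant `D`, and `P` is `D` times the projection onto the complement. -/
def RankInv (W : List (List S)) (D : ℤ) (P : Matrix (Fin n) (Fin n) ℤ) : Prop :=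
  ∃ (ι : Type) (_ : Fintype ι) (_ : DecidableEq ι) (U : Matrix ι (Fin n) ℤ),
    Fintype.card ι ≤ W.length ∧ (∀ i, U i ∈ I.vecs W) ∧
    (∀ w ∈ W, (Matrix.gramProj U).mulVec (I.vec w) = 0) ∧ 0 < (U * U.transpose).det ∧
    D = (U * U.transpose).det ∧ P = Matrix.gramProj U

theorem rankInv_nil : I.RankInv [] 1 1 := by
  refine ⟨Fin 0, inferInstance, inferInstance, 0, by simp, fun i => i.elim0, by simp, ?_, ?_, ?_⟩
  · simp
  · simp
  · simp [Matrix.gramProj]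

theorem RankInv.det_pos {W : List (List S)} {D : ℤ} {P : Matrix (Fin n) (Fin n) ℤ}
    (h : I.RankInv W D P) : 0 < D := by
  obtain ⟨ι, _, _, U, -, -, -, h, rfl, -⟩ := h
  exact h

theorem RankInv.cons_of_eq_zero {W : List (List S)} {D : ℤ} {P : Matrix (Fin n) (Fin n) ℤ}
    (h : I.RankInv W D P) {w : List S} (hw : P.mulVec (I.vec w) = 0) : I.RankInv (w :: W) D P := by
  obtain ⟨ι, _, _, U, h1, h2, h3, h4, rfl, rfl⟩ := h
  refine ⟨ι, _, _, U, h1.trans (by simp), fun i => ?_, ?_, h4, rfl, rfl⟩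
  · exact Set.image_mono (fun w hw => List.mem_cons_of_mem _ hw) (h2 i)
  · rintro w' hw'
    rcases List.mem_cons.1 hw' with rfl | hw'
    · exact hw
    · exact h3 w' hw'

theorem RankInv.cons_of_ne_zero {W : List (List S)} {D : ℤ} {P : Matrix (Fin n) (Fin n) ℤ}
    (h : I.RankInv W D P) {w : List S} (hw : P.mulVec (I.vec w) ≠ 0) :
    I.RankInv (w :: W) (I.vec w ⬝ᵥ P.mulVec (I.vec w)) (Matrix.of fun i j =>
      ((I.vec w ⬝ᵥ P.mulVec (I.vec w)) * P i j - P.mulVec (I.vec w) i * P.mulVec (I.vec w) j) / D) := by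
  obtain ⟨ι, _, _, U, h1, h2, h3, h4, rfl, rfl⟩ := h
  have hpos := Matrix.det_gram_addRow_pos U (I.vec w) h4 hw
  have hdet := Matrix.det_gram_addRow U (I.vec w) h4.ne'
  have hspan : ∀ v : Fin n → ℤ, (Matrix.gramProj (Matrix.addRow U (I.vec w))).mulVec v = 0 ↔ _ :=
    fun v => Matrix.gramProj_mulVec_eq_zero_iff (Matrix.addRow U (I.vec w)) v
      (by rw [hdet]; exact hpos.ne')
  refine ⟨ι ⊕ Unit, inferInstance, inferInstance, Matrix.addRow U (I.vec w), ?_, ?_, ?_, ?_, ?_, ?_⟩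
  · simpa using h1
  · rintro (i | i)
    · exact Set.image_mono (fun w hw => List.mem_cons_of_mem _ hw) (h2 i)
    · exact ⟨w, by simp, rfl⟩
  · intro w' hw'
    rw [hspan]
    rcases List.mem_cons.1 hw' with rfl | hw'
    · exact Submodule.subset_span ⟨.inr (), rfl⟩
    · refine Submodule.span_mono ?_
        ((Matrix.gramProj_mulVec_eq_zero_iff U _ h4.ne').1 (h3 w' hw'))
      rintro _ ⟨i, rfl⟩
      exact ⟨.inl i, rfl⟩
  · rwa [hdet]
  · rw [hdet]
  · ext i j
    have := congrFun₂ (Matrix.gramProj_addRow U (I.vec w) h4.ne' hpos.ne') i j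
    simp only [Matrix.smul_apply, Matrix.sub_apply, Matrix.vecMulVec_apply, smul_eq_mul] at this
    -- The numerator equals the old determinant times an entry of the new projection, so the integer
    -- division is exact.
    rw [Matrix.of_apply, ← this, Int.mul_ediv_cancel_left _ h4.ne']

/-- The data exist for every list of words, independently of the program; the step bound for
arbitrary choices relies on this. -/
theorem exists_rankInv (W : List (List S)) : ∃ D P, I.RankInv W D P := by
  induction W with
  | nil => exact ⟨_, _, I.rankInv_nil⟩
  | cons w W ih =>
    obtain ⟨D, P, h⟩ := ih
    by_cases hw : P.mulVec (I.vec w) = 0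
    · exact ⟨_, _, h.cons_of_eq_zero I hw⟩
    · exact ⟨_, _, h.cons_of_ne_zero I hw⟩

/-- The free scalar `c` allows the test on `den • αμ(w)` as well as on the candidates, which carry
the square of the denominator. -/
theorem RankInv.forward_mem_iff {W : List (List S)} {D : ℤ} {P : Matrix (Fin n) (Fin n) ℤ}
    (h : I.RankInv W D P) (hW : ∀ w ∈ W, I.IsInt w) {w : List S} {v : Fin n → ℤ} {c : ℚ}
    (hc : c ≠ 0) (hv : ∀ i, (v i : ℚ) = c * A.forward w i) :
    A.forward w ∈ A.spanOf ℚ W ↔ P.mulVec v = 0 := by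
  obtain ⟨ι, _, _, U, h1, h2, h3, h4, rfl, rfl⟩ := h
  have hsmul : ∀ {w}, I.IsInt w → (fun i => (I.vec w i : ℚ)) = (I.den : ℚ) • A.forward w :=
    fun hw => funext hw
  have hspan : A.spanOf ℚ W =
      Submodule.span ℚ (Set.range fun i => fun j => (U i j : ℚ)) := by
    refine le_antisymm ?_ ?_
    · rw [spanOf, Submodule.span_le]
      rintro _ ⟨w, hw, rfl⟩
      have := (Matrix.gramProj_mulVec_eq_zero_iff U _ h4.ne').1 (h3 w hw)
      rw [hsmul (hW w hw)] at this
      exact (Submodule.smul_mem_iff _ I.den_ne_zero).1 this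
    · rw [Submodule.span_le]
      rintro _ ⟨i, rfl⟩
      obtain ⟨w, hw, hwi⟩ := h2 i
      change (fun j => (U i j : ℚ)) ∈ _
      rw [← hwi, hsmul (hW w hw)]
      exact Submodule.smul_mem _ _ (Submodule.subset_span ⟨w, hw, rfl⟩)
  have hv' : (fun i => (v i : ℚ)) = c • A.forward w := funext hv
  rw [Matrix.gramProj_mulVec_eq_zero_iff U v h4.ne', hspan, hv', Submodule.smul_mem_iff _ hc]

/-! ### Bounds -/

/-- All numbers that occur are at most `2 ^ b`. -/
structure Bdd (b : ℕ) : Prop where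
  dim : n ≤ 2 ^ b
  den : I.den.natAbs ≤ 2 ^ b
  init : ∀ i, (I.init i).natAbs ≤ 2 ^ b
  trans : ∀ σ i j, (I.trans σ i j).natAbs ≤ 2 ^ b

theorem abs_le_of_mul {z : ℤ} {q : ℚ} {b : ℕ} (h : (z : ℚ) = I.den * q) (hz : z.natAbs ≤ 2 ^ b) :
    |q| ≤ 2 ^ b := by
  have h1 : |(z : ℚ)| ≤ 2 ^ b := by
    rw [← Int.cast_abs, Int.abs_eq_natAbs]; exact_mod_cast hz
  have h2 : (1 : ℚ) ≤ |(I.den : ℚ)| := by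
    rw [← Int.cast_abs]; exact_mod_cast Int.one_le_abs I.den_pos.ne'
  rw [h, abs_mul] at h1
  nlinarith [abs_nonneg q]

variable {I}

/-- Each letter costs a factor `2 ^ b` for the entries of its matrix and another for the `n ≤ 2 ^ b`
summands. -/
theorem Bdd.abs_forward_le {b : ℕ} (hb : I.Bdd b) (w : List S) (i : Fin n) :
    |A.forward w i| ≤ 2 ^ (b + 2 * b * w.length) := by
  induction w using List.reverseRecOn generalizing i with
  | nil =>
    rw [forward_nil]
    simpa using I.abs_le_of_mul (I.init_eq i) (hb.init i)
  | append_singleton w σ ih =>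
    rw [forward_concat]
    refine (Finset.abs_sum_le_sum_abs _ _).trans ?_
    have h1 : ∀ j ∈ Finset.univ, |A.forward w j * A.trans σ j i| ≤
        (2 : ℚ) ^ (b + 2 * b * w.length) * 2 ^ b := fun j _ => by
      rw [abs_mul]
      exact mul_le_mul (ih j) (I.abs_le_of_mul (I.trans_eq σ j i) (hb.trans σ j i))
        (abs_nonneg _) (by positivity)
    refine (Finset.sum_le_sum h1).trans ?_
    have h2 : (n : ℚ) ≤ 2 ^ b := by exact_mod_cast hb.dim
    rw [Finset.sum_const, Finset.card_univ, Fintype.card_fin, nsmul_eq_mul, List.length_append,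
      List.length_singleton, show b + 2 * b * (w.length + 1) = b + (b + 2 * b * w.length + b) by ring]
    generalize b + 2 * b * w.length = m
    rw [pow_add, pow_add]
    gcongr

theorem Bdd.natAbs_vec_le {b : ℕ} (hb : I.Bdd b) {w : List S} (hw : I.IsInt w) (i : Fin n) :
    (I.vec w i).natAbs ≤ 2 ^ (2 * b + 2 * b * w.length) := by
  have h1 : |(I.vec w i : ℚ)| ≤ 2 ^ b * 2 ^ (b + 2 * b * w.length) := by
    rw [hw i, abs_mul]
    refine mul_le_mul ?_ (hb.abs_forward_le w i) (abs_nonneg _) (by positivity)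
    rw [← Int.cast_abs, Int.abs_eq_natAbs]; exact_mod_cast hb.den
  rw [← pow_add, ← Int.cast_abs, Int.abs_eq_natAbs] at h1
  rw [show 2 * b + 2 * b * w.length = b + (b + 2 * b * w.length) by ring]
  exact_mod_cast h1

/-- An exponent for the Gram determinants. -/
def gramExp (n b : ℕ) : ℕ :=
  (n + 1) * ((n + 1) + (n + (2 * b + 2 * b * n) + (2 * b + 2 * b * n)))

theorem RankInv.bounds {W : List (List S)} {D : ℤ} {P : Matrix (Fin n) (Fin n) ℤ}
    (h : I.RankInv W D P) {b : ℕ} (hb : I.Bdd b) (hlen : W.length ≤ n + 1)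
    (hW : ∀ w ∈ W, I.IsInt w ∧ w.length ≤ n) :
    D.natAbs ≤ 2 ^ gramExp n b ∧ ∀ i j, (P i j).natAbs ≤
      2 ^ (gramExp n b + 2 * (n + 1) + 2 * (2 * b + 2 * b * n) + 1) := by
  obtain ⟨ι, _, _, U, h1, h2, h3, h4, rfl, rfl⟩ := h
  have hU : ∀ i j, (U i j).natAbs ≤ 2 ^ (2 * b + 2 * b * n) := by
    intro i j
    obtain ⟨w, hw, hwi⟩ := h2 i
    rw [← hwi]
    refine (hb.natAbs_vec_le (hW w hw).1 j).trans (Nat.pow_le_pow_right (by norm_num) ?_)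
    have := (hW w hw).2
    gcongr
  exact ⟨Matrix.natAbs_det_gram_le U (h1.trans hlen) (by simp) hU,
    Matrix.natAbs_gramProj_le U (h1.trans hlen) (by simp) hU⟩

end IntForm

end QAutomaton

/-! ## The runs of the procedure -/

namespace QAutomaton

variable {S : Type*} {n : ℕ} {A : QAutomaton S n}

theorem forward_mem_spanOf {R : Type*} [Semiring R] [Module R (Fin n → ℚ)] {W : List (List S)}
    {w : List S} (h : w ∈ W) : A.forward w ∈ A.spanOf R W :=
  Submodule.subset_span ⟨w, h, rfl⟩

theorem spanOf_mono {R : Type*} [Semiring R] [Module R (Fin n → ℚ)] {W W' : List (List S)}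
    (h : W ⊆ W') : A.spanOf R W ≤ A.spanOf R W' :=
  Submodule.span_mono (Set.image_mono h)

/-- The span contains `α`, and closure on generators extends linearly to the whole span, so no word
leaves it. The hypothesis `hR` lets one proof serve `ℚ` and `ℤ`. -/
theorem forward_mem_of_closed {R : Type*} [Semiring R] [Module R (Fin n → ℚ)]
    (hR : ∀ (c : R) (x : Fin n → ℚ) (M : Matrix (Fin n) (Fin n) ℚ),
      Matrix.vecMul (c • x) M = c • Matrix.vecMul x M)
    {W : List (List S)} (h0 : [] ∈ W)
    (h : ∀ w ∈ W, ∀ σ : S, A.forward (w ++ [σ]) ∈ A.spanOf R W) (w : List S) :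
    A.forward w ∈ A.spanOf R W := by
  induction w using List.reverseRecOn with
  | nil => exact forward_mem_spanOf h0
  | append_singleton w σ ih =>
    rw [forward_concat]
    refine Submodule.span_induction (p := fun x _ => Matrix.vecMul x (A.trans σ) ∈ A.spanOf R W)
      ?_ ?_ ?_ ?_ ih
    · rintro _ ⟨w, hw, rfl⟩
      rw [← forward_concat]
      exact h w hw σ
    · simp
    · intro x y _ _ hx hy
      rw [Matrix.add_vecMul]
      exact add_mem hx hy
    · intro c x _ hx
      rw [hR]
      exact Submodule.smul_mem _ c hx

theorem forward_mem_of_closed_rat {W : List (List S)} (h0 : [] ∈ W)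
    (h : ∀ w ∈ W, ∀ σ : S, A.forward (w ++ [σ]) ∈ A.spanOf ℚ W) (w : List S) :
    A.forward w ∈ A.spanOf ℚ W :=
  forward_mem_of_closed (fun c x M => Matrix.smul_vecMul c x M) h0 h w

theorem spanOf_eq_forwardModule {W : List (List S)} (h0 : [] ∈ W)
    (h : ∀ w ∈ W, ∀ σ : S, A.forward (w ++ [σ]) ∈ A.spanOf ℤ W) :
    A.spanOf ℤ W = A.forwardModule := by
  refine le_antisymm (Submodule.span_mono (Set.image_subset_range _ _)) ?_
  rw [forwardModule, Submodule.span_le]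
  rintro _ ⟨w, rfl⟩
  exact forward_mem_of_closed (fun c x M => Matrix.smul_vecMul c x M) h0 h w

namespace IntForm

variable (I : A.IntForm)

theorem vecs_cons (w : List S) (W : List (List S)) :
    I.vecs (w :: W) = Insert.insert (I.vec w) (I.vecs W) := by
  rw [vecs, vecs, ← Set.image_insert_eq]
  congr 1
  ext; simp

theorem vecs_mono {W W' : List (List S)} (h : W ⊆ W') : I.vecs W ⊆ I.vecs W' := Set.image_mono h

variable {I}

theorem RankInv.smul_mem {W₀ W : List (List S)} {D : ℤ} {P : Matrix (Fin n) (Fin n) ℤ}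
    (h : I.RankInv W₀ D P) (hW : W₀ ⊆ W) (x : Fin n → ℤ) :
    D • x ∈ Matrix.projLattice P (I.vecs W) := by
  obtain ⟨ι, _, _, U, h1, h2, h3, h4, rfl, rfl⟩ := h
  exact Matrix.det_smul_mem_projLattice U (fun i => I.vecs_mono hW (h2 i)) x

/-- All forward vectors lie in the rational span of `W₀`, so the projection kills them; this is the
situation of `Matrix.mem_projLattice_iff`. -/
theorem RankInv.mem_lattice_iff {W₀ W : List (List S)} {D : ℤ} {P : Matrix (Fin n) (Fin n) ℤ}
    (h : I.RankInv W₀ D P) (hW₀ : ∀ w ∈ W₀, I.IsInt w) (hW : ∀ w ∈ W, I.IsInt w)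
    (hQ : ∀ w, A.forward w ∈ A.spanOf ℚ W₀) {w : List S} (hw : I.IsInt w) :
    I.vec w ∈ Matrix.projLattice P (I.vecs W) ↔ A.forward w ∈ A.spanOf ℤ W := by
  have hP : ∀ {w}, I.IsInt w → P.mulVec (I.vec w) = 0 := fun hw =>
    (h.forward_mem_iff I hW₀ I.den_ne_zero hw).1 (hQ _)
  rw [I.forward_mem_spanOf_int_iff hW hw]
  obtain ⟨ι, _, _, U, h1, h2, h3, h4, rfl, rfl⟩ := h
  refine Matrix.mem_projLattice_iff U h4.ne' ?_ (hP hw)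
  rintro _ ⟨w, hw, rfl⟩
  exact hP (hW w hw)

/-- What is known after leaving the first loop with `W₀`. -/
structure ModuleInv (I : A.IntForm) (W₀ : List (List S)) (D : ℤ) (P : Matrix (Fin n) (Fin n) ℤ)
    (j : ℕ) (W : List (List S)) : Prop where
  length_le : W₀.length ≤ n + 1
  isInt : ∀ w ∈ W₀, I.IsInt w ∧ w.length ≤ n
  rankInv : I.RankInv W₀ D P
  mem_span : ∀ w, A.forward w ∈ A.spanOf ℚ W₀
  subset : W₀ ⊆ W
  length_eq : W.length = W₀.length + j
  index_le : 2 ^ j * (Matrix.projLattice P (I.vecs W)).toAddSubgroup.index ≤ D.natAbs ^ n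

theorem ModuleInv.index_pos {W₀ : List (List S)} {D : ℤ} {P : Matrix (Fin n) (Fin n) ℤ}
    {j : ℕ} {W : List (List S)} (h : ModuleInv I W₀ D P j W) :
    0 < (Matrix.projLattice P (I.vecs W)).toAddSubgroup.index ∧
      (Matrix.projLattice P (I.vecs W)).toAddSubgroup.index ≤ D.natAbs ^ n := by
  have hD := h.rankInv.det_pos
  have h1 : ((D.natAbs : ℕ) : ℤ) = D := by omega
  have := Submodule.index_of_smul_mem (N := Matrix.projLattice P (I.vecs W)) (D := D.natAbs)
    (by omega) fun x => by rw [h1]; exact h.rankInv.smul_mem h.subset x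
  rwa [Fintype.card_fin] at this

/-- The index stays positive, so `2 ^ j ≤ D ^ n`. -/
theorem ModuleInv.le {W₀ : List (List S)} {D : ℤ} {P : Matrix (Fin n) (Fin n) ℤ}
    {j : ℕ} {W : List (List S)} (h : ModuleInv I W₀ D P j W) {b : ℕ} (hb : I.Bdd b) :
    j ≤ gramExp n b * n := by
  have h1 := h.index_pos
  have h2 := h.index_le
  have h3 : D.natAbs ^ n ≤ 2 ^ (gramExp n b * n) := by
    rw [pow_mul]
    exact Nat.pow_le_pow_left (h.rankInv.bounds hb h.length_le h.isInt).1 n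
  have h4 : 2 ^ j ≤ 2 ^ (gramExp n b * n) := by
    refine le_trans ?_ (h2.trans h3)
    exact Nat.le_mul_of_pos_right _ h1.1
  exact (Nat.pow_le_pow_iff_right (by norm_num)).1 h4

/-- A vector outside the integral span is outside the completed lattice, which therefore grows
properly and loses at least half of its index. -/
theorem ModuleInv.cons {W₀ : List (List S)} {D : ℤ} {P : Matrix (Fin n) (Fin n) ℤ}
    {j : ℕ} {W : List (List S)} (h : ModuleInv I W₀ D P j W) (hW : ∀ w ∈ W, I.IsInt w)
    {w : List S} (hw : I.IsInt w) (hnew : A.forward w ∉ A.spanOf ℤ W) :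
    ModuleInv I W₀ D P (j + 1) (w :: W) := by
  refine ⟨h.length_le, h.isInt, h.rankInv, h.mem_span,
    fun x hx => List.mem_cons_of_mem _ (h.subset hx), by simp [h.length_eq, add_assoc], ?_⟩
  rw [← h.rankInv.mem_lattice_iff (fun w hw => (h.isInt w hw).1) hW h.mem_span hw] at hnew
  have hlt : Matrix.projLattice P (I.vecs W) < Matrix.projLattice P (I.vecs (w :: W)) := by
    rw [vecs_cons, Matrix.projLattice_insert, left_lt_sup, Submodule.span_singleton_le_iff_mem]
    exact hnew
  have h1 := Submodule.two_mul_index_le hlt h.index_pos.1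
  refine le_trans ?_ h.index_le
  rw [pow_succ, mul_assoc]
  exact Nat.mul_le_mul_left _ h1

/-- The invariant of all runs of the procedure. -/
def RunInv (I : A.IntForm) (m : ℕ) : ZGenState S → Prop
  | .rankLoop W => [] ∈ W ∧ W.length = m + 1 ∧ (∀ w ∈ W, I.IsInt w ∧ w.length ≤ m) ∧
      m ≤ Module.finrank ℚ (A.spanOf ℚ W)
  | .moduleLoop W => [] ∈ W ∧ (∀ w ∈ W, I.IsInt w ∧ w.length < W.length) ∧
      ∃ W₀ D P j, ModuleInv I W₀ D P j W ∧ m = W₀.length + j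
  | .done (.generators W) => A.spanOf ℤ W = A.forwardModule ∧
      ∀ b, I.Bdd b → m ≤ n + 2 + gramExp n b * n
  | .done (.counterexample w) => ¬ IsIntegerVector (A.forward w) ∧
      ∀ b, I.Bdd b → m ≤ n + 2 + gramExp n b * n

theorem finrank_spanOf_le (W : List (List S)) : Module.finrank ℚ (A.spanOf ℚ W) ≤ n := by
  simpa using Submodule.finrank_le (A.spanOf ℚ W)

theorem runInv (I : A.IntForm) {m : ℕ} {s : ZGenState S} (h : ZGenRun A m s) : I.RunInv m s := by
  induction h with
  -- Only dimension at least `0` is claimed at the start, because `α` may be zero. So `n` additions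
  -- and `n + 1` words are possible in the first loop.
  | start => exact ⟨by simp, rfl, by simp [I.isInt_nil], Nat.zero_le _⟩
  | step _ hs ih =>
    cases hs with
    | rank_add hw hnew hint =>
      obtain ⟨h1, h2, h3, h4⟩ := ih
      refine ⟨by simp [h1], by simp [h2], ?_, ?_⟩
      · intro w' hw'
        rcases List.mem_cons.1 hw' with rfl | hw'
        · exact ⟨I.isInt_of_isIntegerVector hint, by simpa using (h3 _ hw).2⟩
        · exact ⟨(h3 _ hw').1, (h3 _ hw').2.trans (Nat.le_succ _)⟩
      · refine h4.trans_lt (Submodule.finrank_lt_finrank_of_lt ?_)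
        -- The added vector lies in the new rational span but not in the old one, so the dimension
        -- grows with every step.
        refine lt_of_le_of_ne (spanOf_mono fun x hx => List.mem_cons_of_mem _ hx) fun he => ?_
        exact hnew (he ▸ forward_mem_spanOf (by simp))
    | rank_return hw hnew hint =>
      obtain ⟨h1, h2, h3, h4⟩ := ih
      have := h4.trans (finrank_spanOf_le _)
      exact ⟨hint, fun b _ => by omega⟩
    | rank_exit hclosed =>
      obtain ⟨h1, h2, h3, h4⟩ := ih
      have := h4.trans (finrank_spanOf_le _)
      rename_i W _
      refine ⟨h1, fun w hw => ⟨(h3 w hw).1, by rw [h2]; exact Nat.lt_succ_of_le (h3 w hw).2⟩, ?_⟩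
      -- From here on the determinant and the projection are frozen: the second loop does not change
      -- the rational span.
      obtain ⟨D, P, h⟩ := I.exists_rankInv W
      refine ⟨W, D, P, 0, ⟨by omega, fun w hw => ⟨(h3 w hw).1, (h3 w hw).2.trans this⟩, h,
        forward_mem_of_closed_rat h1 hclosed, fun _ h => h, rfl, ?_⟩, h2.symm⟩
      have hD := h.det_pos
      have hD' : ((D.natAbs : ℕ) : ℤ) = D := by omega
      have := (Submodule.index_of_smul_mem (N := Matrix.projLattice P (I.vecs W)) (D := D.natAbs)
        (by omega) fun x => by rw [hD']; exact h.smul_mem (fun _ h => h) x).2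
      simpa using this
    | module_add hw hnew hint =>
      obtain ⟨h1, h2, W₀, D, P, j, h3, h4⟩ := ih
      refine ⟨by simp [h1], ?_, W₀, D, P, j + 1,
        h3.cons (fun w hw => (h2 w hw).1) (I.isInt_of_isIntegerVector hint) hnew, by omega⟩
      intro w' hw'
      rcases List.mem_cons.1 hw' with rfl | hw'
      · exact ⟨I.isInt_of_isIntegerVector hint, by simpa using (h2 _ hw).2⟩
      · exact ⟨(h2 _ hw').1, (h2 _ hw').2.trans (by simp)⟩
    | module_return hw hnew hint =>
      obtain ⟨h1, h2, W₀, D, P, j, h3, h4⟩ := ih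
      exact ⟨hint, fun b hb => by have := h3.le hb; have := h3.length_le; omega⟩
    | module_exit hclosed =>
      obtain ⟨h1, h2, W₀, D, P, j, h3, h4⟩ := ih
      exact ⟨spanOf_eq_forwardModule h1 hclosed,
        fun b hb => by have := h3.le hb; have := h3.length_le; omega⟩

theorem run_le (I : A.IntForm) {m : ℕ} {s : ZGenState S} (h : ZGenRun A m s) {b : ℕ}
    (hb : I.Bdd b) : m ≤ n + 2 + gramExp n b * n := by
  have := I.runInv h
  match s, this with
  | .rankLoop W, ⟨_, _, _, h4⟩ => have := h4.trans (finrank_spanOf_le _); omega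
  | .moduleLoop W, ⟨_, _, W₀, D, P, j, h3, h4⟩ =>
    have := h3.le hb; have := h3.length_le; omega
  | .done (.generators W), h => exact h.2 b hb
  | .done (.counterexample w), h => exact h.2 b hb

end IntForm

theorem exists_step (A : QAutomaton S n) (s : ZGenState S) :
    (∃ s', ZGenStep A s s') ∨ ∃ out, s = ZGenState.done out := by
  match s with
  | .done out => exact .inr ⟨out, rfl⟩
  | .rankLoop W =>
    left
    by_cases h : ∀ w ∈ W, ∀ σ : S, A.forward (w ++ [σ]) ∈ A.spanOf ℚ W
    · exact ⟨_, .rank_exit h⟩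
    · push Not at h
      obtain ⟨w, hw, σ, hn⟩ := h
      by_cases hi : IsIntegerVector (A.forward (w ++ [σ]))
      · exact ⟨_, .rank_add hw hn hi⟩
      · exact ⟨_, .rank_return hw hn hi⟩
  | .moduleLoop W =>
    left
    by_cases h : ∀ w ∈ W, ∀ σ : S, A.forward (w ++ [σ]) ∈ A.spanOf ℤ W
    · exact ⟨_, .module_exit h⟩
    · push Not at h
      obtain ⟨w, hw, σ, hn⟩ := h
      by_cases hi : IsIntegerVector (A.forward (w ++ [σ]))
      · exact ⟨_, .module_add hw hn hi⟩
      · exact ⟨_, .module_return hw hn hi⟩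

end QAutomaton

/-! ## Vectors and matrices as lists -/

namespace IntList

variable {m n : ℕ}

/-- The rows of a matrix as a list. -/
def ofMatrix (M : Matrix (Fin m) (Fin n) ℤ) : List (List ℤ) := List.ofFn fun i => List.ofFn (M i)

theorem zipWith_ofFn {α β γ : Type} (f : α → β → γ) (u : Fin n → α) (v : Fin n → β) :
    List.zipWith f (List.ofFn u) (List.ofFn v) = List.ofFn fun i => f (u i) (v i) := by
  refine List.ext_getElem (by simp) fun i h1 h2 => ?_
  simp

theorem dot_ofFn (u v : Fin n → ℤ) : dot (List.ofFn u) (List.ofFn v) = u ⬝ᵥ v := by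
  rw [dot, zipWith_ofFn, List.sum_ofFn]; rfl

theorem mulVec_ofMatrix (M : Matrix (Fin m) (Fin n) ℤ) (v : Fin n → ℤ) :
    mulVec (ofMatrix M) (List.ofFn v) = List.ofFn (M.mulVec v) := by
  rw [mulVec, ofMatrix, List.map_ofFn]
  congr 1
  ext i
  exact dot_ofFn _ _

theorem identity_eq {α : Type} (l : List α) :
    identity l = ofMatrix (1 : Matrix (Fin l.length) (Fin l.length) ℤ) := by
  have key : ∀ n (l : List α), l.length = n →
      identity l = ofMatrix (1 : Matrix (Fin n) (Fin n) ℤ) := by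
    intro n l
    induction l using List.reverseRecOn generalizing n with
    | nil => rintro rfl; rfl
    | append_singleton l a ih =>
      rintro h
      obtain ⟨n, rfl⟩ : ∃ m, n = m + 1 := ⟨l.length, by simpa using h.symm⟩
      rw [show identity (l ++ [a]) = (1 :: (identity l).map fun _ => 0) ::
        (identity l).map fun r => 0 :: r by simp [identity], ih n (by simpa using h)]
      simp only [ofMatrix, List.map_ofFn, List.ofFn_succ (n := n), Matrix.one_apply_eq]
      refine congrArg₂ List.cons (congrArg (List.cons 1) (congrArg List.ofFn (funext fun i => ?_)))
        (congrArg List.ofFn (funext fun i => ?_))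
      · rw [Matrix.one_apply_ne (Fin.succ_ne_zero i).symm]
        rfl
      · rw [Function.comp_apply, Matrix.one_apply_ne (Fin.succ_ne_zero i)]
        refine congrArg (List.cons 0) (congrArg List.ofFn (funext fun j => ?_))
        simp [Matrix.one_apply]
  exact key _ l rfl

/-- The fold is analysed for rectangular matrices, since removing a row destroys squareness. -/
theorem transpose_ofMatrix (M : Matrix (Fin n) (Fin n) ℤ) :
    transpose (ofMatrix M) = ofMatrix M.transpose := by
  have key : ∀ {m : ℕ} (N : Matrix (Fin m) (Fin n) ℤ),
      (ofMatrix N).foldr (fun r c => List.zipWith (fun a l => a :: l) r c)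
        (List.ofFn fun _ : Fin n => []) = ofMatrix N.transpose := by
    intro m
    induction m with
    | zero => intro N; simp [ofMatrix]
    | succ m ih =>
      intro N
      have := ih (Matrix.of fun i => N i.succ)
      simp only [ofMatrix, List.ofFn_succ (n := m), List.foldr_cons] at this ⊢
      erw [this]
      rw [zipWith_ofFn]
      rfl
  rw [transpose, List.foldl_reverse, ← key M]
  congr 1
  rw [ofMatrix, List.map_ofFn]
  rfl

/-- Vectors as finitely supported sequences. -/
def embed : (Fin n → ℤ) →ₗ[ℤ] (ℕ → ℤ) where
  toFun x := fun i => if h : i < n then x ⟨i, h⟩ else 0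
  map_add' x y := by ext i; by_cases h : i < n <;> simp [h]
  map_smul' c x := by ext i; by_cases h : i < n <;> simp [h]

theorem embed_injective : Function.Injective (embed : (Fin n → ℤ) →ₗ[ℤ] (ℕ → ℤ)) := by
  intro x y h
  ext i
  simpa [embed] using congrFun h i

theorem seq_ofFn (v : Fin n → ℤ) : seq (List.ofFn v) = embed v := by
  ext i
  by_cases h : i < n <;> simp [seq, embed, h]

theorem IsMultiple.exists_embed {D : ℤ} {x : ℕ → ℤ} (h : IsMultiple D n x) :
    ∃ y : Fin n → ℤ, x = embed (D • y) := by
  refine ⟨fun i => x i / D, ?_⟩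
  ext i
  by_cases hi : i < n
  · simp [embed, hi, Int.mul_ediv_cancel' (h.1 i)]
  · simp [embed, hi, h.2 i (by omega)]

end IntList

/-! ### Stored data as configurations of the procedure. -/

namespace ZGen
open IntList QAutomaton

theorem all_ofFn {n : ℕ} (v : Fin n → ℤ) (p : ℤ → Bool) :
    (List.ofFn v).all p = true ↔ ∀ i, p (v i) = true := by
  simp [List.all_eq_true, List.mem_ofFn]

theorem initLat_spec {D : ℤ} (hD : 0 < D) (V : List (List ℤ)) (l : List ℤ)
    (hV : ∀ v ∈ V, v.length = l.length) :
    IsBasis D (initLat D V l) ∧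
      lattice (initLat D V l) = lattice (diagonal D l) ⊔ Submodule.span ℤ (seq '' {v | v ∈ V}) := by
  induction V using List.reverseRecOn with
  | nil => exact ⟨(diagonal_spec hD l).1, by simp [initLat]⟩
  | append_singleton V v ih =>
    obtain ⟨ih1, ih2⟩ := ih fun v hv => hV v (by simp [hv])
    rw [show initLat D (V ++ [v]) l = (IntList.insert D (initLat D V l) v).1 by simp [initLat]]
    obtain ⟨h1, h2, -⟩ := insert_spec hD ih1 (v := v) (by rw [hV v (by simp), (initLat_rows D V l).1])
    refine ⟨h1, ?_⟩
    rw [h2, ih2, sup_assoc, ← Submodule.span_union]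
    congr 2
    ext x
    simp only [Set.mem_union, Set.mem_image, Set.mem_ofPred_eq, Set.mem_singleton_iff,
      List.mem_append, List.mem_singleton]
    constructor
    · rintro (⟨y, hy, rfl⟩ | rfl)
      · exact ⟨y, .inl hy, rfl⟩
      · exact ⟨v, .inr rfl, rfl⟩
    · rintro ⟨y, hy | rfl, rfl⟩
      · exact .inl ⟨y, hy, rfl⟩
      · exact .inr rfl

/-- As `P` is symmetric, its stored rows span the range of `P`. The diagonal start contributes only
multiples of `D`, which belong to the lattice anyway. -/
theorem lattice_initLat {n : ℕ} {D : ℤ} (hD : 0 < D) {P : Matrix (Fin n) (Fin n) ℤ}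
    (hP : P.transpose = P) {V : List (Fin n → ℤ)}
    (hfull : ∀ x, D • x ∈ Matrix.projLattice P {v | v ∈ V}) {l : List ℤ} (hl : l.length = n) :
    lattice (initLat D (ofMatrix P ++ V.map List.ofFn) l) =
      (Matrix.projLattice P {v | v ∈ V}).map embed := by
  rw [(initLat_spec hD _ _ ?_).2]
  · have h1 : Submodule.span ℤ (seq '' {v | v ∈ ofMatrix P ++ V.map List.ofFn}) =
        (Matrix.projLattice P {v | v ∈ V}).map embed := by
      rw [Matrix.projLattice, Matrix.range_mulVecLin, Matrix.col, hP, ← Submodule.span_union,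
        Submodule.map_span]
      congr 1
      ext x
      simp only [Set.mem_image, Set.mem_ofPred_eq, List.mem_append, List.mem_map, Set.mem_union,
        ofMatrix, List.mem_ofFn]
      constructor
      · rintro ⟨_, ⟨i, rfl⟩ | ⟨v, hv, rfl⟩, rfl⟩
        · exact ⟨P i, .inr ⟨i, rfl⟩, (seq_ofFn _).symm⟩
        · exact ⟨v, .inl hv, (seq_ofFn _).symm⟩
      · rintro ⟨v, hv | ⟨i, rfl⟩, rfl⟩
        · exact ⟨_, .inr ⟨v, hv, rfl⟩, seq_ofFn _⟩
        · exact ⟨_, .inl ⟨i, rfl⟩, seq_ofFn _⟩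
    rw [h1, sup_eq_right]
    intro x hx
    obtain ⟨y, rfl⟩ := (hl ▸ (diagonal_spec hD l).2 x hx : IsMultiple D n x).exists_embed
    exact ⟨_, hfull y, rfl⟩
  · simp only [List.mem_append, List.mem_map, ofMatrix, List.mem_ofFn]
    rintro _ (⟨i, rfl⟩ | ⟨v, hv, rfl⟩) <;> simp [hl]

theorem updateProj_of_eq_zero {n : ℕ} {D : ℤ} {P : Matrix (Fin n) (Fin n) ℤ} {v : Fin n → ℤ}
    (h : P.mulVec v = 0) : updateProj D (ofMatrix P) (List.ofFn v) = (D, ofMatrix P) := by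
  rw [updateProj, if_pos]
  rw [mulVec_ofMatrix, all_ofFn, h]
  simp

theorem updateProj_of_ne_zero {n : ℕ} {D : ℤ} {P : Matrix (Fin n) (Fin n) ℤ} {v : Fin n → ℤ}
    (h : P.mulVec v ≠ 0) : updateProj D (ofMatrix P) (List.ofFn v) =
      (v ⬝ᵥ P.mulVec v, ofMatrix (Matrix.of fun i j =>
        ((v ⬝ᵥ P.mulVec v) * P i j - P.mulVec v i * P.mulVec v j) / D)) := by
  rw [updateProj, if_neg]
  · rw [mulVec_ofMatrix, dot_ofFn, ofMatrix, zipWith_ofFn]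
    simp only [zipWith_ofFn]
    rfl
  · rw [mulVec_ofMatrix, all_ofFn]
    intro h'
    exact h (funext fun i => by simpa using h' i)

variable {S : Type*} {k n : ℕ} {A : QAutomaton S n} (I : A.IntForm) (e : Fin k ≃ S)

theorem exists_updateProj {W : List (List S)} {D : ℤ} {P : Matrix (Fin n) (Fin n) ℤ}
    (h : I.RankInv W D P) (w : List S) :
    ∃ D' P', updateProj D (ofMatrix P) (List.ofFn (I.vec w)) = (D', ofMatrix P') ∧
      I.RankInv (w :: W) D' P' := by
  by_cases hw : P.mulVec (I.vec w) = 0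
  · exact ⟨_, _, updateProj_of_eq_zero hw, h.cons_of_eq_zero I hw⟩
  · exact ⟨_, _, updateProj_of_ne_zero hw, h.cons_of_ne_zero I hw⟩

/-- A word as a list of numbers. -/
def wordList (w : List S) : List ℤ := w.map fun σ => ((e.symm σ : ℕ) : ℤ)

theorem wordList_concat (w : List S) (σ : S) :
    wordList e (w ++ [σ]) = wordList e w ++ [((e.symm σ : ℕ) : ℤ)] := by
  simp [wordList]

/-- The matrices as they are stored by the algorithm. -/
def letterList : List (ℤ × List (List ℤ)) :=
  List.ofFn fun i : Fin k => (((i : ℕ) : ℤ), ofMatrix (I.trans (e i)).transpose)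

/-- The state `s` represents the words `W`, and its projection belongs to the words `W₀`. -/
structure Data (W₀ W : List (List S)) (P : Matrix (Fin n) (Fin n) ℤ) (m : ℕ) (s : State) :
    Prop where
  den : s.den = I.den
  letters : s.letters = letterList I e
  words : s.words = W.map fun w => (wordList e w, List.ofFn (I.vec w))
  isInt : ∀ w ∈ W, I.IsInt w ∧ w.length < W.length
  length_le : W.length ≤ m + 1
  length_le' : W₀.length ≤ n + 1
  isInt' : ∀ w ∈ W₀, I.IsInt w ∧ w.length ≤ n
  rankInv : I.RankInv W₀ s.det P
  proj : s.proj = ofMatrix P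
  lat : s.lat.length ≤ n ∧ ∀ r ∈ s.lat, r.length ≤ n ∧ ∀ x ∈ r, size x ≤ size s.det
  out : ∃ w, s.out = wordList e w ∧ w.length ≤ W.length

/-- The lattice of the state in the second loop. -/
structure LatData (W₀ W : List (List S)) (P : Matrix (Fin n) (Fin n) ℤ) (s : State) : Prop where
  subset : W₀ ⊆ W
  mem_span : ∀ w, A.forward w ∈ A.spanOf ℚ W₀
  isBasis : IsBasis s.det s.lat
  length_eq : s.lat.length = n
  lattice_eq : lattice s.lat = (Matrix.projLattice P (I.vecs W)).map embed

/-- The state of the algorithm represents the configuration of the procedure after `m` steps. -/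
def Sim (m : ℕ) : ZGenState S → State → Prop
  | .rankLoop W, s => s.phase = 0 ∧ s.lat = [] ∧ ∃ P, Data I e W W P m s
  | .moduleLoop W, s => s.phase = 1 ∧ ∃ W₀ P, Data I e W₀ W P m s ∧ LatData I W₀ W P s
  | .done (.generators W), s => s.phase = 2 ∧ ∃ W₀ P, Data I e W₀ W P m s
  | .done (.counterexample w), s => s.phase = 3 ∧ s.out = wordList e w ∧
      ∃ W₀ W P, Data I e W₀ W P m s

variable {I e} {W₀ W : List (List S)} {P : Matrix (Fin n) (Fin n) ℤ} {m : ℕ} {s : State}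

theorem Data.mem_candidates (h : Data I e W₀ W P m s) {c : List ℤ × List ℤ} :
    c ∈ candidates s ↔ ∃ w ∈ W, ∃ σ,
      c = (wordList e (w ++ [σ]), List.ofFn (I.next w σ)) := by
  simp only [candidates, h.words, h.letters, letterList, List.mem_flatMap, List.mem_map,
    List.mem_ofFn]
  constructor
  · rintro ⟨_, ⟨w, hw, rfl⟩, _, ⟨i, rfl⟩, rfl⟩
    exact ⟨w, hw, e i, by simp [wordList_concat, mulVec_ofMatrix, IntForm.next]⟩
  · rintro ⟨w, hw, σ, rfl⟩
    exact ⟨_, ⟨w, hw, rfl⟩, _, ⟨e.symm σ, rfl⟩,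
      by simp [wordList_concat, mulVec_ofMatrix, IntForm.next]⟩

theorem Data.rankNew_iff (h : Data I e W W P m s) {w : List S} (hw : w ∈ W) (σ : S) :
    rankNew s (wordList e (w ++ [σ]), List.ofFn (I.next w σ)) = true ↔
      A.forward (w ++ [σ]) ∉ A.spanOf ℚ W := by
  have h0 := I.den_ne_zero
  rw [h.rankInv.forward_mem_iff I (fun w hw => (h.isInt w hw).1) (mul_ne_zero h0 h0)
    fun i => (I.next_eq (h.isInt w hw).1 σ i).trans (mul_assoc _ _ _).symm]
  rw [rankNew, h.proj, mulVec_ofMatrix, Bool.not_eq_true', ← Bool.not_eq_true, all_ofFn, not_iff_not]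
  simp [funext_iff]

theorem dvdVec_ofFn {d : ℤ} {v : Fin n → ℤ} : dvdVec d (List.ofFn v) = true ↔ ∀ i, d ∣ v i := by
  rw [dvdVec, all_ofFn]
  simp only [decide_eq_true_eq, Int.dvd_iff_emod_eq_zero]

theorem divVec_next {w : List S} (h : I.IsInt w) {σ : S} (h' : I.IsInt (w ++ [σ])) :
    divVec I.den (List.ofFn (I.next w σ)) = List.ofFn (I.vec (w ++ [σ])) := by
  rw [divVec, List.map_ofFn]
  congr 1
  ext i
  simp [I.next_eq_mul h h' i, Int.mul_ediv_cancel_left _ I.den_pos.ne']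

theorem LatData.insert_iff (h : Data I e W₀ W P m s) (hl : LatData I W₀ W P s) {w : List S}
    (hw : I.IsInt w) : (IntList.insert s.det s.lat (List.ofFn (I.vec w))).2 = true ↔
      A.forward w ∉ A.spanOf ℤ W := by
  have h1 := (insert_spec h.rankInv.det_pos hl.isBasis
    (v := List.ofFn (I.vec w)) (by simp [hl.length_eq])).2.2
  rw [← Bool.not_eq_false, not_iff_not, h1, hl.lattice_eq, seq_ofFn,
    ← h.rankInv.mem_lattice_iff (fun w hw => (h.isInt' w hw).1) (fun w hw => (h.isInt w hw).1)
      hl.mem_span hw]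
  exact ⟨fun ⟨y, hy, hyx⟩ => embed_injective hyx ▸ hy, fun h => ⟨_, h, rfl⟩⟩

/-- A candidate not divisible by the denominator is certainly new; otherwise the division yields an
integral vector that the triangular basis can test. -/
theorem LatData.moduleNew_iff (h : Data I e W₀ W P m s) (hl : LatData I W₀ W P s) {w : List S}
    (hw : w ∈ W) (σ : S) :
    moduleNew s (wordList e (w ++ [σ]), List.ofFn (I.next w σ)) = true ↔
      A.forward (w ++ [σ]) ∉ A.spanOf ℤ W := by
  have hi := (h.isInt w hw).1
  rw [moduleNew, h.den]
  by_cases hd : I.IsInt (w ++ [σ])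
  · have : dvdVec I.den (List.ofFn (I.next w σ)) = true :=
      dvdVec_ofFn.2 ((I.isInt_concat_iff hi σ).1 hd)
    rw [divVec_next hi hd, this, Bool.not_true, Bool.false_or, hl.insert_iff h hd]
  · have : ¬ dvdVec I.den (List.ofFn (I.next w σ)) = true := by
      rw [dvdVec_ofFn, ← I.isInt_concat_iff hi σ]; exact hd
    simp only [this, Bool.not_false, Bool.true_or, true_iff]
    exact fun h' => hd (I.isInt_of_mem_spanOf (fun w hw => (h.isInt w hw).1) h')

theorem choice_mem (h : ¬ (newCandidates s).isEmpty = true) : choice s ∈ newCandidates s := by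
  rw [choice]
  cases hn : newCandidates s with
  | nil => simp [hn] at h
  | cons c l => simp

end ZGen

/-! ### Simulation of the procedure step by step. -/

namespace ZGen
open IntList QAutomaton

variable {S : Type*} {k n : ℕ} {A : QAutomaton S n} {I : A.IntForm} {e : Fin k ≃ S}
  {W₀ W : List (List S)} {P : Matrix (Fin n) (Fin n) ℤ} {m : ℕ} {s : State}

theorem Data.succ (h : Data I e W₀ W P m s) : Data I e W₀ W P (m + 1) s :=
  { h with length_le := h.length_le.trans (Nat.le_succ _) }

theorem Data.return_ (h : Data I e W₀ W P m s) {w : List S} (hw : w ∈ W) (σ : S)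
    {c : List ℤ × List ℤ} (hc : c.1 = wordList e (w ++ [σ])) :
    Data I e W₀ W P (m + 1) (return_ s c) :=
  { h.succ with out := ⟨w ++ [σ], hc, by simpa using (h.isInt w hw).2⟩ }

theorem Data.moduleExit (h : Data I e W₀ W P m s) : Data I e W₀ W P (m + 1) (moduleExit s) :=
  { h.succ with }

theorem isInt_cons {w : List S} {σ : S} (h : ∀ w ∈ W, I.IsInt w ∧ w.length < W.length) (hw : w ∈ W)
    (hi : I.IsInt (w ++ [σ])) :
    ∀ w' ∈ (w ++ [σ]) :: W, I.IsInt w' ∧ w'.length < ((w ++ [σ]) :: W).length := by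
  intro w' hw'
  rcases List.mem_cons.1 hw' with rfl | hw'
  · exact ⟨hi, by simpa using (h _ hw).2⟩
  · exact ⟨(h _ hw').1, (h _ hw').2.trans (by simp)⟩

theorem transpose_eq_of_rankInv {D : ℤ} (h : I.RankInv W D P) : P.transpose = P := by
  obtain ⟨ι, _, _, U, -, -, -, -, -, rfl⟩ := h
  exact Matrix.transpose_gramProj U

theorem rankLoop_exit (hrun : ZGenRun A m (.rankLoop W)) (h : Data I e W W P m s)
    (hclosed : ∀ w ∈ W, ∀ σ : S, A.forward (w ++ [σ]) ∈ A.spanOf ℚ W) :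
    Data I e W W P (m + 1) (rankExit s) ∧ LatData I W W P (rankExit s) := by
  have hD := h.rankInv.det_pos
  have hV : s.proj ++ s.words.map (fun w => w.2) =
      ofMatrix P ++ (W.map I.vec).map List.ofFn := by
    rw [h.proj, h.words, List.map_map, List.map_map]; rfl
  have hl : (s.proj.map fun _ => (0 : ℤ)).length = n := by simp [h.proj, ofMatrix]
  have hrows := initLat_rows s.det (s.proj ++ s.words.map fun w => w.2) (s.proj.map fun _ => 0)
  rw [hl] at hrows
  have hset : {v | v ∈ W.map I.vec} = I.vecs W := by
    ext v; simp [IntForm.vecs]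
  refine ⟨{ h.succ with lat := ⟨hrows.1.le, hrows.2⟩ }, fun _ h => h,
    forward_mem_of_closed_rat (I.runInv hrun).1 hclosed, ?_, hrows.1, ?_⟩
  · refine (initLat_spec hD _ _ ?_).1
    rw [hV, hl]
    simp only [List.mem_append, List.mem_map, ofMatrix, List.mem_ofFn]
    rintro _ (⟨i, rfl⟩ | ⟨v, hv, rfl⟩) <;> simp
  · change lattice (initLat s.det _ _) = _
    rw [hV, lattice_initLat hD (transpose_eq_of_rankInv h.rankInv) ?_ hl, hset]
    rw [hset]
    exact h.rankInv.smul_mem fun _ h => h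

theorem rankLoop_add (hrun : ZGenRun A m (.rankLoop W)) (h : Data I e W W P m s)
    (hlat : s.lat = []) {w : List S} (hw : w ∈ W) {σ : S} (hnew : A.forward (w ++ [σ]) ∉ A.spanOf ℚ W)
    (hint : IsIntegerVector (A.forward (w ++ [σ]))) :
    ∃ P', Data I e ((w ++ [σ]) :: W) ((w ++ [σ]) :: W) P' (m + 1)
      (rankAdd s (wordList e (w ++ [σ]), List.ofFn (I.next w σ))) := by
  -- The invariant of the prolonged run supplies the bounds on the number and the length of the
  -- words after the addition.
  obtain ⟨-, h2, h3, h4⟩ := I.runInv (hrun.step (.rank_add hw hnew hint))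
  have h4 := h4.trans (IntForm.finrank_spanOf_le _)
  have hi := I.isInt_of_isIntegerVector hint
  obtain ⟨D', P', h5, h6⟩ := exists_updateProj I h.rankInv (w ++ [σ])
  have h7 : updateProj s.det s.proj (divVec s.den (List.ofFn (I.next w σ))) = (D', ofMatrix P') := by
    rw [h.den, divVec_next (h.isInt w hw).1 hi, h.proj, h5]
  refine ⟨P', ⟨h.den, h.letters, ?_, isInt_cons h.isInt hw hi, h2.le, by omega,
    fun w hw => ⟨(h3 w hw).1, (h3 w hw).2.trans h4⟩, ?_, ?_, ?_, ?_⟩⟩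
  · simp only [rankAdd, List.map_cons, h.words, h.den, divVec_next (h.isInt w hw).1 hi]
  · simpa only [rankAdd, h7] using h6
  · simp only [rankAdd, h7]
  · simp [rankAdd, hlat]
  · obtain ⟨w', h9, h10⟩ := h.out
    exact ⟨w', h9, h10.trans (by simp)⟩

theorem moduleLoop_add (h : Data I e W₀ W P m s) (hl : LatData I W₀ W P s) {w : List S}
    (hw : w ∈ W) {σ : S} (hint : IsIntegerVector (A.forward (w ++ [σ]))) :
    Data I e W₀ ((w ++ [σ]) :: W) P (m + 1)
      (moduleAdd s (wordList e (w ++ [σ]), List.ofFn (I.next w σ))) ∧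
    LatData I W₀ ((w ++ [σ]) :: W) P
      (moduleAdd s (wordList e (w ++ [σ]), List.ofFn (I.next w σ))) := by
  have hi := I.isInt_of_isIntegerVector hint
  have hdiv := divVec_next (h.isInt w hw).1 hi
  have hlat : (moduleAdd s (wordList e (w ++ [σ]), List.ofFn (I.next w σ))).lat =
      (IntList.insert s.det s.lat (List.ofFn (I.vec (w ++ [σ])))).1 := by
    simp only [moduleAdd, h.den, hdiv]
  have hrow := forall₂_insert s.det s.lat (List.ofFn (I.vec (w ++ [σ])))
  obtain ⟨h1, h2, -⟩ := insert_spec h.rankInv.det_pos hl.isBasis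
    (v := List.ofFn (I.vec (w ++ [σ]))) (by simp [hl.length_eq])
  refine ⟨⟨h.den, h.letters, ?_, isInt_cons h.isInt hw hi, ?_, h.length_le', h.isInt', h.rankInv,
    h.proj, ?_, ?_⟩, ⟨fun x hx => List.mem_cons_of_mem _ (hl.subset hx), hl.mem_span, ?_, ?_, ?_⟩⟩
  · simp only [moduleAdd, List.map_cons, h.words, h.den, hdiv]
  · simpa using h.length_le
  · rw [hlat]
    refine ⟨hrow.length_eq ▸ h.lat.1, fun r hr => ?_⟩
    obtain ⟨i, hi, rfl⟩ := List.mem_iff_getElem.1 hr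
    have hb := hrow.get (by rw [hrow.length_eq]; exact hi) hi
    obtain ⟨h3, h4⟩ := h.lat.2 _ (List.getElem_mem (by rw [hrow.length_eq]; exact hi))
    exact ⟨hb.1.trans h3, fun x hx => (hb.2 x hx).elim (h4 x) id⟩
  · obtain ⟨w', h9, h10⟩ := h.out
    exact ⟨w', h9, h10.trans (by simp)⟩
  · rw [hlat]; exact h1
  · rw [hlat, ← hrow.length_eq, hl.length_eq]
  · rw [hlat, h2, IntForm.vecs_cons, Matrix.projLattice_insert, Submodule.map_sup,
      Submodule.map_span, Set.image_singleton, seq_ofFn, hl.lattice_eq]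

/-- The filtered candidates are exactly the pairs allowed by the guard. The first of them is an
admissible choice, and an empty list means that the guard fails. -/
theorem Sim.step {z : ZGenState S} (hrun : ZGenRun A m z) (h : Sim I e m z s)
    (hr : running s = true) : ∃ z', ZGenStep A z z' ∧ Sim I e (m + 1) z' (step s) := by
  rw [running, decide_eq_true_eq] at hr
  match z, h with
  | .rankLoop W, ⟨hp, hlat, P, h⟩ =>
    have hn : newCandidates s = (candidates s).filter (rankNew s) := if_pos hp
    by_cases hc : (newCandidates s).isEmpty = true
    · have hclosed : ∀ w ∈ W, ∀ σ : S, A.forward (w ++ [σ]) ∈ A.spanOf ℚ W := by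
        intro w hw σ
        by_contra hw'
        rw [hn, List.isEmpty_iff, List.filter_eq_nil_iff] at hc
        exact hc _ (h.mem_candidates.2 ⟨w, hw, σ, rfl⟩) ((h.rankNew_iff hw σ).2 hw')
      refine ⟨_, .rank_exit hclosed, ?_⟩
      rw [ZGen.step, if_pos hc, if_pos hp]
      exact ⟨rfl, W, P, rankLoop_exit hrun h hclosed⟩
    · have hmem := choice_mem hc
      rw [ZGen.step, if_neg hc]
      rw [hn, List.mem_filter, h.mem_candidates] at hmem
      obtain ⟨⟨w, hw, σ, hcw⟩, hnew⟩ := hmem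
      rw [hcw, h.rankNew_iff hw σ] at hnew
      have hdvd := (dvdVec_ofFn (d := I.den * I.den) (v := I.next w σ)).trans
        (I.isIntegerVector_iff (h.isInt w hw).1 σ).symm
      rw [hcw, h.den]
      split
      · rename_i hd
        have hint := hdvd.1 hd
        obtain ⟨P', h'⟩ := rankLoop_add hrun h hlat hw hnew hint
        refine ⟨_, .rank_add hw hnew hint, ?_⟩
        exact ⟨hp, hlat, P', h'⟩
      · rename_i hd
        exact ⟨_, .rank_return hw hnew (mt hdvd.2 hd), rfl, rfl, W, W, P, h.return_ hw σ rfl⟩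
  | .moduleLoop W, ⟨hp, W₀, P, h, hl⟩ =>
    have hp0 : s.phase ≠ 0 := by omega
    have hn : newCandidates s = (candidates s).filter (moduleNew s) := if_neg hp0
    by_cases hc : (newCandidates s).isEmpty = true
    · have hclosed : ∀ w ∈ W, ∀ σ : S, A.forward (w ++ [σ]) ∈ A.spanOf ℤ W := by
        intro w hw σ
        by_contra hw'
        rw [hn, List.isEmpty_iff, List.filter_eq_nil_iff] at hc
        exact hc _ (h.mem_candidates.2 ⟨w, hw, σ, rfl⟩) ((hl.moduleNew_iff h hw σ).2 hw')
      refine ⟨_, .module_exit hclosed, ?_⟩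
      rw [ZGen.step, if_pos hc, if_neg hp0]
      exact ⟨rfl, W₀, P, h.moduleExit⟩
    · have hmem := choice_mem hc
      rw [ZGen.step, if_neg hc]
      rw [hn, List.mem_filter, h.mem_candidates] at hmem
      obtain ⟨⟨w, hw, σ, hcw⟩, hnew⟩ := hmem
      rw [hcw, hl.moduleNew_iff h hw σ] at hnew
      have hdvd := (dvdVec_ofFn (d := I.den * I.den) (v := I.next w σ)).trans
        (I.isIntegerVector_iff (h.isInt w hw).1 σ).symm
      rw [hcw, h.den]
      split
      · rename_i hd
        have hint := hdvd.1 hd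
        refine ⟨_, .module_add hw hnew hint, ?_⟩
        exact ⟨hp, W₀, P, moduleLoop_add h hl hw hint⟩
      · rename_i hd
        exact ⟨_, .module_return hw hnew (mt hdvd.2 hd), rfl, rfl, W₀, W, P, h.return_ hw σ rfl⟩
  | .done (.generators W), ⟨hp, _⟩ => omega
  | .done (.counterexample w), ⟨hp, _⟩ => omega

end ZGen

/-! ## The initial state -/

namespace ZGen
open IntList QAutomaton

variable {S : Type*} {k n : ℕ}

/-- The automaton as the input of the algorithm. -/
def input (e : Fin k ≃ S) (A : QAutomaton S n) : Input :=
  (n, k, List.ofFn A.init, List.ofFn fun i => List.ofFn fun r => List.ofFn (A.trans (e i) r),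
    List.ofFn A.final, 0)

theorem enc_ofFn {α : Type*} [DatumEnc α] (v : Fin n → α) :
    enc (List.ofFn v) = .list (List.ofFn fun i => enc (v i)) :=
  congrArg Datum.list List.map_ofFn

/-- Tuples are nested pairs and lists are nested pairs closed by `0`; the last component of `Input`
is that closing `0`. -/
theorem enc_input (e : Fin k ≃ S) (A : QAutomaton S n) : enc (input e A) = A.encode e := by
  simp only [input, enc_mk, enc_ofFn]
  rfl

theorem scale_eq {d : ℤ} {q : ℚ} (h : (q.den : ℤ) ∣ d) : (scale d q : ℚ) = d * q := by
  obtain ⟨c, rfl⟩ := h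
  have h0 : (q.den : ℤ) ≠ 0 := by exact_mod_cast q.den_ne_zero
  have h1 : (q.den : ℚ) ≠ 0 := by exact_mod_cast q.den_ne_zero
  rw [scale, Int.mul_ediv_cancel_left _ h0]
  push_cast
  have h2 : (q.num : ℚ) = q * q.den := (Rat.mul_den_eq_num q).symm
  rw [h2]
  ring

/-- The integral form of an automaton that the algorithm uses. -/
def intForm (e : Fin k ≃ S) (A : QAutomaton S n) : A.IntForm where
  den := inputDen (input e A)
  den_pos := by
    refine mul_pos (List.prod_pos ?_) (List.prod_pos ?_) <;>
      simp only [List.mem_map, List.mem_flatMap]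
    · rintro _ ⟨q, -, rfl⟩
      exact_mod_cast q.den_pos
    · rintro _ ⟨_, -, _, -, q, -, rfl⟩
      exact_mod_cast q.den_pos
  init i := scale (inputDen (input e A)) (A.init i)
  trans σ := Matrix.of fun i j => scale (inputDen (input e A)) (A.trans σ i j)
  init_eq i := scale_eq <| Dvd.dvd.mul_right (List.dvd_prod <| by
    simp only [input, List.mem_map, List.mem_ofFn]
    exact ⟨_, ⟨i, rfl⟩, rfl⟩) _
  trans_eq σ i j := scale_eq <| Dvd.dvd.mul_left (List.dvd_prod <| by
    simp only [input, List.mem_map, List.mem_flatMap]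
    exact ⟨_, List.mem_ofFn.2 ⟨e.symm σ, rfl⟩, _, List.mem_ofFn.2 ⟨i, rfl⟩, _,
      List.mem_ofFn.2 ⟨j, rfl⟩, by rw [e.apply_symm_apply]⟩) _

theorem inputInit_input (e : Fin k ≃ S) (A : QAutomaton S n) :
    inputInit (input e A) = List.ofFn (intForm e A).init := by
  rw [inputInit, input, List.map_ofFn]; rfl

theorem indices_ofFn {α : Type} (v : Fin n → α) :
    indices (List.ofFn v) = List.ofFn fun i : Fin n => ((i : ℕ) : ℤ) := by
  rw [indices_eq, List.length_ofFn]
  refine List.ext_getElem (by simp) fun i h1 h2 => ?_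
  simp

theorem letters_start (e : Fin k ≃ S) (A : QAutomaton S n) :
    (start (input e A)).letters = letterList (intForm e A) e := by
  simp only [start, input, indices_ofFn, zipWith_ofFn, letterList, List.map_ofFn]
  congr 1
  funext i
  refine congrArg (Prod.mk _) ?_
  rw [← transpose_ofMatrix, ofMatrix]
  congr 2
  funext r
  simp only [Function.comp_apply, List.map_ofFn]
  rfl

theorem identity_ofFn {α : Type} (v : Fin n → α) :
    identity (List.ofFn v) = ofMatrix (1 : Matrix (Fin n) (Fin n) ℤ) := by
  have h : ∀ m, m = n → ofMatrix (1 : Matrix (Fin m) (Fin m) ℤ) =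
      ofMatrix (1 : Matrix (Fin n) (Fin n) ℤ) := by rintro m rfl; rfl
  rw [identity_eq, h _ (by simp)]

theorem sim_start (e : Fin k ≃ S) (A : QAutomaton S n) :
    Sim (intForm e A) e 0 (.rankLoop [[]]) (start (input e A)) := by
  -- The initial data arise by inserting `ε` into the empty family, whose Gram determinant and
  -- projection are `1`; this also covers `α = 0`.
  obtain ⟨D, P, h1, h2⟩ := exists_updateProj (intForm e A) (intForm e A).rankInv_nil []
  rw [IntForm.vec_nil, ← inputInit_input, ← identity_ofFn A.init] at h1
  change updateProj 1 (identity (input e A).2.2.1) (inputInit (input e A)) = _ at h1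
  refine ⟨rfl, rfl, P, rfl, letters_start e A, ?_, ?_, by simp, by simp, ?_, ?_, ?_, ?_,
    [], rfl, by simp⟩
  · simp [start, wordList, IntForm.vec_nil, inputInit_input]
  · simp [IntForm.isInt_nil]
  · simp [IntForm.isInt_nil]
  · simpa only [start, h1] using h2
  · simp only [start, h1]
  · simp [start]

/-! ## The size of the states -/

/-- A bound for the binary length of the numbers in an integral form. -/
def bitBound (x : Input) : ℕ := size (start x) + size x

theorem size_start (x : Input) : size (start x).den + size (start x).letters +
    size (start x).words < size (start x) := by
  change _ < size (start x).toTuple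
  simp only [State.toTuple, size_mk]
  omega

theorem natAbs_le_of_size_le {z : ℤ} {b : ℕ} (h : size z ≤ b) : z.natAbs ≤ 2 ^ b := by
  have h1 := natAbs_lt_two_pow_size z
  have h2 : 2 ^ (size z - 1) ≤ 2 ^ b := Nat.pow_le_pow_right (by norm_num) (by omega)
  omega

theorem length_init (e : Fin k ≃ S) (A : QAutomaton S n) : (input e A).2.2.1.length = n := by
  simp [input]

/-- The denominator, the scaled `α` and the scaled matrices all occur in the initial state, so its
size bounds their binary lengths. The dimension is below the size of the encoded `α`. -/
theorem bdd_intForm (e : Fin k ≃ S) (A : QAutomaton S n) :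
    (intForm e A).Bdd (bitBound (input e A)) := by
  have hs := size_start (input e A)
  have hb : size (start (input e A)) ≤ bitBound (input e A) := Nat.le_add_right _ _
  refine ⟨?_, natAbs_le_of_size_le (?_ : size (start (input e A)).den ≤ _), fun i => ?_,
    fun σ i j => ?_⟩
  · have h1 := length_lt_size (input e A).2.2.1
    rw [length_init] at h1
    have h2 : size (input e A).2.2.1 ≤ size (input e A) := by
      simp only [input, size_mk]; omega
    have h3 : n < 2 ^ n := Nat.lt_two_pow_self
    have h4 : 2 ^ n ≤ 2 ^ bitBound (input e A) :=
      Nat.pow_le_pow_right (by norm_num) (by rw [bitBound]; omega)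
    omega
  · omega
  · refine natAbs_le_of_size_le ?_
    have h1 : size ((intForm e A).init i) < size (inputInit (input e A)) := by
      rw [inputInit_input]
      exact size_le_of_mem (List.mem_ofFn.2 ⟨i, rfl⟩)
    have h2 : size (start (input e A)).words = 1 + size (inputInit (input e A)) + 1 + 1 + 1 := rfl
    omega
  · refine natAbs_le_of_size_le ?_
    have h1 : size ((intForm e A).trans σ i j) <
        size (List.ofFn (((intForm e A).trans (e (e.symm σ))).transpose j)) := by
      rw [e.apply_symm_apply]
      exact size_le_of_mem (List.mem_ofFn.2 ⟨i, rfl⟩)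
    have h2 := size_le_of_mem (l := ofMatrix ((intForm e A).trans (e (e.symm σ))).transpose)
      (List.mem_ofFn.2 ⟨j, rfl⟩)
    have h3 := size_le_of_mem (l := letterList (intForm e A) e) (List.mem_ofFn.2 ⟨e.symm σ, rfl⟩)
    rw [← letters_start] at h3
    simp only [size_mk] at h3
    omega

/-- A bound for the size of the numbers in the projection. -/
def projBound (n b : ℕ) : ℕ := IntForm.gramExp n b + 2 * (n + 1) + 2 * (2 * b + 2 * b * n) + 3

/-- A bound for the size of a state after `m` steps. -/
def stateBound (n b m : ℕ) : ℕ :=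
  (b + 2) + b + 3 + ((m + 1) * (((m + 1) * (b + 1) + 1) +
    (n * (2 * b + 2 * b * (m + 1) + 2 + 1) + 1) + 1 + 1) + 1) + projBound n b +
    (n * (n * (projBound n b + 1) + 2) + 1) + (n * (n * (projBound n b + 1) + 2) + 1) +
    ((m + 1) * (b + 1) + 1) + 7

theorem size_le_of_natAbs_le {z : ℤ} {b : ℕ} (h : z.natAbs ≤ 2 ^ b) : size z ≤ b + 2 :=
  size_int_le (h.trans_lt (Nat.pow_lt_pow_right (by norm_num) (Nat.lt_succ_self b)))

variable {A : QAutomaton S n} {I : A.IntForm} {e : Fin k ≃ S}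
  {W₀ W : List (List S)} {P : Matrix (Fin n) (Fin n) ℤ} {b m : ℕ} {s : State}

theorem size_wordList_le (hQ : size (letterList I e) ≤ b) {w : List S} (hw : w.length ≤ m) :
    size (wordList e w) ≤ m * (b + 1) + 1 := by
  refine (size_list_le (B := b) ?_).trans ?_
  · simp only [wordList, List.mem_map]
    rintro _ ⟨σ, -, rfl⟩
    have h := size_le_of_mem (l := letterList I e) (List.mem_ofFn.2 ⟨e.symm σ, rfl⟩)
    rw [size_mk] at h
    omega
  · rw [wordList, List.length_map]
    gcongr

/-- Word lengths and hence vector entries are controlled by the number of steps, determinant and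
projection by `RankInv.bounds`, and the triangular basis by the size of the determinant. -/
theorem Data.size_le (h : Data I e W₀ W P m s) (hb : I.Bdd b) (hQ : size (letterList I e) ≤ b)
    (hp : size s.phase ≤ 3) : size s ≤ stateBound n b m := by
  obtain ⟨hD, hP⟩ := h.rankInv.bounds hb h.length_le' h.isInt'
  have h1 : size s.den ≤ b + 2 := h.den ▸ size_le_of_natAbs_le hb.den
  have h2 : size s.letters ≤ b := h.letters ▸ hQ
  have h3 : size s.words ≤ (m + 1) * (((m + 1) * (b + 1) + 1) +
      (n * (2 * b + 2 * b * (m + 1) + 2 + 1) + 1) + 1 + 1) + 1 := by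
    rw [h.words]
    refine (size_list_le (B := ((m + 1) * (b + 1) + 1) +
      (n * (2 * b + 2 * b * (m + 1) + 2 + 1) + 1) + 1) ?_).trans ?_
    · simp only [List.mem_map]
      rintro _ ⟨w, hw, rfl⟩
      obtain ⟨h4, h5⟩ := h.isInt w hw
      have h6 : w.length ≤ m + 1 := h5.le.trans h.length_le
      rw [size_mk]
      gcongr
      · exact size_wordList_le hQ h6
      · refine (size_list_le (B := 2 * b + 2 * b * (m + 1) + 2) ?_).trans (by simp)
        simp only [List.mem_ofFn]
        rintro _ ⟨i, rfl⟩
        refine size_le_of_natAbs_le ((hb.natAbs_vec_le h4 i).trans ?_)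
        exact Nat.pow_le_pow_right (by norm_num) (by gcongr)
    · rw [List.length_map]
      have := h.length_le
      gcongr
  have h4 : size s.det ≤ projBound n b := by
    have := size_le_of_natAbs_le hD
    rw [projBound]; omega
  have h5 : size s.proj ≤ n * (n * (projBound n b + 1) + 2) + 1 := by
    rw [h.proj]
    refine size_nested_le (by simp [ofMatrix]) ?_
    simp only [ofMatrix, List.mem_ofFn]
    rintro _ ⟨i, rfl⟩
    refine ⟨by simp, fun x hx => ?_⟩
    obtain ⟨j, rfl⟩ := List.mem_ofFn.1 hx
    exact size_le_of_natAbs_le (hP i j)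
  have h6 : size s.lat ≤ n * (n * (projBound n b + 1) + 2) + 1 :=
    size_nested_le h.lat.1 fun r hr => ⟨(h.lat.2 r hr).1, fun x hx => ((h.lat.2 r hr).2 x hx).trans h4⟩
  have h7 : size s.out ≤ (m + 1) * (b + 1) + 1 := by
    obtain ⟨w, hw, hl⟩ := h.out
    exact hw ▸ size_wordList_le hQ (hl.trans h.length_le)
  change size s.toTuple ≤ _
  simp only [State.toTuple, size_mk, stateBound]
  omega

theorem Sim.size_le {z : ZGenState S} (h : Sim I e m z s) (hb : I.Bdd b)
    (hQ : size (letterList I e) ≤ b) : size s ≤ stateBound n b m := by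
  match z, h with
  | .rankLoop W, ⟨hp, _, P, h⟩ => exact h.size_le hb hQ (by rw [hp]; decide)
  | .moduleLoop W, ⟨hp, W₀, P, h, _⟩ => exact h.size_le hb hQ (by rw [hp]; decide)
  | .done (.generators W), ⟨hp, W₀, P, h⟩ => exact h.size_le hb hQ (by rw [hp]; decide)
  | .done (.counterexample w), ⟨hp, _, W₀, W, P, h⟩ => exact h.size_le hb hQ (by rw [hp]; decide)

/-! ## The run of the algorithm -/

theorem enc_wordList (w : List S) : enc (wordList e w) = Datum.word e w := by
  simp only [wordList, Datum.word]
  exact congrArg Datum.list (List.map_map ..)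

theorem Sim.output_eq {out : ZGenOutput S} (h : Sim I e m (.done out) s) :
    output s = out.encode e := by
  match out, h with
  | .generators W, ⟨hp, W₀, P, h⟩ =>
    rw [output, if_pos hp, h.words, List.map_map]
    refine congrArg (Datum.pair (.int 0) ∘ Datum.list) ?_
    rw [List.map_map]
    exact List.map_congr_left fun w _ => enc_wordList w
  | .counterexample w, ⟨hp, ho, _⟩ =>
    rw [output, if_neg (by omega), ho]
    exact congrArg (Datum.pair (.int 1)) (enc_wordList w)

theorem Sim.exists_done {z : ZGenState S} (h : Sim I e m z s) (hr : running s = false) :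
    ∃ out, z = .done out := by
  rw [running, decide_eq_false_iff_not] at hr
  match z, h with
  | .rankLoop W, ⟨hp, _⟩ => omega
  | .moduleLoop W, ⟨hp, _⟩ => omega
  | .done out, _ => exact ⟨out, rfl⟩

theorem exists_sim (hs : Sim I e 0 (.rankLoop [[]]) s) :
    ∀ i, (∀ j < i, running (step^[j] s) = true) →
      ∃ z, ZGenRun A i z ∧ Sim I e i z (step^[i] s)
  | 0, _ => ⟨_, .start, hs⟩
  | i + 1, h => by
    obtain ⟨z, h1, h2⟩ := exists_sim hs i fun j hj => h j (by omega)
    obtain ⟨z', h3, h4⟩ := h2.step h1 (h i (by omega))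
    rw [Function.iterate_succ_apply']
    exact ⟨z', h1.step h3, h4⟩

theorem exists_iterate (hs : Sim I e 0 (.rankLoop [[]]) s) (hb : I.Bdd b) :
    ∃ N ≤ n + 2 + IntForm.gramExp n b * n, (∀ j < N, running (step^[j] s) = true) ∧
      running (step^[N] s) = false := by
  have h : ∃ N, running (step^[N] s) = false := by
    by_contra! h
    -- If the program never stopped, it would simulate a run longer than the bound valid for all
    -- runs.
    obtain ⟨z, h1, -⟩ := exists_sim hs (n + 2 + IntForm.gramExp n b * n + 1) fun j _ => by simpa using h j
    have := I.run_le h1 hb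
    omega
  classical
  have hN : ∀ j < Nat.find h, running (step^[j] s) = true := fun j hj => by
    simpa using Nat.find_min h hj
  obtain ⟨z, h1, -⟩ := exists_sim hs _ hN
  exact ⟨Nat.find h, I.run_le h1 hb, hN, Nat.find_spec h⟩

/-- A bound for the number of steps. -/
def stepBound (x : Input) : ℕ :=
  x.2.2.1.length + 2 + IntForm.gramExp x.2.2.1.length (bitBound x) * x.2.2.1.length

theorem polyBdd_length : PolyBdd size fun x : Input => x.2.2.1.length :=
  (PolyTime.fst.comp (PolyTime.snd.comp PolyTime.snd)).length_bdd

theorem polyBdd_bitBound : PolyBdd size bitBound := PolyTime.zgen_start.size_bdd.add .self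

theorem polyBdd_gramExp : PolyBdd size fun x => IntForm.gramExp x.2.2.1.length (bitBound x) := by
  have hn := polyBdd_length
  have hb := (PolyBdd.const 2).mul polyBdd_bitBound
  have h := hb.add (hb.mul hn)
  exact (hn.add (.const 1)).mul ((hn.add (.const 1)).add ((hn.add h).add h))

theorem polyBdd_stepBound : PolyBdd size stepBound :=
  (polyBdd_length.add (.const 2)).add (polyBdd_gramExp.mul polyBdd_length)

theorem polyBdd_stateBound :
    PolyBdd size fun x => stateBound x.2.2.1.length (bitBound x) (stepBound x) := by
  have hn := polyBdd_length
  have hb := polyBdd_bitBound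
  have hm := polyBdd_stepBound.add (.const 1)
  have h2 := (PolyBdd.const 2).mul hb
  have hw := (hm.mul (hb.add (.const 1))).add (.const 1)
  have hp : PolyBdd size fun x => projBound x.2.2.1.length (bitBound x) :=
    ((polyBdd_gramExp.add ((PolyBdd.const 2).mul (hn.add (.const 1)))).add
      ((PolyBdd.const 2).mul (h2.add (h2.mul hn)))).add (.const 3)
  have hP := (hn.mul ((hn.mul (hp.add (.const 1))).add (.const 2))).add (.const 1)
  have hv := (hn.mul (((h2.add (h2.mul hm)).add (.const 2)).add (.const 1))).add (.const 1)
  exact ((((((((hb.add (.const 2)).add hb).add (.const 3)).add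
    ((hm.mul (((hw.add hv).add (.const 1)).add (.const 1))).add (.const 1))).add hp).add hP).add
    hP).add hw).add (.const 7)

theorem stateBound_mono {m' : ℕ} (h : m ≤ m') : stateBound n b m ≤ stateBound n b m' := by
  unfold stateBound; gcongr

/-- A program for the procedure. -/
theorem exists_program : ∃ (P : WhileProgram) (p : Polynomial ℕ),
    ∀ {k n : ℕ} {S : Type*} (e : Fin k ≃ S) (A : QAutomaton S n), ∃ out t,
      ZGenReturns A out ∧ P.Halts (A.encode e) (out.encode e) t ∧ t ≤ p.eval (A.encode e).size := by
  obtain ⟨P₁, p₁, h₁⟩ := PolyTime.zgen_start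
  obtain ⟨P₂, p₂, h₂⟩ := PolyTime.exists_loop PolyTime.zgen_running PolyTime.zgen_step
  obtain ⟨P₃, p₃, h₃⟩ := PolyTime.zgen_output
  obtain ⟨p, hp⟩ := ((PolyBdd.self (s := size (α := Input))).eval p₁).add
    (((polyBdd_stepBound.add (.const 1)).mul (polyBdd_stateBound.eval p₂)).add
      (polyBdd_stateBound.eval p₃))
  refine ⟨.seq P₁ (.seq P₂ P₃), p, fun {k n S} e A => ?_⟩
  have hx := hp (input e A)
  simp only [length_init] at hx
  have hQ : size (letterList (intForm e A) e) ≤ bitBound (input e A) := by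
    rw [← letters_start, bitBound]
    have := size_start (input e A)
    omega
  have hb := bdd_intForm e A
  have hm : stepBound (input e A) = n + 2 + IntForm.gramExp n (bitBound (input e A)) * n := by
    rw [stepBound, length_init]
  obtain ⟨N, hN, hr, hr'⟩ := exists_iterate (sim_start e A) hb
  rw [← hm] at hN
  -- Every state before the end represents a configuration after at most `stepBound` steps, so one
  -- size bound serves for all iterations.
  have hB : ∀ i ≤ N, size (step^[i] (start (input e A))) ≤
      stateBound n (bitBound (input e A)) (stepBound (input e A)) := fun i hi => by
    obtain ⟨z, -, h⟩ := exists_sim (sim_start e A) i fun j hj => hr j (by omega)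
    exact (h.size_le hb hQ).trans (stateBound_mono (by omega))
  obtain ⟨z, h4, h5⟩ := exists_sim (sim_start e A) N hr
  obtain ⟨out, rfl⟩ := h5.exists_done hr'
  obtain ⟨t₁, h6, h7⟩ := h₁ (input e A)
  obtain ⟨t₂, h8, h9⟩ := h₂ N _ _ hr hr' hB
  obtain ⟨t₃, h10, h11⟩ := h₃ (step^[N] (start (input e A)))
  rw [h5.output_eq] at h10
  rw [enc_input] at h6
  refine ⟨out, t₁ + (t₂ + t₃), ⟨N, h4⟩, .seq h6 (.seq h8 h10), ?_⟩
  have hsize : (A.encode e).size = size (input e A) := by rw [size, enc_input]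
  rw [hsize]
  refine le_trans ?_ hx
  gcongr
  · exact h9.trans (by gcongr)
  · exact h11.trans (p₃.eval_nat_mono (hB N le_rfl))

end ZGen

theorem mainTheorem9 :
    ∃ (p : Polynomial ℕ) (P : WhileProgram),
      ∀ (k n : ℕ) (S : Type*) (e : Fin k ≃ S) (A : QAutomaton S n),
        -- every run of the procedure stops, after polynomially many steps, with an output
        (∀ m s, ZGenRun A m s →
          m ≤ p.eval (A.encode e).size ∧
            ((∃ s', ZGenStep A s s') ∨ ∃ out, s = ZGenState.done out)) ∧
        -- every output that the procedure can return is correct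
        (∀ W : List (List S), ZGenReturns A (ZGenOutput.generators W) →
          A.spanOf ℤ W = A.forwardModule) ∧
        (∀ w : List S, ZGenReturns A (ZGenOutput.counterexample w) →
          ¬ IsIntegerVector (A.forward w)) ∧
        -- the program carries the procedure out in polynomial time
        (∃ (out : ZGenOutput S) (t : ℕ),
          ZGenReturns A out ∧
            P.Halts (A.encode e) (out.encode e) t ∧ t ≤ p.eval (A.encode e).size) := by
  obtain ⟨P, p, hP⟩ := ZGen.exists_program
  obtain ⟨q, hq⟩ := ZGen.polyBdd_stepBound
  -- One polynomial has to serve twice: `q` bounds the number of steps and `p` the cost of the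
  -- program.
  refine ⟨q + p, P, fun k n S e A => ⟨fun m s h => ⟨?_, A.exists_step s⟩, ?_, ?_, ?_⟩⟩
  · have h1 := (ZGen.intForm e A).run_le h (ZGen.bdd_intForm e A)
    have h2 := hq (ZGen.input e A)
    rw [ZGen.stepBound, ZGen.length_init, DatumEnc.size, ZGen.enc_input] at h2
    rw [Polynomial.eval_add]
    omega
  · rintro W ⟨m, h⟩
    exact ((ZGen.intForm e A).runInv h).1
  · rintro w ⟨m, h⟩
    exact ((ZGen.intForm e A).runInv h).1
  · obtain ⟨out, t, h1, h2, h3⟩ := hP e A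
    refine ⟨out, t, h1, h2, ?_⟩
    rw [Polynomial.eval_add]
    omega
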